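/- All vector spaces are over $\mathbb C$. Let $\ell\ge 1$. For a Lie superalgebra $\widetilde{\mathfrak g}$ let $\widetilde{\mathfrak g}_\ell=\widetilde{\mathfrak g}\otimes\mathbb C[\theta]/(\theta^{\ell+1})$ ($\theta$ even) be its $\ell$-th Takiff superalgebra, write $x^{(i)}=x\otimes\theta^i$, and $\mathfrak s_\ell=\mathfrak s\otimes\mathbb C[\theta]/(\theta^{\ell+1})$ for a subspace $\mathfrak s\subseteq\widetilde{\mathfrak g}$. Let $\mathfrak h$ be a Cartan subalgebra of $\widetilde{\mathfrak g}_{\bar 0}$, and for $\lambda\in\mathfrak h_\ell^*$ let $\lambda^{(i)}\in\mathfrak h^*$ be given by $\lambda^{(i)}(h)=\lambda(h^{(i)})$, $0\le i\le\ell$. For a Borel subalgebra $\mathfrak b=\mathfrak h\oplus\mathfrak n$, where $\mathfrak n$ is the sum of the root spaces for a positive system, a $\mathfrak b_\ell$-highest weight vector of weight $\lambda$ in a $\widetilde{\mathfrak g}_\ell$-module is a vector $v\ne0$ with $\mathfrak n_\ell v=0$ and $hv=\lambda(h)v$ for all $h\in\mathfrak h_\ell$. The category $\widetilde{\mathcal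 O}_\ell$ consists of the finitely generated $\widetilde{\mathfrak g}_\ell$-modules on which $\mathfrak h$ acts semisimply and $\widetilde{\mathfrak b}_\ell$ acts locally finitely, for a fixed Borel subalgebra $\widetilde{\mathfrak b}$. **Part 1 (basic classical case).** Let $\widetilde{\mathfrak g}$ be one of $\mathfrak{gl}(m|n)$, $\mathfrak{sl}(m|n)$ with $m\neq n$, $\mathfrak{osp}(m|2n)$, $D(2,1;a)$ (with $a\ne0,-1$), $G(3)$, $F(4)$. Let $\langle\cdot,\cdot\rangle$ be the bilinear form on $\mathfrak h^*$ induced by a non-degenerate even invariant supersymmetric bilinear form on $\widetilde{\mathfrak g}$. Let $\widetilde{\mathfrak b}=\mathfrak h\oplus\widetilde{\mathfrak n}$ be the Borel subalgebra with positive system $\Phi^+$ of an arbitrary triangular decomposition: for some $H\in\mathfrak h$ the weight spaces of $\widetilde{\mathfrak g}$ with $\operatorname{Re}\alpha(H)=0$ add up to $\mathfrak h$, and $\Phi^+$ is the set of roots with $\operatorname{Re}\alpha(H)>0$. Let $\alpha$ be a simple root of $\Phi^+$ (that is, not a sum of two positive roots) that is odd and isotropic ($\langle\alpha,\alpha\rangle=0$),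 let $\widetilde{\mathfrak b}(\alpha)$ be the Borel subalgebra with positive system $(\Phi^+\setminus\{\alpha\})\cup\{-\alpha\}$, and let $0\neq f_\alpha\in\widetilde{\mathfrak g}^{-\alpha}$. Let $L$ be a simple $\widetilde{\mathfrak g}_\ell$-module in $\widetilde{\mathcal O}_\ell$ with a $\widetilde{\mathfrak b}_\ell$-highest weight vector $v_\lambda$ of weight $\lambda\in\mathfrak h_\ell^*$. (i) If $0\le k\le\ell$, $\langle\lambda^{(k)},\alpha\rangle\neq0$ and $\langle\lambda^{(k+1)},\alpha\rangle=\dots=\langle\lambda^{(\ell)},\alpha\rangle=0$, then $f_\alpha^{(0)}f_\alpha^{(1)}\cdots f_\alpha^{(k)}v_\lambda$ is a $\widetilde{\mathfrak b}(\alpha)_\ell$-highest weight vector of $L$ (of some weight). (ii) If $\langle\lambda^{(k)},\alpha\rangle=0$ for all $0\le k\le\ell$, then $v_\lambda$ is a $\widetilde{\mathfrak b}(\alpha)_\ell$-highest weight vector of $L$. **Part 2 (periplectic case).** Let $\widetilde{\mathfrak g}=\mathfrak{pe}(n)$ be the Lie superalgebra of block matrices $\begin{pmatrix}A&B\\C&-A^t\end{pmatrix}$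 with $A,B,C\in\mathbb C^{n\times n}$, $B^t=B$, $C^t=-C$, let $\mathfrak h$ be its diagonal matrices, $\varepsilon_i\in\mathfrak h^*$ the $i$-th diagonal entry of $A$, and $\langle\varepsilon_i,\varepsilon_j\rangle=\delta_{ij}$. Let $\widetilde{\mathfrak b}$ be the distinguished Borel subalgebra, with positive roots $\varepsilon_i-\varepsilon_j$ $(i<j)$ and $\varepsilon_i+\varepsilon_j$ $(i\le j)$, and $\widetilde{\mathfrak b}^r$ the reverse one, with positive roots $\varepsilon_i-\varepsilon_j$ and $-\varepsilon_i-\varepsilon_j$ $(i<j)$. Let $$(\gamma_0,\dots,\gamma_{q-1})=(2\varepsilon_1,\ \varepsilon_1+\varepsilon_2,\ 2\varepsilon_2,\ \varepsilon_1+\varepsilon_3,\ \varepsilon_2+\varepsilon_3,\ 2\varepsilon_3,\ \dots,\ \varepsilon_{n-1}+\varepsilon_n,\ 2\varepsilon_n),$$ and let $\widetilde{\mathfrak b}^r=\mathfrak B^0,\mathfrak B^1,\dots,\mathfrak B^q=\widetilde{\mathfrak b}$ be the chain of Borel subalgebras in which the positive system of $\mathfrak B^{p+1}$ arises from that of $\mathfrak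 B^p$ by adding $\gamma_p$ and, if $\gamma_p=\varepsilon_i+\varepsilon_j$ with $i<j$, removing $-\gamma_p$. Let $0\le p<q$ and let $L$ be a simple $\widetilde{\mathfrak g}_\ell$-module in $\widetilde{\mathcal O}_\ell$ with a $\mathfrak B^p_\ell$-highest weight vector $v_\lambda$ of weight $\lambda\in\mathfrak h_\ell^*$. (i) Suppose $\gamma_p=\varepsilon_i+\varepsilon_j$ with $i<j$, put $\overline{\gamma_p}=\varepsilon_i-\varepsilon_j$ and let $0\neq f\in\widetilde{\mathfrak g}^{\gamma_p}$. If $0\le k\le\ell$, $\langle\lambda^{(k)},\overline{\gamma_p}\rangle\ne0$ and $\langle\lambda^{(k+1)},\overline{\gamma_p}\rangle=\dots=\langle\lambda^{(\ell)},\overline{\gamma_p}\rangle=0$, then $f^{(0)}f^{(1)}\cdots f^{(k)}v_\lambda$ is a $\mathfrak B^{p+1}_\ell$-highest weight vector of $L$. If $\langle\lambda^{(k)},\overline{\gamma_p}\rangle=0$ for all $0\le k\le\ell$, then $v_\lambda$ is a $\mathfrak B^{p+1}_\ell$-highest weight vector of $L$. (ii) If $\mathfrak B^p$ and $\mathfrak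 B^{p+1}$ are connected by an inclusion (that is, $\mathfrak B^p\subseteq\mathfrak B^{p+1}$ has codimension one), then $v_\lambda$ is a $\mathfrak B^{p+1}_\ell$-highest weight vector of $L$. -/

import Mathlib

open scoped TensorProduct Polynomial Matrix Kronecker

noncomputable section

namespace TakiffSuper

set_option linter.unusedSectionVars false
set_option linter.unusedSimpArgs false

/-! ## Lie superalgebras over the complex numbers -/

/-- The sign `(-1)^(i j)` of two parities. -/
def sgn (i j : ZMod 2) : ℂ := if i = 1 ∧ j = 1 then -1 else 1

/-- A complex Lie superalgebra: a `ℤ/2`-graded vector space (`part 0` even, `part 1` odd) with an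
even bilinear bracket satisfying super skew-symmetry and the super Jacobi identity. -/
class LieSuperalgebra (L : Type*) [AddCommGroup L] [Module ℂ L] where
  part : ZMod 2 → Submodule ℂ L
  part_isCompl : IsCompl (part 0) (part 1)
  br : L →ₗ[ℂ] L →ₗ[ℂ] L
  br_mem : ∀ {i j : ZMod 2} {x y : L}, x ∈ part i → y ∈ part j → br x y ∈ part (i + j)
  br_skew : ∀ {i j : ZMod 2} {x y : L}, x ∈ part i → y ∈ part j → br x y = -(sgn i j • br y x)
  br_jacobi : ∀ {i j : ZMod 2} {x y : L} (z : L), x ∈ part i → y ∈ part j →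
    br x (br y z) = br (br x y) z + sgn i j • br y (br x z)

open LieSuperalgebra

section Sub

variable {L : Type*} [AddCommGroup L] [Module ℂ L] [LieSuperalgebra L]

/-- A graded subspace closed under the bracket is a Lie superalgebra. -/
@[reducible] def ofSub (S : Submodule ℂ L)
    (hg : ∀ a ∈ part (L := L) 0, ∀ b ∈ part (L := L) 1, a + b ∈ S → a ∈ S ∧ b ∈ S)
    (hb : ∀ x ∈ S, ∀ y ∈ S, br x y ∈ S) : LieSuperalgebra S where
  part i := (part i).comap S.subtype
  part_isCompl := by
    have hc := part_isCompl (L := L)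
    constructor
    · rw [Submodule.disjoint_def]
      intro x h0 h1
      exact Subtype.ext (Submodule.disjoint_def.1 hc.disjoint _ h0 h1)
    · rw [codisjoint_iff, eq_top_iff]
      rintro ⟨x, hx⟩ -
      obtain ⟨a, ha, b, hb', hab⟩ := Submodule.mem_sup.1
        ((codisjoint_iff.1 hc.codisjoint).symm ▸ Submodule.mem_top : x ∈ part (L := L) 0 ⊔ part 1)
      have hS := hg a ha b hb' (hab ▸ hx)
      exact Submodule.mem_sup.2 ⟨⟨a, hS.1⟩, ha, ⟨b, hS.2⟩, hb', Subtype.ext hab⟩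
  br := LinearMap.mk₂ ℂ (fun x y => (⟨br (x : L) (y : L), hb _ x.2 _ y.2⟩ : S))
    (fun _ _ _ => Subtype.ext (by simp)) (fun _ _ _ => Subtype.ext (by simp))
    (fun _ _ _ => Subtype.ext (by simp)) (fun _ _ _ => Subtype.ext (by simp))
  br_mem hx hy := br_mem (L := L) hx hy
  br_skew hx hy := Subtype.ext (br_skew (L := L) hx hy)
  br_jacobi z hx hy := Subtype.ext (br_jacobi (L := L) (z : L) hx hy)

end Sub

/-! ## Takiff superalgebras -/

section Takiff

variable {L : Type*} [AddCommGroup L] [Module ℂ L] {A : Type*} [CommRing A] [Algebra ℂ A]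

/-- The subspace `s ⊗ A` of `L ⊗ A`. -/
def tensorSub (A : Type*) [CommRing A] [Algebra ℂ A] (s : Submodule ℂ L) :
    Submodule ℂ (L ⊗[ℂ] A) :=
  Submodule.span ℂ {t | ∃ x ∈ s, ∃ a : A, t = x ⊗ₜ[ℂ] a}

theorem tensorSub_disjoint {s t : Submodule ℂ L} (h : IsCompl s t) :
    IsCompl (tensorSub A s) (tensorSub A t) := by
  have hs : ∀ u ∈ tensorSub A s, (s.projection t h).rTensor A u = u := by
    intro u hu
    induction hu using Submodule.span_induction with
    | mem u hu =>
      obtain ⟨x, hx, a, rfl⟩ := hu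
      rw [LinearMap.rTensor_tmul]
      congr 1
      exact Submodule.projection_apply_of_mem_left h hx
    | zero => simp
    | add u v _ _ hu hv => rw [map_add, hu, hv]
    | smul c u _ hu => rw [map_smul, hu]
  have ht : ∀ u ∈ tensorSub A t, (s.projection t h).rTensor A u = 0 := by
    intro u hu
    induction hu using Submodule.span_induction with
    | mem u hu =>
      obtain ⟨x, hx, a, rfl⟩ := hu
      rw [LinearMap.rTensor_tmul, Submodule.projection_apply_of_mem_right h hx,
        TensorProduct.zero_tmul]
    | zero => simp
    | add u v _ _ hu hv => rw [map_add, hu, hv, add_zero]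
    | smul c u _ hu => rw [map_smul, hu, smul_zero]
  constructor
  · rw [Submodule.disjoint_def]
    intro u h1 h2
    rw [← hs u h1, ht u h2]
  · rw [codisjoint_iff, eq_top_iff]
    rintro u -
    induction u using TensorProduct.induction_on with
    | zero => exact zero_mem _
    | add u v hu hv => exact add_mem hu hv
    | tmul x a =>
      obtain ⟨y, hy, z, hz, rfl⟩ := Submodule.mem_sup.1
        ((codisjoint_iff.1 h.codisjoint).symm ▸ Submodule.mem_top : x ∈ s ⊔ t)
      rw [TensorProduct.add_tmul]
      exact Submodule.add_mem_sup (Submodule.subset_span ⟨y, hy, a, rfl⟩)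
        (Submodule.subset_span ⟨z, hz, a, rfl⟩)

variable [LieSuperalgebra L]

variable (L A) in
/-- The bracket `[x ⊗ a, y ⊗ b] = [x, y] ⊗ a b`. -/
def tensorBr : (L ⊗[ℂ] A) →ₗ[ℂ] (L ⊗[ℂ] A) →ₗ[ℂ] (L ⊗[ℂ] A) :=
  TensorProduct.map₂ (br (L := L)) (LinearMap.mul ℂ A)

@[simp] theorem tensorBr_tmul (x y : L) (a b : A) :
    tensorBr L A (x ⊗ₜ a) (y ⊗ₜ b) = br x y ⊗ₜ (a * b) := by
  simp [tensorBr]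

theorem tensorBr_mem {i j : ZMod 2} {u v : L ⊗[ℂ] A} (hu : u ∈ tensorSub A (part (L := L) i))
    (hv : v ∈ tensorSub A (part (L := L) j)) :
    tensorBr L A u v ∈ tensorSub A (part (L := L) (i + j)) := by
  induction hu using Submodule.span_induction with
  | mem u hu =>
    obtain ⟨x, hx, a, rfl⟩ := hu
    induction hv using Submodule.span_induction with
    | mem v hv =>
      obtain ⟨y, hy, b, rfl⟩ := hv
      rw [tensorBr_tmul]
      exact Submodule.subset_span ⟨_, br_mem hx hy, _, rfl⟩
    | zero => rw [map_zero]; exact zero_mem _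
    | add v w _ _ hv hw => rw [map_add]; exact add_mem hv hw
    | smul c v _ hv => rw [map_smul]; exact Submodule.smul_mem _ c hv
  | zero => rw [map_zero]; exact zero_mem _
  | add u w _ _ hu hw => rw [map_add]; exact add_mem hu hw
  | smul c u _ hu => rw [map_smul]; exact Submodule.smul_mem _ c hu

theorem tensorBr_skew {i j : ZMod 2} {u v : L ⊗[ℂ] A} (hu : u ∈ tensorSub A (part (L := L) i))
    (hv : v ∈ tensorSub A (part (L := L) j)) :
    tensorBr L A u v = -(sgn i j • tensorBr L A v u) := by
  induction hu using Submodule.span_induction with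
  | mem u hu =>
    obtain ⟨x, hx, a, rfl⟩ := hu
    induction hv using Submodule.span_induction with
    | mem v hv =>
      obtain ⟨y, hy, b, rfl⟩ := hv
      rw [tensorBr_tmul, tensorBr_tmul, br_skew hx hy, TensorProduct.neg_tmul,
        TensorProduct.smul_tmul', mul_comm a b]
    | zero => simp
    | add v w _ _ hv hw => simp only [map_add, LinearMap.add_apply, hv, hw, smul_add, neg_add]
    | smul c v _ hv =>
      simp only [map_smul, LinearMap.smul_apply, hv, smul_neg]; rw [smul_comm]
  | zero => simp
  | add u w _ _ hu hw => simp only [map_add, LinearMap.add_apply, hu, hw, smul_add, neg_add]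
  | smul c u _ hu => simp only [map_smul, LinearMap.smul_apply, hu, smul_neg]; rw [smul_comm]

theorem tensorBr_jacobi {i j : ZMod 2} {u v : L ⊗[ℂ] A} (w : L ⊗[ℂ] A)
    (hu : u ∈ tensorSub A (part (L := L) i)) (hv : v ∈ tensorSub A (part (L := L) j)) :
    tensorBr L A u (tensorBr L A v w) =
      tensorBr L A (tensorBr L A u v) w + sgn i j • tensorBr L A v (tensorBr L A u w) := by
  induction w using TensorProduct.induction_on with
  | zero => simp
  | add w w' hw hw' => simp only [map_add, hw, hw', smul_add]; abel
  | tmul z c =>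
    induction hu using Submodule.span_induction with
    | mem u hu =>
      obtain ⟨x, hx, a, rfl⟩ := hu
      induction hv using Submodule.span_induction with
      | mem v hv =>
        obtain ⟨y, hy, b, rfl⟩ := hv
        simp only [tensorBr_tmul]
        rw [br_jacobi z hx hy, TensorProduct.add_tmul, TensorProduct.smul_tmul',
          mul_assoc, mul_left_comm b a c]
      | zero => simp
      | add v w _ _ hv hw =>
        simp only [map_add, LinearMap.add_apply, hv, hw, smul_add]; abel
      | smul c v _ hv =>
        simp only [map_smul, LinearMap.smul_apply, hv, smul_add]; rw [smul_comm]
    | zero => simp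
    | add u w _ _ hu hw =>
      simp only [map_add, LinearMap.add_apply, hu, hw, smul_add]; abel
    | smul c u _ hu =>
      simp only [map_smul, LinearMap.smul_apply, hu, smul_add]; rw [smul_comm]

end Takiff

/-- The truncated polynomial algebra `ℂ[θ]/(θ^(ℓ+1))`. -/
abbrev Trunc (ℓ : ℕ) : Type := AdjoinRoot ((Polynomial.X : ℂ[X]) ^ (ℓ + 1))

/-- The class `θ` of the variable. -/
def theta (ℓ : ℕ) : Trunc ℓ := AdjoinRoot.root _

/-- The `ℓ`-th Takiff superalgebra `L ⊗ ℂ[θ]/(θ^(ℓ+1))`, with `θ` even. -/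
abbrev Takiff (L : Type*) [AddCommGroup L] [Module ℂ L] (ℓ : ℕ) : Type _ := L ⊗[ℂ] Trunc ℓ

instance takiffLieSuperalgebra (L : Type*) [AddCommGroup L] [Module ℂ L] [LieSuperalgebra L]
    (ℓ : ℕ) : LieSuperalgebra (Takiff L ℓ) where
  part i := tensorSub (Trunc ℓ) (part i)
  part_isCompl := tensorSub_disjoint part_isCompl
  br := tensorBr L (Trunc ℓ)
  br_mem := tensorBr_mem
  br_skew := tensorBr_skew
  br_jacobi := tensorBr_jacobi

section Basic

variable {L : Type*} [AddCommGroup L] [Module ℂ L]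

/-- The element `x^(i) = x ⊗ θ^i`. -/
def jet (ℓ : ℕ) (x : L) (i : ℕ) : Takiff L ℓ := x ⊗ₜ (theta ℓ ^ i)

/-- The subspace `s_ℓ = s ⊗ ℂ[θ]/(θ^(ℓ+1))` for a subspace `s`. -/
def takiffSub (s : Submodule ℂ L) (ℓ : ℕ) : Submodule ℂ (Takiff L ℓ) := tensorSub (Trunc ℓ) s

/-- The component `λ^(i)` of `λ ∈ (h_ℓ)^*`: the functional `y ↦ λ(y ⊗ θ^i)` on `h`. -/
def weightComp {h : Submodule ℂ L} {ℓ : ℕ} (lam : Module.Dual ℂ (takiffSub h ℓ)) (i : ℕ) :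
    Module.Dual ℂ h where
  toFun y := lam ⟨jet ℓ (y : L) i, Submodule.subset_span ⟨y, y.2, _, rfl⟩⟩
  map_add' y z := by
    rw [← map_add]; congr 1; exact Subtype.ext (TensorProduct.add_tmul _ _ _)
  map_smul' c y := by
    rw [RingHom.id_apply, ← map_smul]; congr 1
end Basic

/-! ## Modules -/

/-- A (`ℤ/2`-graded) module over a Lie superalgebra. -/
class LieSuperModule (L : Type*) [AddCommGroup L] [Module ℂ L] [LieSuperalgebra L]
    (M : Type*) [AddCommGroup M] [Module ℂ M] where
  grade : ZMod 2 → Submodule ℂ M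
  grade_isCompl : IsCompl (grade 0) (grade 1)
  act : L →ₗ[ℂ] M →ₗ[ℂ] M
  act_mem : ∀ {i j : ZMod 2} {x : L} {m : M}, x ∈ part i → m ∈ grade j → act x m ∈ grade (i + j)
  act_br : ∀ {i j : ZMod 2} {x y : L} (m : M), x ∈ part i → y ∈ part j →
    act (br x y) m = act x (act y m) - sgn i j • act y (act x m)

open LieSuperModule

section Modules

variable (L : Type*) [AddCommGroup L] [Module ℂ L] [LieSuperalgebra L]
variable (M : Type*) [AddCommGroup M] [Module ℂ M]

/-- A simple module: nonzero, without proper nonzero (graded) submodules. -/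
def IsSimpleMod [LieSuperModule L M] : Prop :=
  Nontrivial M ∧ ∀ N : Submodule ℂ M,
    (∀ (x : L), ∀ m ∈ N, act x m ∈ N) →
    (N ⊓ grade L 0) ⊔ (N ⊓ grade L 1) = N → N = ⊥ ∨ N = ⊤

/-- Finite generation as a module over the (universal enveloping algebra of the) superalgebra. -/
def IsFinGen [LieSuperModule L M] : Prop :=
  ∃ S : Finset M, ∀ N : Submodule ℂ M,
    (∀ (x : L), ∀ m ∈ N, act x m ∈ N) → (∀ m ∈ S, m ∈ N) → N = ⊤

variable {L}

/-- The `h`-weight space of weight `ν`; here `h` is identified with `h ⊗ 1`. -/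
def weightSpace (h : Submodule ℂ L) (ℓ : ℕ) [LieSuperModule (Takiff L ℓ) M]
    (ν : Module.Dual ℂ h) : Submodule ℂ M where
  carrier := {m | ∀ y : h, act (jet ℓ (y : L) 0) m = ν y • m}
  add_mem' ha hb y := by rw [map_add, ha y, hb y, smul_add]
  zero_mem' y := by rw [map_zero, smul_zero]
  smul_mem' c m hm y := by rw [map_smul, hm y, smul_comm]

/-- Membership of `M` in the category `O` of the Takiff superalgebra, with respect to the Cartan
subalgebra `h` and the Borel subalgebra `b`: finitely generated, `h` acts semisimply and `b_ℓ`
acts locally finitely. -/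
structure InCategoryO (h b : Submodule ℂ L) (ℓ : ℕ) [LieSuperModule (Takiff L ℓ) M] : Prop where
  finGen : IsFinGen (Takiff L ℓ) M
  semisimple : ⨆ ν : Module.Dual ℂ h, weightSpace M h ℓ ν = ⊤
  locallyFinite : ∀ m : M, ∃ N : Submodule ℂ M, m ∈ N ∧ FiniteDimensional ℂ N ∧
    ∀ x ∈ takiffSub b ℓ, ∀ u ∈ N, act x u ∈ N

variable {M}

/-- `v` is a highest weight vector of weight `lam ∈ (h_ℓ)^*` for the Borel subalgebra
`(h ⊕ n)_ℓ` with nilradical `n_ℓ`. -/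
def IsHighestWeightVector (h n : Submodule ℂ L) (ℓ : ℕ) [LieSuperModule (Takiff L ℓ) M]
    (lam : Module.Dual ℂ (takiffSub h ℓ)) (v : M) : Prop :=
  v ≠ 0 ∧ (∀ x ∈ takiffSub n ℓ, act x v = 0) ∧ ∀ y : takiffSub h ℓ, act (y : Takiff L ℓ) v = lam y • v

/-- The vector `f^(0) f^(1) ⋯ f^(k) v`. -/
def jetProd (ℓ : ℕ) [LieSuperModule (Takiff L ℓ) M] (f : L) (k : ℕ) (v : M) : M :=
  (((List.range (k + 1)).map fun i => (act (jet ℓ f i) : Module.End ℂ M)).prod) v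

end Modules

/-! ## Roots, triangular decompositions, odd reflections -/

section Roots

variable {L : Type*} [AddCommGroup L] [Module ℂ L] [LieSuperalgebra L]

/-- The space of weight `α` in `L` for the adjoint action of `h`. -/
def rootSpace (h : Submodule ℂ L) (α : Module.Dual ℂ h) : Submodule ℂ L where
  carrier := {x | ∀ y : h, br (y : L) x = α y • x}
  add_mem' ha hb y := by rw [map_add, ha y, hb y, smul_add]
  zero_mem' y := by rw [map_zero, smul_zero]
  smul_mem' c m hm y := by rw [map_smul, hm y, smul_comm]

/-- The set of roots. -/
def roots (h : Submodule ℂ L) : Set (Module.Dual ℂ h) := {α | α ≠ 0 ∧ rootSpace h α ≠ ⊥}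

/-- The set of odd roots. -/
def oddRoots (h : Submodule ℂ L) : Set (Module.Dual ℂ h) :=
  {α | α ≠ 0 ∧ rootSpace h α ⊓ part 1 ≠ ⊥}

/-- The sum of the root spaces of a set of roots. -/
def rootSum (h : Submodule ℂ L) (P : Set (Module.Dual ℂ h)) : Submodule ℂ L :=
  ⨆ α ∈ P, rootSpace h α

/-- The triangular decomposition `L = n⁻ ⊕ h ⊕ n` given by an element `H` of `h`: `L` is the sum
of its `h`-weight spaces and those weight spaces with `Re α(H) = 0` add up to `h`. Then `n` and
`n⁻` are the sums of the weight spaces with `Re α(H) > 0` and `Re α(H) < 0`. -/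
structure IsTriangular (h : Submodule ℂ L) (H : h) : Prop where
  span : ⨆ α : Module.Dual ℂ h, rootSpace h α = ⊤
  zero : ⨆ (α : Module.Dual ℂ h) (_ : (α H).re = 0), rootSpace h α = h

/-- The positive system of the triangular decomposition given by `H`. -/
def posRoots (h : Submodule ℂ L) (H : h) : Set (Module.Dual ℂ h) := {α ∈ roots h | 0 < (α H).re}

/-- The simple roots of a positive system: those that are not sums of two positive roots. -/
def simpleRoots {h : Submodule ℂ L} (P : Set (Module.Dual ℂ h)) : Set (Module.Dual ℂ h) :=
  {α ∈ P | ∀ β ∈ P, ∀ γ ∈ P, α ≠ β + γ}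

/-- The odd reflection `(P \ {α}) ∪ {-α}` of a positive system. -/
def oddReflection {h : Submodule ℂ L} (P : Set (Module.Dual ℂ h)) (α : Module.Dual ℂ h) :
    Set (Module.Dual ℂ h) := (P \ {α}) ∪ {-α}

/-- Even, non-degenerate, invariant, supersymmetric bilinear forms on a Lie superalgebra. -/
structure IsInvariantForm (B : L →ₗ[ℂ] L →ₗ[ℂ] ℂ) : Prop where
  even : ∀ x ∈ part (L := L) 0, ∀ y ∈ part (L := L) 1, B x y = 0 ∧ B y x = 0
  symm : ∀ {i j : ZMod 2} {x y : L}, x ∈ part i → y ∈ part j → B x y = sgn i j * B y x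
  invariant : ∀ x y z : L, B (br x y) z = B x (br y z)
  nondegenerate : ∀ x : L, (∀ y : L, B x y = 0) → x = 0

open Classical in
/-- The bilinear form on `h^*` induced by a form `B` on `L` that is non-degenerate on `h`:
`⟨ν, μ⟩ = ν(t)` where `t ∈ h` is the element with `B(t, y) = μ(y)` for all `y ∈ h`. -/
def dualForm (h : Submodule ℂ L) (B : L →ₗ[ℂ] L →ₗ[ℂ] ℂ) (ν μ : Module.Dual ℂ h) : ℂ :=
  if H : ∃ t : h, ∀ y : h, B (t : L) (y : L) = μ y then ν H.choose else 0

theorem dualForm_eq (h : Submodule ℂ L) (B : L →ₗ[ℂ] L →ₗ[ℂ] ℂ)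
    (hB : ∀ x : h, (∀ y : h, B (x : L) (y : L) = 0) → x = 0) (ν μ : Module.Dual ℂ h) (t : h)
    (ht : ∀ y : h, B (t : L) (y : L) = μ y) : dualForm h B ν μ = ν t := by
  have H : ∃ t : h, ∀ y : h, B (t : L) (y : L) = μ y := ⟨t, ht⟩
  rw [dualForm, dif_pos H]
  congr 1
  rw [← sub_eq_zero]
  refine hB _ fun y => ?_
  rw [Submodule.coe_sub, map_sub, LinearMap.sub_apply, H.choose_spec y, ht y, sub_self]

end Roots

/-! ## The matrix Lie superalgebras -/

section Matrices

variable {a b : Type*} [Fintype a] [Fintype b]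

/-- The bracket of `gl(a|b)`: the bilinear extension of `x y - (-1)^(|x||y|) y x`. -/
def superComm (x y : Matrix (a ⊕ b) (a ⊕ b) ℂ) : Matrix (a ⊕ b) (a ⊕ b) ℂ :=
  x * y - y * x + (2 : ℂ) • (Matrix.fromBlocks 0 y.toBlocks₁₂ y.toBlocks₂₁ 0 *
    Matrix.fromBlocks 0 x.toBlocks₁₂ x.toBlocks₂₁ 0)

theorem superComm_fromBlocks (A A' : Matrix a a ℂ) (B B' : Matrix a b ℂ) (C C' : Matrix b a ℂ)
    (D D' : Matrix b b ℂ) :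
    superComm (Matrix.fromBlocks A B C D) (Matrix.fromBlocks A' B' C' D') =
      Matrix.fromBlocks (A * A' - A' * A + (B * C' + B' * C)) (A * B' + B * D' - (A' * B + B' * D))
        (C * A' + D * C' - (C' * A + D' * C)) (D * D' - D' * D + (C * B' + C' * B)) := by
  simp only [superComm, Matrix.fromBlocks_multiply, Matrix.toBlocks_fromBlocks₁₂,
    Matrix.toBlocks_fromBlocks₂₁, Matrix.fromBlocks_add, sub_eq_add_neg,
    Matrix.fromBlocks_neg, Matrix.zero_mul, Matrix.mul_zero, two_smul, zero_add, add_zero]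
  congr 1 <;> abel

/-- The parity decomposition of `gl(a|b)`: even matrices are block diagonal, odd matrices are
block off-diagonal. -/
def matPart (i : ZMod 2) : Submodule ℂ (Matrix (a ⊕ b) (a ⊕ b) ℂ) where
  carrier := {x | if i = 0 then x.toBlocks₁₂ = 0 ∧ x.toBlocks₂₁ = 0
    else x.toBlocks₁₁ = 0 ∧ x.toBlocks₂₂ = 0}
  add_mem' {x y} hx hy := by
    rw [← Matrix.fromBlocks_toBlocks x, ← Matrix.fromBlocks_toBlocks y] at *
    simp only [Set.mem_ofPred_eq, Matrix.fromBlocks_add, Matrix.toBlocks_fromBlocks₁₂,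
      Matrix.toBlocks_fromBlocks₂₁, Matrix.toBlocks_fromBlocks₁₁,
      Matrix.toBlocks_fromBlocks₂₂] at hx hy ⊢
    split_ifs at hx hy ⊢ <;> simp [hx.1, hx.2, hy.1, hy.2]
  zero_mem' := by
    simp only [Set.mem_ofPred_eq]
    split_ifs <;> exact ⟨rfl, rfl⟩
  smul_mem' c x hx := by
    rw [← Matrix.fromBlocks_toBlocks x] at *
    simp only [Set.mem_ofPred_eq, Matrix.fromBlocks_smul, Matrix.toBlocks_fromBlocks₁₂,
      Matrix.toBlocks_fromBlocks₂₁, Matrix.toBlocks_fromBlocks₁₁,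
      Matrix.toBlocks_fromBlocks₂₂] at hx ⊢
    split_ifs at hx ⊢ <;> simp [hx.1, hx.2]


theorem mem_matPart_zero {x : Matrix (a ⊕ b) (a ⊕ b) ℂ} :
    x ∈ matPart (a := a) (b := b) 0 ↔ ∃ A D, x = Matrix.fromBlocks A 0 0 D := by
  constructor
  · rintro ⟨h1, h2⟩
    exact ⟨x.toBlocks₁₁, x.toBlocks₂₂, by rw [← h1, ← h2, Matrix.fromBlocks_toBlocks]⟩
  · rintro ⟨A, D, rfl⟩
    exact ⟨rfl, rfl⟩

theorem mem_matPart_one {x : Matrix (a ⊕ b) (a ⊕ b) ℂ} :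
    x ∈ matPart (a := a) (b := b) 1 ↔ ∃ B C, x = Matrix.fromBlocks 0 B C 0 := by
  constructor
  · rintro ⟨h1, h2⟩
    exact ⟨x.toBlocks₁₂, x.toBlocks₂₁, by rw [← h1, ← h2, Matrix.fromBlocks_toBlocks]⟩
  · rintro ⟨A, D, rfl⟩
    exact ⟨rfl, rfl⟩

theorem zmod2_cases (i : ZMod 2) : i = 0 ∨ i = 1 := by
  revert i; decide

/-- The general linear Lie superalgebra `gl(a|b)`. -/
instance glLieSuperalgebra : LieSuperalgebra (Matrix (a ⊕ b) (a ⊕ b) ℂ) where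
  part := matPart
  part_isCompl := by
    constructor
    · rw [Submodule.disjoint_def]
      intro x h0 h1
      obtain ⟨A, D, rfl⟩ := mem_matPart_zero.1 h0
      obtain ⟨h1, h2⟩ := h1
      rw [Matrix.toBlocks_fromBlocks₁₁] at h1
      rw [Matrix.toBlocks_fromBlocks₂₂] at h2
      rw [h1, h2, Matrix.fromBlocks_zero]
    · rw [codisjoint_iff, eq_top_iff]
      intro x _
      refine Submodule.mem_sup.2 ⟨_, mem_matPart_zero.2 ⟨x.toBlocks₁₁, x.toBlocks₂₂, rfl⟩, _,
        mem_matPart_one.2 ⟨x.toBlocks₁₂, x.toBlocks₂₁, rfl⟩, ?_⟩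
      rw [Matrix.fromBlocks_add]
      simp only [add_zero, zero_add, Matrix.fromBlocks_toBlocks]
  br := LinearMap.mk₂ ℂ superComm
    (fun x x' y => by
      rw [← Matrix.fromBlocks_toBlocks x, ← Matrix.fromBlocks_toBlocks x',
        ← Matrix.fromBlocks_toBlocks y]
      simp only [superComm_fromBlocks, Matrix.fromBlocks_add, Matrix.add_mul, Matrix.mul_add]
      congr 1 <;> abel)
    (fun c x y => by
      rw [← Matrix.fromBlocks_toBlocks x, ← Matrix.fromBlocks_toBlocks y]
      simp only [superComm_fromBlocks, Matrix.fromBlocks_smul, Matrix.smul_mul, Matrix.mul_smul,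
        smul_sub, smul_add])
    (fun x y y' => by
      rw [← Matrix.fromBlocks_toBlocks x, ← Matrix.fromBlocks_toBlocks y',
        ← Matrix.fromBlocks_toBlocks y]
      simp only [superComm_fromBlocks, Matrix.fromBlocks_add, Matrix.add_mul, Matrix.mul_add]
      congr 1 <;> abel)
    (fun c x y => by
      rw [← Matrix.fromBlocks_toBlocks x, ← Matrix.fromBlocks_toBlocks y]
      simp only [superComm_fromBlocks, Matrix.fromBlocks_smul, Matrix.smul_mul, Matrix.mul_smul,
        smul_sub, smul_add])
  br_mem := by
    intro i j x y hx hy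
    have h11 : (1 : ZMod 2) + 1 = 0 := by decide
    rcases zmod2_cases i with rfl | rfl <;> rcases zmod2_cases j with rfl | rfl <;>
    simp only [zero_add, add_zero, h11, mem_matPart_zero, mem_matPart_one] at hx hy ⊢ <;>
    obtain ⟨A, D, rfl⟩ := hx <;> obtain ⟨A', D', rfl⟩ := hy <;>
    simp only [LinearMap.mk₂_apply, superComm_fromBlocks, Matrix.zero_mul, Matrix.mul_zero,
      add_zero, zero_add, sub_zero] <;> exact ⟨_, _, rfl⟩
  br_skew := by
    intro i j x y hx hy
    have h01 : (0 : ZMod 2) ≠ 1 := by decide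
    rcases zmod2_cases i with rfl | rfl <;> rcases zmod2_cases j with rfl | rfl <;>
    simp only [mem_matPart_zero, mem_matPart_one] at hx hy <;>
    obtain ⟨A, D, rfl⟩ := hx <;> obtain ⟨A', D', rfl⟩ := hy <;>
    simp only [LinearMap.mk₂_apply, superComm_fromBlocks, sgn, h01, false_and, and_false, if_false,
      and_self, if_true, one_smul, neg_smul, neg_neg, Matrix.fromBlocks_neg] <;>
    congr 1 <;> simp only [Matrix.zero_mul, Matrix.mul_zero] <;> abel
  br_jacobi := by
    intro i j x y z hx hy
    have h01 : (0 : ZMod 2) ≠ 1 := by decide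
    rw [← Matrix.fromBlocks_toBlocks z]
    rcases zmod2_cases i with rfl | rfl <;> rcases zmod2_cases j with rfl | rfl <;>
    simp only [mem_matPart_zero, mem_matPart_one] at hx hy <;>
    obtain ⟨A, D, rfl⟩ := hx <;> obtain ⟨A', D', rfl⟩ := hy <;>
    simp only [LinearMap.mk₂_apply, superComm_fromBlocks, sgn, h01, false_and, and_false, if_false,
      and_self, if_true, one_smul, neg_smul, Matrix.fromBlocks_neg, Matrix.fromBlocks_add,
      Matrix.zero_mul, Matrix.mul_zero, add_zero, zero_add, sub_zero, zero_sub] <;>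
    congr 1 <;>
    simp only [Matrix.mul_add, Matrix.add_mul, Matrix.mul_sub, Matrix.sub_mul, Matrix.mul_assoc,
      Matrix.mul_neg, Matrix.neg_mul] <;> abel

theorem gl_br_fromBlocks (A A' : Matrix a a ℂ) (B B' : Matrix a b ℂ) (C C' : Matrix b a ℂ)
    (D D' : Matrix b b ℂ) :
    br (Matrix.fromBlocks A B C D) (Matrix.fromBlocks A' B' C' D') =
      Matrix.fromBlocks (A * A' - A' * A + (B * C' + B' * C)) (A * B' + B * D' - (A' * B + B' * D))
        (C * A' + D * C' - (C' * A + D' * C)) (D * D' - D' * D + (C * B' + C' * B)) :=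
  superComm_fromBlocks A A' B B' C C' D D'

variable (a b) in
/-- The supertrace `tr A - tr D`. -/
def supertrace : Matrix (a ⊕ b) (a ⊕ b) ℂ →ₗ[ℂ] ℂ where
  toFun x := x.toBlocks₁₁.trace - x.toBlocks₂₂.trace
  map_add' x y := by
    simp only [Matrix.trace, Matrix.diag, Matrix.toBlocks₁₁, Matrix.toBlocks₂₂, Matrix.of_apply,
      Matrix.add_apply, Finset.sum_add_distrib]
    ring
  map_smul' c x := by
    simp only [Matrix.trace, Matrix.diag, Matrix.toBlocks₁₁, Matrix.toBlocks₂₂, Matrix.of_apply,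
      Matrix.smul_apply, ← Finset.smul_sum, smul_sub, RingHom.id_apply]

variable (a b) in
/-- The underlying space of the special linear Lie superalgebra `sl(a|b)`. -/
def slSub : Submodule ℂ (Matrix (a ⊕ b) (a ⊕ b) ℂ) := LinearMap.ker (supertrace a b)

instance slLieSuperalgebra : LieSuperalgebra (slSub a b) := ofSub (slSub a b)
  (by
    intro x hx y hy h
    obtain ⟨B, C, rfl⟩ := mem_matPart_one.1 hy
    have h1 : Matrix.fromBlocks 0 B C 0 ∈ slSub a b := by
      simp [slSub, supertrace]
    exact ⟨by simpa using sub_mem h h1, h1⟩)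
  (by
    intro x hx y hy
    rw [← Matrix.fromBlocks_toBlocks x, ← Matrix.fromBlocks_toBlocks y, gl_br_fromBlocks]
    simp only [slSub, supertrace, LinearMap.mem_ker, LinearMap.coe_mk, AddHom.coe_mk,
      Matrix.toBlocks_fromBlocks₁₁, Matrix.toBlocks_fromBlocks₂₂, Matrix.trace_add,
      Matrix.trace_sub]
    rw [Matrix.trace_mul_comm x.toBlocks₁₁, Matrix.trace_mul_comm x.toBlocks₂₂,
      Matrix.trace_mul_comm x.toBlocks₁₂, Matrix.trace_mul_comm x.toBlocks₂₁]
    ring)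

end Matrices

section Classical

/-- The symmetric matrix with ones on the anti-diagonal. -/
def antiDiag (m : ℕ) : Matrix (Fin m) (Fin m) ℂ := Matrix.of fun i j => if i = j.rev then 1 else 0

theorem antiDiag_transpose (m : ℕ) : (antiDiag m)ᵀ = antiDiag m := by
  ext i j
  simp only [antiDiag, Matrix.transpose_apply, Matrix.of_apply]
  congr 1
  rw [eq_iff_iff]
  constructor <;> rintro rfl <;> simp

/-- The underlying space of the orthosymplectic Lie superalgebra `osp(m|2n)`: the matrices in
`gl(m|2n)` that preserve the even supersymmetric form given by `antiDiag m` on the even part and by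
the standard symplectic matrix on the odd part. -/
def ospSub (m n : ℕ) :
    Submodule ℂ (Matrix (Fin m ⊕ (Fin n ⊕ Fin n)) (Fin m ⊕ (Fin n ⊕ Fin n)) ℂ) where
  carrier := {x | x.toBlocks₁₁ᵀ * antiDiag m + antiDiag m * x.toBlocks₁₁ = 0 ∧
    x.toBlocks₂₂ᵀ * Matrix.J (Fin n) ℂ + Matrix.J (Fin n) ℂ * x.toBlocks₂₂ = 0 ∧
    x.toBlocks₁₂ᵀ * antiDiag m = Matrix.J (Fin n) ℂ * x.toBlocks₂₁}
  add_mem' {x y} hx hy := by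
    rw [← Matrix.fromBlocks_toBlocks x, ← Matrix.fromBlocks_toBlocks y] at *
    simp only [Set.mem_ofPred_eq, Matrix.fromBlocks_add, Matrix.toBlocks_fromBlocks₁₂,
      Matrix.toBlocks_fromBlocks₂₁, Matrix.toBlocks_fromBlocks₁₁, Matrix.toBlocks_fromBlocks₂₂,
      Matrix.transpose_add, Matrix.add_mul, Matrix.mul_add] at hx hy ⊢
    refine ⟨?_, ?_, ?_⟩
    · rw [add_add_add_comm, hx.1, hy.1, add_zero]
    · rw [add_add_add_comm, hx.2.1, hy.2.1, add_zero]
    · rw [hx.2.2, hy.2.2]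
  zero_mem' := by
    have h11 : (0 : Matrix (Fin m ⊕ (Fin n ⊕ Fin n)) (Fin m ⊕ (Fin n ⊕ Fin n)) ℂ).toBlocks₁₁ = 0 := rfl
    have h12 : (0 : Matrix (Fin m ⊕ (Fin n ⊕ Fin n)) (Fin m ⊕ (Fin n ⊕ Fin n)) ℂ).toBlocks₁₂ = 0 := rfl
    have h21 : (0 : Matrix (Fin m ⊕ (Fin n ⊕ Fin n)) (Fin m ⊕ (Fin n ⊕ Fin n)) ℂ).toBlocks₂₁ = 0 := rfl
    have h22 : (0 : Matrix (Fin m ⊕ (Fin n ⊕ Fin n)) (Fin m ⊕ (Fin n ⊕ Fin n)) ℂ).toBlocks₂₂ = 0 := rfl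
    simp [h11, h12, h21, h22]
  smul_mem' c x hx := by
    rw [← Matrix.fromBlocks_toBlocks x] at *
    simp only [Set.mem_ofPred_eq, Matrix.fromBlocks_smul, Matrix.toBlocks_fromBlocks₁₂,
      Matrix.toBlocks_fromBlocks₂₁, Matrix.toBlocks_fromBlocks₁₁, Matrix.toBlocks_fromBlocks₂₂,
      Matrix.transpose_smul, Matrix.smul_mul, Matrix.mul_smul, ← smul_add] at hx ⊢
    exact ⟨by rw [hx.1, smul_zero], by rw [hx.2.1, smul_zero], by rw [hx.2.2]⟩

theorem osp_closed {m n : ℕ} {x y : Matrix (Fin m ⊕ (Fin n ⊕ Fin n)) (Fin m ⊕ (Fin n ⊕ Fin n)) ℂ}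
    (hx : x ∈ ospSub m n) (hy : y ∈ ospSub m n) : br x y ∈ ospSub m n := by
  have key : ∀ x : Matrix (Fin m ⊕ (Fin n ⊕ Fin n)) (Fin m ⊕ (Fin n ⊕ Fin n)) ℂ, x ∈ ospSub m n →
      x.toBlocks₁₁ᵀ * antiDiag m = -(antiDiag m * x.toBlocks₁₁) ∧
      x.toBlocks₂₂ᵀ * Matrix.J (Fin n) ℂ = -(Matrix.J (Fin n) ℂ * x.toBlocks₂₂) ∧
      x.toBlocks₁₂ᵀ * antiDiag m = Matrix.J (Fin n) ℂ * x.toBlocks₂₁ ∧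
      x.toBlocks₂₁ᵀ * Matrix.J (Fin n) ℂ = -(antiDiag m * x.toBlocks₁₂) := by
    rintro x ⟨h1, h2, h3⟩
    refine ⟨eq_neg_of_add_eq_zero_left h1, eq_neg_of_add_eq_zero_left h2, h3, ?_⟩
    have h4 := congrArg Matrix.transpose h3
    rw [Matrix.transpose_mul, Matrix.transpose_mul, antiDiag_transpose, Matrix.J_transpose,
      Matrix.transpose_transpose, Matrix.mul_neg] at h4
    rw [h4, neg_neg]
  obtain ⟨x1, x2, x3, x4⟩ := key x hx
  obtain ⟨y1, y2, y3, y4⟩ := key y hy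
  rw [← Matrix.fromBlocks_toBlocks x, ← Matrix.fromBlocks_toBlocks y, gl_br_fromBlocks]
  refine ⟨?_, ?_, ?_⟩ <;>
  simp only [Matrix.toBlocks_fromBlocks₁₂, Matrix.toBlocks_fromBlocks₂₁,
    Matrix.toBlocks_fromBlocks₁₁, Matrix.toBlocks_fromBlocks₂₂, Matrix.transpose_add,
    Matrix.transpose_sub, Matrix.transpose_mul, Matrix.add_mul, Matrix.sub_mul, Matrix.mul_add,
    Matrix.mul_sub, Matrix.mul_assoc, x1, x2, x3, x4, y1, y2, y3, y4, Matrix.mul_neg] <;>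
  simp only [← Matrix.mul_assoc, x1, x2, x3, x4, y1, y2, y3, y4, Matrix.neg_mul] <;> abel

instance ospLieSuperalgebra (m n : ℕ) : LieSuperalgebra (ospSub m n) := ofSub (ospSub m n)
  (by
    intro x hx y hy h
    obtain ⟨A, D, rfl⟩ := mem_matPart_zero.1 hx
    obtain ⟨B, C, rfl⟩ := mem_matPart_one.1 hy
    rw [Matrix.fromBlocks_add] at h
    obtain ⟨h1, h2, h3⟩ := h
    simp only [Matrix.toBlocks_fromBlocks₁₂, Matrix.toBlocks_fromBlocks₂₁,
      Matrix.toBlocks_fromBlocks₁₁, Matrix.toBlocks_fromBlocks₂₂, add_zero, zero_add] at h1 h2 h3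
    constructor
    · exact ⟨by simpa using h1, by simpa using h2, by simp⟩
    · exact ⟨by simp, by simp, by simpa using h3⟩)
  (fun _ hx _ hy => osp_closed hx hy)

/-- The underlying space of the periplectic Lie superalgebra `pe(n)`: the matrices
`(A B; C -Aᵗ)` with `B` symmetric and `C` skew-symmetric. -/
def peSub (n : ℕ) : Submodule ℂ (Matrix (Fin n ⊕ Fin n) (Fin n ⊕ Fin n) ℂ) where
  carrier := {x | x.toBlocks₂₂ = -x.toBlocks₁₁ᵀ ∧ x.toBlocks₁₂ᵀ = x.toBlocks₁₂ ∧
    x.toBlocks₂₁ᵀ = -x.toBlocks₂₁}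
  add_mem' {x y} hx hy := by
    rw [← Matrix.fromBlocks_toBlocks x, ← Matrix.fromBlocks_toBlocks y] at *
    simp only [Set.mem_ofPred_eq, Matrix.fromBlocks_add, Matrix.toBlocks_fromBlocks₁₂,
      Matrix.toBlocks_fromBlocks₂₁, Matrix.toBlocks_fromBlocks₁₁, Matrix.toBlocks_fromBlocks₂₂,
      Matrix.transpose_add] at hx hy ⊢
    exact ⟨by rw [hx.1, hy.1, neg_add], by rw [hx.2.1, hy.2.1], by rw [hx.2.2, hy.2.2, neg_add]⟩
  zero_mem' := by
    have h11 : (0 : Matrix (Fin n ⊕ Fin n) (Fin n ⊕ Fin n) ℂ).toBlocks₁₁ = 0 := rfl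
    have h12 : (0 : Matrix (Fin n ⊕ Fin n) (Fin n ⊕ Fin n) ℂ).toBlocks₁₂ = 0 := rfl
    have h21 : (0 : Matrix (Fin n ⊕ Fin n) (Fin n ⊕ Fin n) ℂ).toBlocks₂₁ = 0 := rfl
    have h22 : (0 : Matrix (Fin n ⊕ Fin n) (Fin n ⊕ Fin n) ℂ).toBlocks₂₂ = 0 := rfl
    simp [h11, h12, h21, h22]
  smul_mem' c x hx := by
    rw [← Matrix.fromBlocks_toBlocks x] at *
    simp only [Set.mem_ofPred_eq, Matrix.fromBlocks_smul, Matrix.toBlocks_fromBlocks₁₂,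
      Matrix.toBlocks_fromBlocks₂₁, Matrix.toBlocks_fromBlocks₁₁, Matrix.toBlocks_fromBlocks₂₂,
      Matrix.transpose_smul] at hx ⊢
    exact ⟨by rw [hx.1, smul_neg], by rw [hx.2.1], by rw [hx.2.2, smul_neg]⟩

theorem pe_closed {n : ℕ} {x y : Matrix (Fin n ⊕ Fin n) (Fin n ⊕ Fin n) ℂ}
    (hx : x ∈ peSub n) (hy : y ∈ peSub n) : br x y ∈ peSub n := by
  obtain ⟨x1, x2, x3⟩ := hx
  obtain ⟨y1, y2, y3⟩ := hy
  rw [← Matrix.fromBlocks_toBlocks x, ← Matrix.fromBlocks_toBlocks y, gl_br_fromBlocks]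
  refine ⟨?_, ?_, ?_⟩ <;>
  simp only [Matrix.toBlocks_fromBlocks₁₂, Matrix.toBlocks_fromBlocks₂₁,
    Matrix.toBlocks_fromBlocks₁₁, Matrix.toBlocks_fromBlocks₂₂, Matrix.transpose_add,
    Matrix.transpose_sub, Matrix.transpose_mul, Matrix.transpose_neg, Matrix.transpose_transpose,
    x1, x2, x3, y1, y2, y3, Matrix.mul_neg, Matrix.neg_mul] <;> abel

instance peLieSuperalgebra (n : ℕ) : LieSuperalgebra (peSub n) := ofSub (peSub n)
  (by
    intro x hx y hy h
    obtain ⟨A, D, rfl⟩ := mem_matPart_zero.1 hx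
    obtain ⟨B, C, rfl⟩ := mem_matPart_one.1 hy
    rw [Matrix.fromBlocks_add] at h
    obtain ⟨h1, h2, h3⟩ := h
    simp only [Matrix.toBlocks_fromBlocks₁₂, Matrix.toBlocks_fromBlocks₂₁,
      Matrix.toBlocks_fromBlocks₁₁, Matrix.toBlocks_fromBlocks₂₂, add_zero, zero_add] at h1 h2 h3
    constructor
    · exact ⟨by simpa using h1, by simp, by simp⟩
    · exact ⟨by simp, by simpa using h2, by simpa using h3⟩)
  (fun _ hx _ hy => pe_closed hx hy)

end Classical

/-! ## Basic classical Lie superalgebras -/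

/-- The diagonal matrices. -/
def diagSub (ι : Type*) : Submodule ℂ (Matrix ι ι ℂ) where
  carrier := {x | x.IsDiag}
  add_mem' hx hy := hx.add hy
  zero_mem' := Matrix.isDiag_zero
  smul_mem' c _ hx := hx.smul c

section BasicClassical

variable {L : Type*} [AddCommGroup L] [Module ℂ L] [LieSuperalgebra L]

/-- The pairs `(L, h)` and `(L', h')` are isomorphic: there is an isomorphism of Lie superalgebras
that carries `h` onto `h'`. -/
def IsoPair {L' : Type*} [AddCommGroup L'] [Module ℂ L'] [LieSuperalgebra L']
    (h : Submodule ℂ L) (h' : Submodule ℂ L') : Prop :=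
  ∃ φ : L ≃ₗ[ℂ] L', (∀ (i : ZMod 2) (x : L), x ∈ part i → φ x ∈ part i) ∧
    (∀ x y : L, φ (br x y) = br (φ x) (φ y)) ∧ h.map φ.toLinearMap = h'

variable (L) in
/-- Simple Lie superalgebras: the bracket is nonzero, and there are no proper nonzero graded
ideals. -/
def IsSimpleAlg : Prop :=
  (∃ x y : L, br x y ≠ 0) ∧ ∀ I : Submodule ℂ L,
    (∀ (x : L), ∀ y ∈ I, br x y ∈ I) → (I ⊓ part 0) ⊔ (I ⊓ part 1) = I → I = ⊥ ∨ I = ⊤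

/-- `L` is a simple Lie superalgebra with even part `s × sl(2)` and odd part `ℂ^ι ⊗ ℂ²` as a module
over the even part, for a matrix Lie algebra `s ⊆ gl(ι)`, and `h` consists of the pairs of diagonal
matrices in the even part. Here `ℂ^ι ⊗ ℂ²` is the space of `ι × 2`-matrices `X`, on which `(A, S)`
acts by `X ↦ A X + X Sᵗ`. -/
def IsExceptional {ι : Type*} [Fintype ι] (s : Set (Matrix ι ι ℂ)) (h : Submodule ℂ L) : Prop :=
  IsSimpleAlg L ∧ ∃ Φ : L →ₗ[ℂ] Matrix ι ι ℂ × Matrix (Fin 2) (Fin 2) ℂ × Matrix ι (Fin 2) ℂ,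
    Function.Injective Φ ∧ Set.range Φ = {t | t.1 ∈ s ∧ t.2.1.trace = 0} ∧
    (∀ x : L, x ∈ part 0 ↔ (Φ x).2.2 = 0) ∧
    (∀ x : L, x ∈ part 1 ↔ (Φ x).1 = 0 ∧ (Φ x).2.1 = 0) ∧
    (∀ x ∈ part (L := L) 0, ∀ y ∈ part (L := L) 0,
      (Φ (br x y)).1 = (Φ x).1 * (Φ y).1 - (Φ y).1 * (Φ x).1 ∧
      (Φ (br x y)).2.1 = (Φ x).2.1 * (Φ y).2.1 - (Φ y).2.1 * (Φ x).2.1) ∧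
    (∀ x ∈ part (L := L) 0, ∀ y ∈ part (L := L) 1,
      (Φ (br x y)).2.2 = (Φ x).1 * (Φ y).2.2 + (Φ y).2.2 * ((Φ x).2.1)ᵀ) ∧
    (∀ x : L, x ∈ h ↔ x ∈ part (L := L) 0 ∧ (Φ x).1.IsDiag ∧ (Φ x).2.1.IsDiag)

/-- `sl(2) × sl(2)` acting on `ℂ² ⊗ ℂ²`. -/
def sl2sl2 : Set (Matrix (Fin 2 × Fin 2) (Fin 2 × Fin 2) ℂ) :=
  {A | ∃ P Q : Matrix (Fin 2) (Fin 2) ℂ, P.trace = 0 ∧ Q.trace = 0 ∧ A = P ⊗ₖ 1 + 1 ⊗ₖ Q}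

/-- A generic alternating trilinear form on `ℂ³ ⊕ ℂ³ ⊕ ℂ` (the form `⟨u, v × w⟩` of the split
octonions): `det(a, a', a'') + det(b, b', b'') + Σ c (a' · b'' - a'' · b')`, the last sum running
over the cyclic permutations. -/
def threeForm (u v w : Fin 3 ⊕ Fin 3 ⊕ Unit → ℂ) : ℂ :=
  let p (x : Fin 3 ⊕ Fin 3 ⊕ Unit → ℂ) : Fin 3 → ℂ := fun i => x (Sum.inl i)
  let q (x : Fin 3 ⊕ Fin 3 ⊕ Unit → ℂ) : Fin 3 → ℂ := fun i => x (Sum.inr (Sum.inl i))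
  let r (x : Fin 3 ⊕ Fin 3 ⊕ Unit → ℂ) : ℂ := x (Sum.inr (Sum.inr ()))
  p u ⬝ᵥ (crossProduct (p v) (p w)) + q u ⬝ᵥ (crossProduct (q v) (q w)) +
    r u * (p v ⬝ᵥ q w - p w ⬝ᵥ q v) + r v * (p w ⬝ᵥ q u - p u ⬝ᵥ q w) +
    r w * (p u ⬝ᵥ q v - p v ⬝ᵥ q u)

/-- The simple Lie algebra of type `G₂` in its seven-dimensional representation, as the
infinitesimal stabilizer of a generic alternating trilinear form. -/
def g2 : Set (Matrix (Fin 3 ⊕ Fin 3 ⊕ Unit) (Fin 3 ⊕ Fin 3 ⊕ Unit) ℂ) :=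
  {A | ∀ u v w, threeForm (A *ᵥ u) v w + threeForm u (A *ᵥ v) w + threeForm u v (A *ᵥ w) = 0}

def pauliX : Matrix (Fin 2) (Fin 2) ℂ := !![0, 1; 1, 0]
def pauliY : Matrix (Fin 2) (Fin 2) ℂ := !![0, -Complex.I; Complex.I, 0]
def pauliZ : Matrix (Fin 2) (Fin 2) ℂ := !![1, 0; 0, -1]

/-- Seven pairwise anti-commuting matrices with square one on the spinor space `ℂ² ⊗ ℂ² ⊗ ℂ²`. -/
def gammaMat : Fin 7 → Matrix (Fin 2 × Fin 2 × Fin 2) (Fin 2 × Fin 2 × Fin 2) ℂ :=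
  ![pauliX ⊗ₖ (1 ⊗ₖ 1), pauliY ⊗ₖ (1 ⊗ₖ 1), pauliZ ⊗ₖ (pauliX ⊗ₖ 1), pauliZ ⊗ₖ (pauliY ⊗ₖ 1),
    pauliZ ⊗ₖ (pauliZ ⊗ₖ pauliX), pauliZ ⊗ₖ (pauliZ ⊗ₖ pauliY), pauliZ ⊗ₖ (pauliZ ⊗ₖ pauliZ)]

/-- The Lie algebra `so(7)` in its spin representation, spanned by the products `γᵢ γⱼ`, `i ≠ j`. -/
def spin7 : Set (Matrix (Fin 2 × Fin 2 × Fin 2) (Fin 2 × Fin 2 × Fin 2) ℂ) :=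
  Submodule.span ℂ {A | ∃ i j : Fin 7, i ≠ j ∧ A = gammaMat i * gammaMat j}

/-- `L` is a basic classical Lie superalgebra and `h` is a Cartan subalgebra: up to isomorphism,
`L` is one of `gl(m|n)`, `sl(m|n)` with `m ≠ n`, `osp(m|2n)`, with `h` the diagonal matrices, or one
of the exceptional ones. The exceptional Lie superalgebras `D(2,1;a)`, `G(3)`, `F(4)` are the simple
ones with even parts `sl(2) × sl(2) × sl(2)`, `G₂ × sl(2)`, `so(7) × sl(2)` and odd parts
`ℂ² ⊗ ℂ² ⊗ ℂ²`, `ℂ⁷ ⊗ ℂ²`, `spin₇ ⊗ ℂ²`, respectively. -/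
inductive IsBasicClassical (h : Submodule ℂ L) : Prop
  | gl (m n : ℕ) : IsoPair h (diagSub (Fin m ⊕ Fin n)) → IsBasicClassical h
  | sl (m n : ℕ) : m ≠ n →
      IsoPair h ((diagSub (Fin m ⊕ Fin n)).comap (slSub (Fin m) (Fin n)).subtype) →
      IsBasicClassical h
  | osp (m n : ℕ) : IsoPair h ((diagSub (Fin m ⊕ (Fin n ⊕ Fin n))).comap (ospSub m n).subtype) →
      IsBasicClassical h
  | d21 : IsExceptional sl2sl2 h → IsBasicClassical h
  | g3 : IsExceptional g2 h → IsBasicClassical h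
  | f4 : IsExceptional spin7 h → IsBasicClassical h

end BasicClassical

/-! ## The periplectic Lie superalgebra -/

section Periplectic

/-- The Cartan subalgebra of diagonal matrices in `pe(n)`. -/
def peCartan (n : ℕ) : Submodule ℂ (peSub n) := (diagSub (Fin n ⊕ Fin n)).comap (peSub n).subtype

/-- The weight `ε_i`, which reads off the `i`-th diagonal entry of the upper left block. -/
def eps {n : ℕ} (i : Fin n) : Module.Dual ℂ (peCartan n) where
  toFun y := ((y : peSub n) : Matrix (Fin n ⊕ Fin n) (Fin n ⊕ Fin n) ℂ) (Sum.inl i) (Sum.inl i)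
  map_add' _ _ := rfl
  map_smul' _ _ := rfl

/-- The element `e_ii = E_ii - E_(n+i,n+i)` of the Cartan subalgebra. -/
def cartanBasis {n : ℕ} (i : Fin n) : peCartan n :=
  ⟨⟨Matrix.fromBlocks (Matrix.diagonal (Pi.single i 1)) 0 0 (-Matrix.diagonal (Pi.single i 1)),
    by simp [peSub]⟩, by
      simp only [peCartan, Submodule.mem_comap, diagSub]
      exact Matrix.IsDiag.fromBlocks (Matrix.isDiag_diagonal _) (Matrix.isDiag_diagonal _).neg⟩

/-- The bilinear form on `h^*` with `⟨ε_i, ε_j⟩ = δ_ij`. -/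
def peForm {n : ℕ} (ν μ : Module.Dual ℂ (peCartan n)) : ℂ :=
  ∑ i : Fin n, ν (cartanBasis i) * μ (cartanBasis i)

/-- The pairs `(1,1), (1,2), (2,2), (1,3), (2,3), (3,3), …, (n-1,n), (n,n)`. -/
def peSeq (n : ℕ) : List (Fin n × Fin n) :=
  (List.finRange n).flatMap fun j => ((List.finRange n).filter (· ≤ j)).map fun i => (i, j)

/-- The sequence of roots `γ_0, γ_1, … = 2ε_1, ε_1+ε_2, 2ε_2, ε_1+ε_3, …, ε_(n-1)+ε_n, 2ε_n`. -/
def peGamma (n : ℕ) (p : Fin (peSeq n).length) : Module.Dual ℂ (peCartan n) :=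
  eps ((peSeq n).get p).1 + eps ((peSeq n).get p).2

/-- The positive system of the distinguished Borel subalgebra. -/
def peDistinguished (n : ℕ) : Set (Module.Dual ℂ (peCartan n)) :=
  {α | ∃ i j : Fin n, i < j ∧ α = eps i - eps j} ∪ {α | ∃ i j : Fin n, i ≤ j ∧ α = eps i + eps j}

/-- The positive system of the `p`-th Borel subalgebra in the chain from the reverse Borel
subalgebra (`p = 0`) to the distinguished one (`p` the length of the chain): besides the positive
even roots, it contains the `γ_r` with `r < p`, and the negatives of those `γ_r = ε_i + ε_j` with
`r ≥ p` and `i < j`. (The `-2ε_i` are not roots.) -/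
def peRoots (n p : ℕ) : Set (Module.Dual ℂ (peCartan n)) :=
  {α | ∃ i j : Fin n, i < j ∧ α = eps i - eps j} ∪
  {α | ∃ r : Fin (peSeq n).length, (r : ℕ) < p ∧ α = peGamma n r} ∪
  {α | ∃ r : Fin (peSeq n).length, p ≤ (r : ℕ) ∧
    ((peSeq n).get r).1 < ((peSeq n).get r).2 ∧ α = -peGamma n r}

/-- The nilradical of the `p`-th Borel subalgebra of the chain. -/
def peNil (n p : ℕ) : Submodule ℂ (peSub n) := rootSum (peCartan n) (peRoots n p)

/-- The `p`-th Borel subalgebra of the chain. -/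
def peBorel (n p : ℕ) : Submodule ℂ (peSub n) := peCartan n ⊔ peNil n p

/-- Two Borel subalgebras are connected by an inclusion: the first is contained in the second, with
codimension one. -/
def IsInclusion {n : ℕ} (b b' : Submodule ℂ (peSub n)) : Prop :=
  b ≤ b' ∧ Module.finrank ℂ b' = Module.finrank ℂ b + 1

/-- The chain starts at the positive system of the reverse Borel subalgebra. -/
theorem peRoots_zero (n : ℕ) : peRoots n 0 =
    {α | ∃ i j : Fin n, i < j ∧ α = eps i - eps j} ∪
      {α | ∃ i j : Fin n, i < j ∧ α = -(eps i + eps j)} := by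
  ext α
  constructor
  · rintro ((h | ⟨r, hr, -⟩) | ⟨r, -, hr, rfl⟩)
    · exact Or.inl h
    · exact absurd hr (Nat.not_lt_zero _)
    · exact Or.inr ⟨_, _, hr, rfl⟩
  · rintro (h | ⟨i, j, hij, rfl⟩)
    · exact Or.inl (Or.inl h)
    · have : (i, j) ∈ peSeq n := by simp [peSeq, hij.le]
      obtain ⟨r, hr⟩ := List.get_of_mem this
      refine Or.inr ⟨r, Nat.zero_le _, by rw [hr]; exact hij, ?_⟩
      rw [peGamma, hr]

/-- The chain ends at the positive system of the distinguished Borel subalgebra. -/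
theorem peRoots_length (n : ℕ) : peRoots n (peSeq n).length = peDistinguished n := by
  ext α
  constructor
  · rintro ((h | ⟨r, -, rfl⟩) | ⟨r, hr, -⟩)
    · exact Or.inl h
    · have : (peSeq n).get r ∈ peSeq n := List.get_mem _ _
      refine Or.inr ⟨_, _, ?_, rfl⟩
      simp only [peSeq, List.mem_flatMap, List.mem_map, List.mem_filter] at this
      obtain ⟨j, -, i, ⟨-, hi⟩, h⟩ := this
      have h' : (peSeq n).get r = (i, j) := h.symm
      rw [h']
      exact of_decide_eq_true hi
    · exact absurd r.2 (not_lt.2 hr)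
  · rintro (h | ⟨i, j, hij, rfl⟩)
    · exact Or.inl (Or.inl h)
    · have : (i, j) ∈ peSeq n := by simp [peSeq, hij]
      obtain ⟨r, hr⟩ := List.get_of_mem this
      exact Or.inl (Or.inr ⟨r, r.2, by rw [peGamma, hr]⟩)

end Periplectic

end TakiffSuper

end

open TakiffSuper LieSuperalgebra LieSuperModule

/-!
An odd reflection in a root vector `f` of weight `γ` takes place inside a small Takiff superalgebra.
If `e` spans the opposite root space, then `f` and `e` are odd, `[f, f] = 0`, and `t = [e, f]` lies
in the Cartan subalgebra with `γ(t) = 0`, so that the `f^(i)` anticommute, `[e^(i), f^(j)] = t^(i+j)`,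
and the `t^(k)` commute with all `f^(j)`. On a highest weight vector `v` the element `t^(k)` acts by
the scalar `λ^(k)(t)`. The other positive root spaces are stable under bracketing with `f`, so they
kill all products of the `f^(i)` applied to `v`. The structure `IsReflection` records this situation.

Two observations finish the argument. If `λ^(i)(t) = 0` for all `i ≥ j`, then `f^(j) v` is singular
of lower weight, and a singular vector of lower weight in a simple module vanishes
(`singular_eq_zero`): the subspace that it generates under the nonpositive root spaces is already a
graded submodule, with weights bounded away from the weight of `v`. If `k` is maximal with
`λ^(k)(t) ≠ 0`, applying `e^(k), e^(k-1), …, e^(0)` in turn to `f^(0) ⋯ f^(k) v` strips off the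
factors from the left and leaves a nonzero multiple of `v`. Both conclusions are
`IsReflection.highestWeight_self` and `IsReflection.highestWeight_jetProd`.

It remains to produce an `IsReflection`. In the basic classical case (`isReflection_of_isotropic`)
this comes from the invariant form and three properties of the Cartan subalgebra, gathered in
`IsDiagonalCartan`: it is even and abelian, even roots are not isotropic, and odd weight spaces are
at most one-dimensional. These hold because the Cartan subalgebra acts by diagonal matrices, with
distinct weights on the odd part. In the periplectic case (`pe_isReflection`) the root vectors are
explicit, and each positive system of the chain is cut out by an explicit element of the Cartan
subalgebra (`exists_realizes`). For `γ = 2 ε_i` there is no opposite root and `t = 0`, so an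
inclusion of Borel subalgebras is covered by the first of the two conclusions.
-/

open scoped TensorProduct Polynomial Matrix Kronecker

noncomputable section

namespace TakiffSuper

/-! ### Elements of Takiff superalgebras -/

section Jets

variable {L : Type*} [AddCommGroup L] [Module ℂ L] {ℓ : ℕ}

theorem theta_pow_eq_zero {k : ℕ} (hk : ℓ < k) : theta ℓ ^ k = 0 := by
  have h : theta ℓ ^ (ℓ + 1) = 0 := by
    have := AdjoinRoot.mk_self (f := (Polynomial.X : ℂ[X]) ^ (ℓ + 1))
    rwa [map_pow, AdjoinRoot.mk_X] at this
  obtain ⟨d, rfl⟩ := Nat.exists_eq_add_of_le hk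
  rw [pow_add, h, zero_mul]

theorem jet_eq_zero (x : L) {k : ℕ} (hk : ℓ < k) : jet ℓ x k = 0 := by
  rw [jet, theta_pow_eq_zero hk, TensorProduct.tmul_zero]

theorem jet_add (x y : L) (k : ℕ) : jet ℓ (x + y) k = jet ℓ x k + jet ℓ y k :=
  TensorProduct.add_tmul _ _ _

theorem jet_smul (c : ℂ) (x : L) (k : ℕ) : jet ℓ (c • x) k = c • jet ℓ x k := rfl

@[simp] theorem jet_zero (k : ℕ) : jet ℓ (0 : L) k = 0 := TensorProduct.zero_tmul _ _

theorem jet_mem_takiffSub {s : Submodule ℂ L} {x : L} (hx : x ∈ s) (k : ℕ) :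
    jet ℓ x k ∈ takiffSub s ℓ := Submodule.subset_span ⟨x, hx, _, rfl⟩

theorem takiffSub_le_iff {s : Submodule ℂ L} {N : Submodule ℂ (Takiff L ℓ)} :
    takiffSub s ℓ ≤ N ↔ ∀ x ∈ s, ∀ k, jet ℓ x k ∈ N := by
  refine ⟨fun h x hx k => h (jet_mem_takiffSub hx k), fun h => Submodule.span_le.2 ?_⟩
  rintro _ ⟨x, hx, a, rfl⟩
  induction a using AdjoinRoot.induction_on with
  | ih p =>
    induction p using Polynomial.induction_on' with
    | add p q hp hq =>
      rw [map_add, TensorProduct.tmul_add]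
      exact add_mem hp hq
    | monomial k c =>
      have : AdjoinRoot.mk ((Polynomial.X : ℂ[X]) ^ (ℓ + 1)) (Polynomial.monomial k c) =
          c • theta ℓ ^ k := by
        rw [← Polynomial.C_mul_X_pow_eq_monomial, map_mul, map_pow, AdjoinRoot.mk_X,
          AdjoinRoot.mk_C, Algebra.smul_def]
        rfl
      rw [this, TensorProduct.tmul_smul]
      exact N.smul_mem c (h x hx k)

theorem mem_takiffSub_top (z : Takiff L ℓ) : z ∈ takiffSub (⊤ : Submodule ℂ L) ℓ := by
  induction z using TensorProduct.induction_on with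
  | zero => exact zero_mem _
  | add u v hu hv => exact add_mem hu hv
  | tmul x a => exact Submodule.subset_span ⟨x, trivial, a, rfl⟩

variable [LieSuperalgebra L]

theorem br_jet (x y : L) (i j : ℕ) : br (jet ℓ x i) (jet ℓ y j) = jet ℓ (br x y) (i + j) :=
  (tensorBr_tmul x y _ _).trans (by rw [← pow_add]; rfl)

theorem jet_mem_part {i : ZMod 2} {x : L} (hx : x ∈ part i) (k : ℕ) :
    jet ℓ x k ∈ part (L := Takiff L ℓ) i := jet_mem_takiffSub hx k

end Jets

/-! ### Gradings and root spaces -/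

section Graded

variable {L : Type*} [AddCommGroup L] [Module ℂ L] [LieSuperalgebra L]

@[simp] theorem sgn_zero_left (j : ZMod 2) : sgn 0 j = 1 := by simp [sgn]

@[simp] theorem sgn_zero_right (j : ZMod 2) : sgn j 0 = 1 := by simp [sgn]

@[simp] theorem sgn_one_one : sgn 1 1 = -1 := by simp [sgn]

theorem exists_part_add (x : L) : ∃ x0 ∈ part (L := L) 0, ∃ x1 ∈ part (L := L) 1, x0 + x1 = x :=
  Submodule.mem_sup.1 ((codisjoint_iff.1 (part_isCompl (L := L)).codisjoint).symm ▸
    Submodule.mem_top : x ∈ part 0 ⊔ part 1)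

theorem eq_zero_of_mem_parts {x : L} (h0 : x ∈ part (L := L) 0) (h1 : x ∈ part (L := L) 1) :
    x = 0 := Submodule.disjoint_def.1 part_isCompl.disjoint x h0 h1

/-- A subspace that contains the homogeneous components of its elements. -/
def IsGraded (s : Submodule ℂ L) : Prop :=
  ∀ x ∈ s, ∃ x0 ∈ s, x0 ∈ part (L := L) 0 ∧ ∃ x1 ∈ s, x1 ∈ part (L := L) 1 ∧ x0 + x1 = x

theorem br_even_skew {x : L} (hx : x ∈ part (L := L) 0) (y : L) : br x y = -br y x := by
  obtain ⟨y0, h0, y1, h1, rfl⟩ := exists_part_add y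
  simp only [map_add, LinearMap.add_apply, neg_add]
  rw [br_skew hx h0, br_skew hx h1]
  simp

theorem br_even_jacobi {x : L} (hx : x ∈ part (L := L) 0) (y z : L) :
    br x (br y z) = br (br x y) z + br y (br x z) := by
  obtain ⟨y0, h0, y1, h1, rfl⟩ := exists_part_add y
  simp only [map_add, LinearMap.add_apply]
  rw [br_jacobi z hx h0, br_jacobi z hx h1]
  simp only [sgn_zero_left, one_smul]
  abel

theorem rootSpace_isGraded {h : Submodule ℂ L} (hh : h ≤ part (L := L) 0)
    (α : Module.Dual ℂ h) : IsGraded (rootSpace h α) := by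
  intro x hx
  obtain ⟨x0, h0, x1, h1, rfl⟩ := exists_part_add x
  -- The components of `[y, x] = α(y) x` in the two parities.
  have key : ∀ y : h, br (y : L) x0 - α y • x0 = 0 ∧ br (y : L) x1 - α y • x1 = 0 := by
    intro y
    have hsum : (br (y : L) x0 - α y • x0) = -(br (y : L) x1 - α y • x1) := by
      have := hx y
      rw [map_add, smul_add] at this
      rw [eq_neg_iff_add_eq_zero, ← sub_eq_zero.2 this]
      abel
    have m0 : br (y : L) x0 - α y • x0 ∈ part (L := L) 0 :=
      sub_mem (by simpa using br_mem (hh y.2) h0) (Submodule.smul_mem _ _ h0)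
    have m1 : br (y : L) x1 - α y • x1 ∈ part (L := L) 1 :=
      sub_mem (by simpa using br_mem (hh y.2) h1) (Submodule.smul_mem _ _ h1)
    have z0 := eq_zero_of_mem_parts m0 (by rw [hsum]; exact neg_mem m1)
    exact ⟨z0, by rw [z0, eq_comm, neg_eq_zero] at hsum; exact hsum⟩
  exact ⟨x0, fun y => sub_eq_zero.1 (key y).1, h0, x1, fun y => sub_eq_zero.1 (key y).2, h1, rfl⟩

theorem rootSum_isGraded {h : Submodule ℂ L} (hh : h ≤ part (L := L) 0)
    (P : Set (Module.Dual ℂ h)) : IsGraded (rootSum h P) := by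
  intro x hx
  have hle : rootSum h P ≤ (rootSum h P ⊓ part 0) ⊔ (rootSum h P ⊓ part 1) := by
    refine iSup₂_le fun α hα y hy => ?_
    have hs : rootSpace h α ≤ rootSum h P := le_iSup₂_of_le α hα le_rfl
    obtain ⟨y0, h0, p0, y1, h1, p1, rfl⟩ := rootSpace_isGraded hh α y hy
    exact Submodule.add_mem_sup ⟨hs h0, p0⟩ ⟨hs h1, p1⟩
  obtain ⟨x0, h0, x1, h1, rfl⟩ := Submodule.mem_sup.1 (hle hx)
  exact ⟨x0, h0.1, h0.2, x1, h1.1, h1.2, rfl⟩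

theorem rootSpace_le_rootSum {h : Submodule ℂ L} {P : Set (Module.Dual ℂ h)}
    {α : Module.Dual ℂ h} (hα : α ∈ P) : rootSpace h α ≤ rootSum h P :=
  le_iSup₂_of_le α hα le_rfl

theorem br_mem_rootSpace {h : Submodule ℂ L} (hh : h ≤ part (L := L) 0)
    {α β : Module.Dual ℂ h} {x y : L} (hx : x ∈ rootSpace h α) (hy : y ∈ rootSpace h β) :
    br x y ∈ rootSpace h (α + β) := by
  intro z
  rw [br_even_jacobi (hh z.2), hx z, hy z, map_smul, map_smul, LinearMap.smul_apply,
    LinearMap.add_apply, add_smul]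

end Graded

/-! ### Actions on modules -/

section Action

variable {L : Type*} [AddCommGroup L] [Module ℂ L] [LieSuperalgebra L]
variable {M : Type*} [AddCommGroup M] [Module ℂ M] [LieSuperModule L M]

theorem act_act {i j : ZMod 2} {x y : L} (hx : x ∈ part i) (hy : y ∈ part j) (m : M) :
    act x (act y m) = act (br x y) m + sgn i j • act y (act x m) := by
  rw [act_br m hx hy, sub_add_cancel]

theorem act_act_even {x : L} (hx : x ∈ part (L := L) 0) (y : L) (m : M) :
    act x (act y m) = act (br x y) m + act y (act x m) := by
  obtain ⟨y0, h0, y1, h1, rfl⟩ := exists_part_add y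
  simp only [map_add, LinearMap.add_apply]
  rw [act_act hx h0, act_act hx h1]
  simp only [sgn_zero_left, one_smul]
  abel

variable (L) in
theorem exists_grade_add (m : M) : ∃ m0 ∈ grade L (M := M) 0, ∃ m1 ∈ grade L (M := M) 1,
    m0 + m1 = m :=
  Submodule.mem_sup.1
    ((codisjoint_iff.1 (grade_isCompl (L := L) (M := M)).codisjoint).symm ▸ Submodule.mem_top :
      m ∈ grade L 0 ⊔ grade L 1)

variable (L) in
theorem eq_zero_of_add_grade_eq_zero {i : ZMod 2} {a b : M} (ha : a ∈ grade L i)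
    (hb : b ∈ grade L (i + 1)) (hab : a + b = 0) : a = 0 ∧ b = 0 := by
  have hd := Submodule.disjoint_def.1 (grade_isCompl (L := L) (M := M)).disjoint
  have h1 : a = -b := eq_neg_of_add_eq_zero_left hab
  have ha' : a ∈ grade L (i + 1) := h1 ▸ neg_mem hb
  have h2 : a = 0 := by
    rcases zmod2_cases i with rfl | rfl
    · exact hd a ha (by simpa using ha')
    · exact hd a (by simpa [show (1 : ZMod 2) + 1 = 0 by decide] using ha') ha
  exact ⟨h2, by rw [h2, zero_add] at hab; exact hab⟩

/-- The homogeneous components of a vector killed by a homogeneous element are killed by it. -/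
theorem act_components_eq_zero {i : ZMod 2} {x : L} (hx : x ∈ part i) {m0 m1 : M}
    (h0 : m0 ∈ grade L 0) (h1 : m1 ∈ grade L 1) (h : act x (m0 + m1) = 0) :
    act x m0 = 0 ∧ act x m1 = 0 := by
  refine eq_zero_of_add_grade_eq_zero L (i := i) (by simpa using act_mem hx h0) (act_mem hx h1) ?_
  rw [← map_add, h]

end Action

section TakiffAction

variable {L : Type*} [AddCommGroup L] [Module ℂ L] [LieSuperalgebra L] {ℓ : ℕ}
variable {M : Type*} [AddCommGroup M] [Module ℂ M] [LieSuperModule (Takiff L ℓ) M]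

theorem act_takiffSub_eq_zero_iff {s : Submodule ℂ L} {m : M} :
    (∀ x ∈ takiffSub s ℓ, act x m = 0) ↔ ∀ x ∈ s, ∀ k, act (jet ℓ x k) m = 0 :=
  takiffSub_le_iff (N := LinearMap.ker ((act (L := Takiff L ℓ) (M := M)).flip m))

/-! ### The submodule generated by a singular vector -/

/-- The subspace generated by `w` under the root spaces with `Re δ(H) ≤ 0`. -/
def lowerSpan (h : Submodule ℂ L) (H : h) (ℓ : ℕ) [LieSuperModule (Takiff L ℓ) M] (w : M) :
    Submodule ℂ M :=
  sInf {N | w ∈ N ∧ ∀ δ : Module.Dual ℂ h, (δ H).re ≤ 0 → ∀ x ∈ rootSpace h δ, ∀ k, ∀ m ∈ N,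
    act (jet ℓ x k) m ∈ N}

theorem mem_lowerSpan (h : Submodule ℂ L) (H : h) (w : M) : w ∈ lowerSpan h H ℓ w :=
  Submodule.mem_sInf.2 fun _ hN => hN.1

theorem act_mem_lowerSpan {h : Submodule ℂ L} {H : h} {w : M} {δ : Module.Dual ℂ h}
    (hδ : (δ H).re ≤ 0) {x : L} (hx : x ∈ rootSpace h δ) (k : ℕ) {m : M}
    (hm : m ∈ lowerSpan h H ℓ w) : act (jet ℓ x k) m ∈ lowerSpan h H ℓ w :=
  Submodule.mem_sInf.2 fun N hN => hN.2 δ hδ x hx k m (Submodule.mem_sInf.1 hm N hN)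

theorem lowerSpan_le {h : Submodule ℂ L} {H : h} {w : M} {N : Submodule ℂ M} (hw : w ∈ N)
    (hN : ∀ δ : Module.Dual ℂ h, (δ H).re ≤ 0 → ∀ x ∈ rootSpace h δ, ∀ k, ∀ m ∈ N,
      act (jet ℓ x k) m ∈ N) : lowerSpan h H ℓ w ≤ N := sInf_le ⟨hw, hN⟩

/-- If the root spaces with `Re δ(H) > 0` kill `w`, then the subspace generated by `w` under the
other root spaces is a submodule; this takes the place of the Poincaré–Birkhoff–Witt theorem. -/
theorem lowerSpan_invariant {h : Submodule ℂ L} (hh : h ≤ part (L := L) 0)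
    (hspan : ⨆ α : Module.Dual ℂ h, rootSpace h α = ⊤) {H : h} {w : M}
    (hw : ∀ δ : Module.Dual ℂ h, 0 < (δ H).re → ∀ x ∈ rootSpace h δ, ∀ k, act (jet ℓ x k) w = 0)
    (z : Takiff L ℓ) {m : M} (hm : m ∈ lowerSpan h H ℓ w) : act z m ∈ lowerSpan h H ℓ w := by
  -- The vectors of the span that stay in it under the whole superalgebra form a subspace that is
  -- closed under the lower root spaces, because `z x m = [z, x] m ± x z m`.
  let S : Submodule ℂ M := lowerSpan h H ℓ w
  let N : Submodule ℂ M :=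
    S ⊓ ⨅ z : Takiff L ℓ, S.comap (act z)
  have hN : ∀ {m : M}, m ∈ N ↔ m ∈ S ∧ ∀ z : Takiff L ℓ, act z m ∈ S := by
    intro m
    simp [N]
  suffices hle : S ≤ N from (hN.1 (hle hm)).2 z
  refine lowerSpan_le (hN.2 ⟨mem_lowerSpan h H w, fun z => ?_⟩) ?_
  · have hz : takiffSub (⊤ : Submodule ℂ L) ℓ ≤
        S.comap ((act (L := Takiff L ℓ) (M := M)).flip w) := by
      refine takiffSub_le_iff.2 fun x _ k => ?_
      have hx : x ∈ ⨆ α : Module.Dual ℂ h, rootSpace h α := hspan ▸ Submodule.mem_top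
      induction hx using Submodule.iSup_induction' with
      | mem δ x hx =>
        change act (jet ℓ x k) w ∈ S
        rcases le_or_gt (δ H).re 0 with hδ | hδ
        · exact act_mem_lowerSpan hδ hx k (mem_lowerSpan h H w)
        · rw [hw δ hδ x hx k]
          exact zero_mem _
      | zero => rw [jet_zero]; exact zero_mem _
      | add x y _ _ hx hy => rw [jet_add]; exact add_mem (hx trivial) (hy trivial)
    exact hz (mem_takiffSub_top z)
  · intro δ hδ x hx k m hm
    obtain ⟨hmS, hmz⟩ := hN.1 hm
    refine hN.2 ⟨act_mem_lowerSpan hδ hx k hmS, fun z => ?_⟩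
    have key : ∀ {i j : ZMod 2} {z : Takiff L ℓ} {x : L}, z ∈ part i → x ∈ part j →
        x ∈ rootSpace h δ → act z (act (jet ℓ x k) m) ∈ S := by
      intro i j z x hz hxj hx
      rw [act_act hz (jet_mem_part hxj k)]
      exact add_mem (hmz _) (S.smul_mem _ (act_mem_lowerSpan hδ hx k (hmz z)))
    obtain ⟨x0, h0, p0, x1, h1, p1, rfl⟩ := rootSpace_isGraded hh δ x hx
    obtain ⟨z0, hz0, z1, hz1, rfl⟩ := exists_part_add z
    simp only [jet_add, map_add, LinearMap.add_apply]
    exact add_mem (add_mem (key hz0 p0 h0) (key hz1 p0 h0)) (add_mem (key hz0 p1 h1) (key hz1 p1 h1))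

theorem lowerSpan_graded {h : Submodule ℂ L} (hh : h ≤ part (L := L) 0) {H : h} {w : M}
    {j : ZMod 2} (hwj : w ∈ grade (Takiff L ℓ) j) :
    (lowerSpan h H ℓ w ⊓ grade (Takiff L ℓ) 0) ⊔ (lowerSpan h H ℓ w ⊓ grade (Takiff L ℓ) 1) =
      lowerSpan h H ℓ w := by
  refine le_antisymm (sup_le inf_le_left inf_le_left) (lowerSpan_le ?_ ?_)
  · rcases zmod2_cases j with rfl | rfl
    · exact Submodule.mem_sup_left ⟨mem_lowerSpan h H w, hwj⟩
    · exact Submodule.mem_sup_right ⟨mem_lowerSpan h H w, hwj⟩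
  · intro δ hδ x hx k m hm
    have key : ∀ {i j : ZMod 2} {x : L} {m : M}, x ∈ part i → x ∈ rootSpace h δ →
        m ∈ lowerSpan h H ℓ w → m ∈ grade (Takiff L ℓ) j → act (jet ℓ x k) m ∈
          (lowerSpan h H ℓ w ⊓ grade (Takiff L ℓ) 0) ⊔
            (lowerSpan h H ℓ w ⊓ grade (Takiff L ℓ) 1) := by
      intro i j x m hxi hx hm hmj
      have h1 := act_mem_lowerSpan hδ hx k hm
      have h2 := act_mem (jet_mem_part hxi k) hmj
      rcases zmod2_cases (i + j) with hij | hij <;> rw [hij] at h2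
      · exact Submodule.mem_sup_left ⟨h1, h2⟩
      · exact Submodule.mem_sup_right ⟨h1, h2⟩
    obtain ⟨x0, h0, p0, x1, h1, p1, rfl⟩ := rootSpace_isGraded hh δ x hx
    obtain ⟨m0, hm0, m1, hm1, rfl⟩ := Submodule.mem_sup.1 hm
    simp only [jet_add, map_add, LinearMap.add_apply]
    exact add_mem (add_mem (key p0 h0 hm0.1 hm0.2) (key p1 h1 hm0.1 hm0.2))
      (add_mem (key p0 h0 hm1.1 hm1.2) (key p1 h1 hm1.1 hm1.2))

theorem lowerSpan_le_eigenspaces {h : Submodule ℂ L} (hh : h ≤ part (L := L) 0) {H : h} {w : M}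
    {c : ℂ} (hc : act (jet ℓ (H : L) 0) w = c • w) :
    lowerSpan h H ℓ w ≤ ⨆ (μ : ℂ) (_ : μ.re ≤ c.re),
      Module.End.eigenspace (act (jet ℓ (H : L) 0) : Module.End ℂ M) μ := by
  refine lowerSpan_le ?_ ?_
  · exact Submodule.mem_iSup_of_mem c (Submodule.mem_iSup_of_mem le_rfl
      (Module.End.mem_eigenspace_iff.2 hc))
  · intro δ hδ x hx k m hm
    suffices hle : (⨆ (μ : ℂ) (_ : μ.re ≤ c.re),
        Module.End.eigenspace (act (jet ℓ (H : L) 0) : Module.End ℂ M) μ) ≤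
        (⨆ (μ : ℂ) (_ : μ.re ≤ c.re),
          Module.End.eigenspace (act (jet ℓ (H : L) 0) : Module.End ℂ M) μ).comap
          (act (jet ℓ x k)) from hle hm
    refine iSup₂_le fun μ hμ m hm => ?_
    refine Submodule.mem_iSup_of_mem (δ H + μ) (Submodule.mem_iSup_of_mem ?_
      (Module.End.mem_eigenspace_iff.2 ?_))
    · rw [Complex.add_re]
      linarith
    · rw [act_act_even (jet_mem_part (hh H.2) 0), br_jet, hx H, jet_smul,
        Module.End.mem_eigenspace_iff.1 hm, map_smul, map_smul, LinearMap.smul_apply, zero_add,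
        add_smul]

/-- A singular vector whose `H`-weight lies strictly below that of some nonzero vector of a simple
module vanishes: otherwise it would generate a proper submodule. -/
theorem singular_eq_zero (hM : IsSimpleMod (Takiff L ℓ) M) {h : Submodule ℂ L}
    (hh : h ≤ part (L := L) 0) (hspan : ⨆ α : Module.Dual ℂ h, rootSpace h α = ⊤) {H : h}
    {v w : M} {c d : ℂ} (hv : v ≠ 0) (hvd : act (jet ℓ (H : L) 0) v = d • v)
    (hwc : act (jet ℓ (H : L) 0) w = c • w) (hcd : c.re < d.re)
    (hw : ∀ δ : Module.Dual ℂ h, 0 < (δ H).re → ∀ x ∈ rootSpace h δ, ∀ k,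
      act (jet ℓ x k) w = 0) : w = 0 := by
  have hom : ∀ {j : ZMod 2} {w : M}, w ∈ grade (Takiff L ℓ) j →
      act (jet ℓ (H : L) 0) w = c • w →
      (∀ δ : Module.Dual ℂ h, 0 < (δ H).re → ∀ x ∈ rootSpace h δ, ∀ k,
        act (jet ℓ x k) w = 0) → w = 0 := by
    intro j w hwj hwc hw
    rcases hM.2 (lowerSpan h H ℓ w) (fun z m hm => lowerSpan_invariant hh hspan hw z hm)
      (lowerSpan_graded hh hwj) with hbot | htop
    · exact (Submodule.mem_bot ℂ).1 (hbot ▸ mem_lowerSpan h H w)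
    · exfalso
      have hvS := lowerSpan_le_eigenspaces hh hwc (htop.symm ▸ Submodule.mem_top : v ∈ _)
      refine hv (Submodule.disjoint_def.1 (Module.End.eigenspaces_iSupIndep
        (act (jet ℓ (H : L) 0) : Module.End ℂ M) d) v (Module.End.mem_eigenspace_iff.2 hvd) ?_)
      refine SetLike.le_def.1 (iSup₂_le fun μ hμ => le_iSup₂_of_le μ ?_ le_rfl) hvS
      rintro rfl
      exact absurd hcd (not_lt.2 hμ)
  obtain ⟨w0, h0, w1, h1, rfl⟩ := exists_grade_add (Takiff L ℓ) w
  have hkill : ∀ δ : Module.Dual ℂ h, 0 < (δ H).re → ∀ x ∈ rootSpace h δ, ∀ k,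
      act (jet ℓ x k) w0 = 0 ∧ act (jet ℓ x k) w1 = 0 := by
    intro δ hδ x hx k
    obtain ⟨x0, m0, p0, x1, m1, p1, rfl⟩ := rootSpace_isGraded hh δ x hx
    have k0 := act_components_eq_zero (jet_mem_part p0 k) h0 h1 (hw δ hδ x0 m0 k)
    have k1 := act_components_eq_zero (jet_mem_part p1 k) h0 h1 (hw δ hδ x1 m1 k)
    simp only [jet_add, map_add, LinearMap.add_apply]
    exact ⟨by rw [k0.1, k1.1, add_zero], by rw [k0.2, k1.2, add_zero]⟩
  have hH : ∀ {j : ZMod 2} {m : M}, m ∈ grade (Takiff L ℓ) j →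
      act (jet ℓ (H : L) 0) m - c • m ∈ grade (Takiff L ℓ) j := fun {j} {m} hm =>
    sub_mem (by simpa using act_mem (jet_mem_part (hh H.2) 0) hm) (Submodule.smul_mem _ _ hm)
  have heig := eq_zero_of_add_grade_eq_zero (Takiff L ℓ) (i := 0) (hH h0)
    (by simpa using hH h1) (by
      rw [map_add, smul_add] at hwc
      rw [← sub_eq_zero.2 hwc]
      abel)
  rw [hom h0 (sub_eq_zero.1 heig.1) fun δ hδ x hx k => (hkill δ hδ x hx k).1,
    hom h1 (sub_eq_zero.1 heig.2) fun δ hδ x hx k => (hkill δ hδ x hx k).2, add_zero]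

end TakiffAction

/-! ### Odd reflections of highest weight vectors -/

section Core

variable {L : Type*} [AddCommGroup L] [Module ℂ L] [LieSuperalgebra L] {ℓ : ℕ}
variable {M : Type*} [AddCommGroup M] [Module ℂ M] [LieSuperModule (Takiff L ℓ) M]

/-- The situation of an odd reflection in an odd root vector `f` of weight `γ`: the nilradical
before the reflection is `n' + L^(-γ)`, where `n'` is stable under bracketing with `f`, and `f`,
`L^(-γ)` and `t` form a Heisenberg superalgebra with `[L^(-γ), f] ⊆ ℂ t` and `t` central. The space
`L^(-γ)` may be zero. -/
structure IsReflection (h n' : Submodule ℂ L) (H : h) (γ : Module.Dual ℂ h) (f : L) (t : h) :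
    Prop where
  even : h ≤ part (L := L) 0
  span : ⨆ α : Module.Dual ℂ h, rootSpace h α = ⊤
  pos : ∀ δ : Module.Dual ℂ h, 0 < (δ H).re → rootSpace h δ ≤ n' ⊔ rootSpace h (-γ)
  neg : (γ H).re < 0
  graded : IsGraded n'
  br_nil : ∀ x ∈ n', br x f ∈ n'
  f_mem : f ∈ rootSpace h γ
  f_odd : f ∈ part (L := L) 1
  br_self : br f f = 0
  central : γ t = 0
  br_opposite : ∀ e ∈ rootSpace h (-γ), e ∈ part (L := L) 1 ∧ ∃ c : ℂ, br e f = c • (t : L)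

/-- The vector `f^(i₁) ⋯ f^(iᵣ) v` for a list `i₁, …, iᵣ`. -/
def jetList (ℓ : ℕ) [LieSuperModule (Takiff L ℓ) M] (f : L) (l : List ℕ) (v : M) : M :=
  ((l.map fun i => (act (jet ℓ f i) : Module.End ℂ M)).prod) v

@[simp] theorem jetList_nil (f : L) (v : M) : jetList ℓ f [] v = v := by simp [jetList]

@[simp] theorem jetList_cons (f : L) (i : ℕ) (l : List ℕ) (v : M) :
    jetList ℓ f (i :: l) v = act (jet ℓ f i) (jetList ℓ f l v) := by
  simp [jetList]

theorem jetProd_eq_jetList (f : L) (k : ℕ) (v : M) :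
    jetProd ℓ f k v = jetList ℓ f (List.range' 0 (k + 1)) v := by
  rw [jetProd, jetList, List.range_eq_range']

/-- A weight exists as soon as the Cartan part acts by scalars. -/
theorem exists_highestWeight {h n : Submodule ℂ L} {w : M} (hw : w ≠ 0)
    (hn : ∀ x ∈ n, ∀ k, act (jet ℓ x k) w = 0)
    (hh : ∀ y ∈ h, ∀ k, ∃ c : ℂ, act (jet ℓ y k) w = c • w) :
    ∃ mu, IsHighestWeightVector h n ℓ mu w := by
  have hspan : takiffSub h ℓ ≤
      (Submodule.span ℂ {w}).comap ((act (L := Takiff L ℓ) (M := M)).flip w) := by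
    refine takiffSub_le_iff.2 fun y hy k => ?_
    obtain ⟨c, hc⟩ := hh y hy k
    exact Submodule.mem_span_singleton.2 ⟨c, hc.symm⟩
  refine ⟨(LinearEquiv.coord ℂ M w hw).toLinearMap ∘ₗ
    (((act (L := Takiff L ℓ) (M := M)).flip w).comp (takiffSub h ℓ).subtype).codRestrict
      (Submodule.span ℂ {w}) fun y => hspan y.2, hw, act_takiffSub_eq_zero_iff.2 hn, fun y => ?_⟩
  exact (LinearEquiv.coord_apply_smul ℂ M w hw
    ⟨act (y : Takiff L ℓ) w, hspan y.2⟩).symm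

variable {h n' : Submodule ℂ L} {H : h} {γ : Module.Dual ℂ h} {f : L} {t : h}

namespace IsReflection

theorem act_f_act_f (hR : IsReflection h n' H γ f t) (i j : ℕ) (m : M) :
    act (jet ℓ f i) (act (jet ℓ f j) m) = -act (jet ℓ f j) (act (jet ℓ f i) m) := by
  rw [act_act (jet_mem_part hR.f_odd i) (jet_mem_part hR.f_odd j), br_jet, hR.br_self]
  simp

theorem act_f_sq (hR : IsReflection h n' H γ f t) (i : ℕ) (m : M) :
    act (jet ℓ f i) (act (jet ℓ f i) m) = 0 := by
  have h1 := hR.act_f_act_f (ℓ := ℓ) i i m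
  rw [eq_neg_iff_add_eq_zero, ← two_smul ℂ] at h1
  exact (smul_eq_zero.1 h1).resolve_left two_ne_zero

theorem act_f_jetList_eq_zero (hR : IsReflection h n' H γ f t) {i : ℕ} {l : List ℕ} {v : M}
    (hi : i ∈ l ∨ act (jet ℓ f i) v = 0) : act (jet ℓ f i) (jetList ℓ f l v) = 0 := by
  induction l with
  | nil => simpa using hi
  | cons j l ih =>
    rw [jetList_cons]
    by_cases hij : i = j
    · rw [hij, hR.act_f_sq]
    · rw [hR.act_f_act_f, ih, map_zero, neg_zero]
      exact hi.imp_left fun hm => (List.mem_cons.1 hm).resolve_left hij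

theorem act_cartan_act_f (hR : IsReflection h n' H γ f t) (y : h) (i j : ℕ) (m : M) :
    act (jet ℓ (y : L) i) (act (jet ℓ f j) m) =
      γ y • act (jet ℓ f (i + j)) m + act (jet ℓ f j) (act (jet ℓ (y : L) i) m) := by
  rw [act_act_even (jet_mem_part (hR.even y.2) i), br_jet, hR.f_mem y, jet_smul, map_smul,
    LinearMap.smul_apply]

theorem act_nil_act_f (hR : IsReflection h n' H γ f t) {m : M}
    (hm : ∀ x ∈ n', ∀ k, act (jet ℓ x k) m = 0) (j : ℕ) :
    ∀ x ∈ n', ∀ k, act (jet ℓ x k) (act (jet ℓ f j) m) = 0 := by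
  have key : ∀ {i : ZMod 2} {x : L}, x ∈ part i → x ∈ n' → ∀ k,
      act (jet ℓ x k) (act (jet ℓ f j) m) = 0 := by
    intro i x hxi hx k
    rw [act_act (jet_mem_part hxi k) (jet_mem_part hR.f_odd j), br_jet, hm _ (hR.br_nil x hx),
      hm x hx, map_zero, smul_zero, add_zero]
  intro x hx k
  obtain ⟨x0, h0, p0, x1, h1, p1, rfl⟩ := hR.graded x hx
  rw [jet_add, map_add, LinearMap.add_apply, key p0 h0, key p1 h1, add_zero]

theorem act_nil_jetList (hR : IsReflection h n' H γ f t) {v : M}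
    (hv : ∀ x ∈ n', ∀ k, act (jet ℓ x k) v = 0) (l : List ℕ) :
    ∀ x ∈ n', ∀ k, act (jet ℓ x k) (jetList ℓ f l v) = 0 := by
  induction l with
  | nil => simpa using hv
  | cons j l ih =>
    rw [jetList_cons]
    exact hR.act_nil_act_f ih j

theorem act_t_jetList (hR : IsReflection h n' H γ f t) {v : M} {c : ℂ} {i : ℕ}
    (hc : act (jet ℓ (t : L) i) v = c • v) (l : List ℕ) :
    act (jet ℓ (t : L) i) (jetList ℓ f l v) = c • jetList ℓ f l v := by
  induction l with
  | nil => simpa using hc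
  | cons j l ih =>
    rw [jetList_cons, hR.act_cartan_act_f, hR.central, zero_smul, zero_add, ih, map_smul]

theorem act_e_act_f (hR : IsReflection h n' H γ f t) {e : L} (he : e ∈ rootSpace h (-γ)) {b : ℂ}
    (hb : br e f = b • (t : L)) (i j : ℕ) (m : M) :
    act (jet ℓ e i) (act (jet ℓ f j) m) =
      b • act (jet ℓ (t : L) (i + j)) m - act (jet ℓ f j) (act (jet ℓ e i) m) := by
  rw [act_act (jet_mem_part (hR.br_opposite e he).1 i) (jet_mem_part hR.f_odd j), br_jet, hb,
    jet_smul, map_smul, LinearMap.smul_apply, sgn_one_one, neg_one_smul, sub_eq_add_neg]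

theorem act_e_jetList_eq_zero (hR : IsReflection h n' H γ f t) {e : L}
    (he : e ∈ rootSpace h (-γ)) {v : M} {i : ℕ} (hev : act (jet ℓ e i) v = 0) {l : List ℕ}
    (hl : ∀ j ∈ l, act (jet ℓ (t : L) (i + j)) v = 0) :
    act (jet ℓ e i) (jetList ℓ f l v) = 0 := by
  obtain ⟨b, hb⟩ := (hR.br_opposite e he).2
  induction l with
  | nil => simpa using hev
  | cons j l ih =>
    have ht : act (jet ℓ (t : L) (i + j)) v = (0 : ℂ) • v := by
      rw [hl j List.mem_cons_self, zero_smul]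
    rw [jetList_cons, hR.act_e_act_f he hb, ih fun j hj => hl j (List.mem_cons_of_mem _ hj),
      hR.act_t_jetList ht, zero_smul, smul_zero, map_zero, sub_zero]

/-- If `t^(i + j)` kills the highest weight vector `v` for all `i`, then so does `f^(j)`: the
vector `f^(j) v` is again singular, of lower weight. -/
theorem act_f_eq_zero (hR : IsReflection h n' H γ f t) (hM : IsSimpleMod (Takiff L ℓ) M) {v : M}
    (hv : v ≠ 0) (hn : ∀ x ∈ n', ∀ k, act (jet ℓ x k) v = 0)
    (he : ∀ e ∈ rootSpace h (-γ), ∀ k, act (jet ℓ e k) v = 0) {d : ℕ → ℂ}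
    (hd : ∀ i, act (jet ℓ (H : L) i) v = d i • v) {j : ℕ}
    (hj : ∀ i, act (jet ℓ (t : L) (i + j)) v = 0) : act (jet ℓ f j) v = 0 := by
  refine singular_eq_zero hM hR.even hR.span hv (hd 0) (c := γ H + d 0) ?_ ?_ ?_
  · rw [hR.act_cartan_act_f, hd 0, map_smul, zero_add, add_smul]
  · rw [Complex.add_re]
    linarith [hR.neg]
  · intro δ hδ x hx k
    obtain ⟨y, hy, e, hee, rfl⟩ := Submodule.mem_sup.1 (hR.pos δ hδ hx)
    have h2 := hR.act_e_jetList_eq_zero hee (he e hee k) (l := [j])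
      (by simpa using hj k)
    rw [jetList_cons, jetList_nil] at h2
    rw [jet_add, map_add, LinearMap.add_apply, hR.act_nil_act_f hn j y hy, h2, add_zero]

/-- If all `t^(i)` kill the highest weight vector `v`, then `v` remains a highest weight vector
after the reflection. -/
theorem highestWeight_self (hR : IsReflection h n' H γ f t) (hM : IsSimpleMod (Takiff L ℓ) M)
    {n n'' : Submodule ℂ L} (hn : n' ⊔ rootSpace h (-γ) ≤ n)
    (hn'' : n'' ≤ n' ⊔ Submodule.span ℂ {f}) {lam : Module.Dual ℂ (takiffSub h ℓ)} {v : M}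
    (hv : IsHighestWeightVector h n ℓ lam v) (hlam : ∀ k ≤ ℓ, weightComp lam k t = 0) :
    ∃ mu, IsHighestWeightVector h n'' ℓ mu v := by
  obtain ⟨hv0, hvn, hvh⟩ := hv
  rw [act_takiffSub_eq_zero_iff] at hvn
  have hh : ∀ (y : h) k, act (jet ℓ (y : L) k) v = weightComp lam k y • v := fun y k =>
    hvh ⟨_, jet_mem_takiffSub y.2 k⟩
  have hf : ∀ j, act (jet ℓ f j) v = 0 := fun j => by
    refine hR.act_f_eq_zero hM hv0 (fun x hx => hvn x (hn (Submodule.mem_sup_left hx)))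
      (fun x hx => hvn x (hn (Submodule.mem_sup_right hx))) (hh H) fun i => ?_
    rcases le_or_gt (i + j) ℓ with hij | hij
    · rw [hh, hlam _ hij, zero_smul]
    · rw [jet_eq_zero _ hij, map_zero, LinearMap.zero_apply]
  refine ⟨lam, hv0, act_takiffSub_eq_zero_iff.2 fun x hx k => ?_, hvh⟩
  obtain ⟨y, hy, z, hz, rfl⟩ := Submodule.mem_sup.1 (hn'' hx)
  obtain ⟨c, rfl⟩ := Submodule.mem_span_singleton.1 hz
  rw [jet_add, jet_smul, map_add, map_smul, LinearMap.add_apply, LinearMap.smul_apply, hf,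
    hvn y (hn (Submodule.mem_sup_left hy)), smul_zero, add_zero]

/-- If `t^(k)` acts on the highest weight vector `v` by a nonzero scalar and the higher `t^(i)` kill
it, then `f^(0) ⋯ f^(k) v` is a highest weight vector after the reflection. -/
theorem highestWeight_jetProd (hR : IsReflection h n' H γ f t) (hM : IsSimpleMod (Takiff L ℓ) M)
    {e : L} (hee : e ∈ rootSpace h (-γ)) (hef : br e f = t)
    {n n'' : Submodule ℂ L} (hn : n' ⊔ rootSpace h (-γ) ≤ n)
    (hn'' : n'' ≤ n' ⊔ Submodule.span ℂ {f}) {lam : Module.Dual ℂ (takiffSub h ℓ)} {v : M}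
    (hv : IsHighestWeightVector h n ℓ lam v) {k : ℕ} (hk : weightComp lam k t ≠ 0)
    (hlam : ∀ j, k < j → j ≤ ℓ → weightComp lam j t = 0) :
    ∃ mu, IsHighestWeightVector h n'' ℓ mu (jetProd ℓ f k v) := by
  obtain ⟨hv0, hvn, hvh⟩ := hv
  rw [act_takiffSub_eq_zero_iff] at hvn
  have hh : ∀ (y : h) k, act (jet ℓ (y : L) k) v = weightComp lam k y • v := fun y k =>
    hvh ⟨_, jet_mem_takiffSub y.2 k⟩
  have hvn' : ∀ x ∈ n', ∀ k, act (jet ℓ x k) v = 0 :=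
    fun x hx => hvn x (hn (Submodule.mem_sup_left hx))
  have hve : ∀ x ∈ rootSpace h (-γ), ∀ k, act (jet ℓ x k) v = 0 :=
    fun x hx => hvn x (hn (Submodule.mem_sup_right hx))
  have ht : ∀ i, k < i → act (jet ℓ (t : L) i) v = 0 := by
    intro i hi
    rcases le_or_gt i ℓ with hij | hij
    · rw [hh, hlam _ hi hij, zero_smul]
    · rw [jet_eq_zero _ hij, map_zero, LinearMap.zero_apply]
  have hf : ∀ j, k < j → act (jet ℓ f j) v = 0 := fun j hj =>
    hR.act_f_eq_zero hM hv0 hvn' hve (hh H) fun i => ht _ (by omega)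
  -- Applying `e^(k-j)` to `f^(j) ⋯ f^(k) v` gives a nonzero multiple of `f^(j+1) ⋯ f^(k) v`.
  have hne : ∀ r j, j + r = k + 1 → jetList ℓ f (List.range' j r) v ≠ 0 := by
    intro r
    induction r with
    | zero => intro j _; simpa using hv0
    | succ r ih =>
      intro j hj hzero
      rw [List.range'_succ, jetList_cons] at hzero
      have h1 := hR.act_e_act_f (ℓ := ℓ) hee (b := 1) (by rw [hef, one_smul]) (k - j) j
        (jetList ℓ f (List.range' (j + 1) r) v)
      have h2 : act (jet ℓ e (k - j)) (jetList ℓ f (List.range' (j + 1) r) v) = 0 := by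
        refine hR.act_e_jetList_eq_zero hee (hve e hee _) fun i hi => ht _ ?_
        have := (List.mem_range'_1.1 hi).1
        omega
      rw [hzero, map_zero, h2, map_zero, sub_zero, one_smul, show k - j + j = k by omega,
        hR.act_t_jetList (hh t k)] at h1
      exact ih (j + 1) (by omega) ((smul_eq_zero.1 h1.symm).resolve_left hk)
  have hf' : ∀ j, act (jet ℓ f j) (jetList ℓ f (List.range' 0 (k + 1)) v) = 0 := by
    intro j
    refine hR.act_f_jetList_eq_zero ?_
    rcases le_or_gt j k with hj | hj
    · exact Or.inl (List.mem_range'_1.2 (by omega))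
    · exact Or.inr (hf j hj)
  -- Moving `y^(i)` with `i > 0` past `f^(j)` produces `f^(i+j)`, which repeats a later factor or
  -- kills `v`.
  have hcar : ∀ (y : h) (i : ℕ), 0 < i → ∀ r j, j + r = k + 1 →
      act (jet ℓ (y : L) i) (jetList ℓ f (List.range' j r) v) =
        weightComp lam i y • jetList ℓ f (List.range' j r) v := by
    intro y i hi r
    induction r with
    | zero => intro j _; simpa using hh y i
    | succ r ih =>
      intro j hj
      have h0 : act (jet ℓ f (i + j)) (jetList ℓ f (List.range' (j + 1) r) v) = 0 := by
        refine hR.act_f_jetList_eq_zero ?_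
        rcases le_or_gt (i + j) k with hij | hij
        · exact Or.inl (List.mem_range'_1.2 (by omega))
        · exact Or.inr (hf _ hij)
      rw [List.range'_succ, jetList_cons, hR.act_cartan_act_f, h0, smul_zero, zero_add,
        ih (j + 1) (by omega), map_smul]
  have hcar0 : ∀ (y : h) (l : List ℕ), ∃ c : ℂ,
      act (jet ℓ (y : L) 0) (jetList ℓ f l v) = c • jetList ℓ f l v := by
    intro y l
    induction l with
    | nil => exact ⟨_, by simpa using hh y 0⟩
    | cons j l ih =>
      obtain ⟨c, hc⟩ := ih
      exact ⟨γ y + c, by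
        rw [jetList_cons, hR.act_cartan_act_f, hc, map_smul, zero_add, add_smul]⟩
  rw [jetProd_eq_jetList]
  refine exists_highestWeight (hne _ 0 (by omega)) (fun x hx i => ?_) fun y hy i => ?_
  · obtain ⟨x', hx', z, hz, rfl⟩ := Submodule.mem_sup.1 (hn'' hx)
    obtain ⟨c, rfl⟩ := Submodule.mem_span_singleton.1 hz
    rw [jet_add, jet_smul, map_add, map_smul, LinearMap.add_apply, LinearMap.smul_apply, hf',
      hR.act_nil_jetList hvn' _ x' hx', smul_zero, add_zero]
  · rcases Nat.eq_zero_or_pos i with rfl | hi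
    · exact hcar0 ⟨y, hy⟩ _
    · exact ⟨_, hcar ⟨y, hy⟩ i hi _ 0 (by omega)⟩

end IsReflection

end Core

/-! ### Cartan subalgebras acting diagonally -/

section Cartan

variable {L : Type*} [AddCommGroup L] [Module ℂ L] [LieSuperalgebra L]

/-- The properties of a Cartan subalgebra of a basic classical Lie superalgebra on which odd
reflections rest: it is even and abelian, a nonzero commutator of even elements that lies in it does
not commute with the factors, and its weight spaces in the odd part are at most one-dimensional.
The weight `a` in the last condition is a function on `L` of which only the values on `h` matter. -/
structure IsDiagonalCartan (h : Submodule ℂ L) : Prop where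
  even : h ≤ part (L := L) 0
  abelian : ∀ y ∈ h, ∀ z ∈ h, br y z = 0
  anisotropic : ∀ x ∈ part (L := L) 0, ∀ y ∈ part (L := L) 0, br x y ∈ h →
    br (br x y) x = 0 → br x y = 0
  odd_line : ∀ (a : L → ℂ), ∀ x ∈ part (L := L) 1, ∀ z ∈ part (L := L) 1,
    (∀ y ∈ h, br y x = a y • x) → (∀ y ∈ h, br y z = a y • z) → x ≠ 0 → ∃ c : ℂ, z = c • x

theorem IsDiagonalCartan.of_isoPair {L' : Type*} [AddCommGroup L'] [Module ℂ L']
    [LieSuperalgebra L'] {h : Submodule ℂ L} {h' : Submodule ℂ L'} (hp : IsoPair h h')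
    (hh : IsDiagonalCartan h') : IsDiagonalCartan h := by
  obtain ⟨φ, hpart, hbr, rfl⟩ := hp
  have hmem : ∀ y ∈ h, φ y ∈ h.map φ.toLinearMap := fun y hy => ⟨y, hy, rfl⟩
  refine ⟨fun y hy => ?_, fun y hy z hz => ?_, fun x hx y hy hxy hc => ?_,
    fun a x hx z hz hax haz hx0 => ?_⟩
  · obtain ⟨y0, h0, y1, h1, rfl⟩ := exists_part_add y
    have hy1 : φ y1 ∈ part (L := L') 0 := by
      have := sub_mem (hh.even (hmem _ hy)) (hpart 0 y0 h0)
      rwa [map_add, add_sub_cancel_left] at this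
    have := eq_zero_of_mem_parts hy1 (hpart 1 y1 h1)
    rw [φ.map_eq_zero_iff] at this
    rwa [this, add_zero]
  · rw [← φ.map_eq_zero_iff, hbr]
    exact hh.abelian _ (hmem y hy) _ (hmem z hz)
  · rw [← φ.map_eq_zero_iff, hbr]
    refine hh.anisotropic _ (hpart 0 x hx) _ (hpart 0 y hy) ?_ ?_
    · rw [← hbr]
      exact hmem _ hxy
    · rw [← hbr, ← hbr, hc, map_zero]
  · obtain ⟨c, hc⟩ := hh.odd_line (fun y => a (φ.symm y)) _ (hpart 1 x hx) _ (hpart 1 z hz)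
      (by
        rintro _ ⟨y, hy, rfl⟩
        change br (φ y) (φ x) = a (φ.symm (φ y)) • φ x
        rw [← hbr, hax y hy, map_smul, φ.symm_apply_apply])
      (by
        rintro _ ⟨y, hy, rfl⟩
        change br (φ y) (φ z) = a (φ.symm (φ y)) • φ z
        rw [← hbr, haz y hy, map_smul, φ.symm_apply_apply])
      (by rwa [Ne, φ.map_eq_zero_iff])
    exact ⟨c, φ.injective (by rw [hc, map_smul])⟩

/-- Odd weight spaces are at most one-dimensional if `h` acts diagonally in coordinates `Ψ` on the
odd part, with pairwise distinct weights. -/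
theorem odd_line_of_coordinates {h : Submodule ℂ L} {K : Type*} (Ψ : L →ₗ[ℂ] (K → ℂ))
    (hΨ : ∀ x ∈ part (L := L) 1, Ψ x = 0 → x = 0) (wt : K → L → ℂ)
    (hwt : ∀ y ∈ h, ∀ x ∈ part (L := L) 1, ∀ k, Ψ (br y x) k = wt k y * Ψ x k)
    (hsep : ∀ k k', (∀ y ∈ h, wt k y = wt k' y) → k = k') (a : L → ℂ) :
    ∀ x ∈ part (L := L) 1, ∀ z ∈ part (L := L) 1,
    (∀ y ∈ h, br y x = a y • x) → (∀ y ∈ h, br y z = a y • z) → x ≠ 0 → ∃ c : ℂ, z = c • x := by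
  intro x hx z hz hax haz hx0
  have hex : ∃ k, Ψ x k ≠ 0 := by
    by_contra! hall
    exact hx0 (hΨ x hx (funext hall))
  obtain ⟨k, hk⟩ := hex
  have hw : ∀ {x : L}, x ∈ part (L := L) 1 → (∀ y ∈ h, br y x = a y • x) → ∀ {k}, Ψ x k ≠ 0 →
      ∀ y ∈ h, wt k y = a y := by
    intro x hx hax k hk y hy
    have h1 := hwt y hy x hx k
    rw [hax y hy, map_smul, Pi.smul_apply, smul_eq_mul] at h1
    exact (mul_right_cancel₀ hk h1).symm
  refine ⟨Ψ z k / Ψ x k, sub_eq_zero.1 (hΨ _ (sub_mem hz (Submodule.smul_mem _ _ hx)) ?_)⟩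
  funext k'
  rw [map_sub, map_smul, Pi.sub_apply, Pi.smul_apply, smul_eq_mul, Pi.zero_apply]
  by_cases hkk : k' = k
  · rw [hkk, div_mul_cancel₀ _ hk, sub_self]
  · have hz0 : Ψ z k' = 0 := by
      by_contra hne
      exact hkk (hsep _ _ fun y hy => by rw [hw hz haz hne y hy, hw hx hax hk y hy])
    have hx0 : Ψ x k' = 0 := by
      by_contra hne
      exact hkk (hsep _ _ fun y hy => by rw [hw hx hax hne y hy, hw hx hax hk y hy])
    rw [hz0, hx0, mul_zero, sub_zero]

/-- A diagonal commutator `x y - y x` of matrices that commutes with `x` vanishes: its trace on each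
of its eigenspaces is zero. -/
theorem commutator_eq_zero_of_isDiag {ι : Type*} [Fintype ι] {x y : Matrix ι ι ℂ}
    (hd : (x * y - y * x).IsDiag) (hc : (x * y - y * x) * x - x * (x * y - y * x) = 0) :
    x * y - y * x = 0 := by
  classical
  set t := x * y - y * x with ht
  obtain ⟨d, hd'⟩ : ∃ d : ι → ℂ, t = Matrix.diagonal d := ⟨t.diag, hd.diagonal_diag.symm⟩
  have hx : ∀ i j, d i ≠ d j → x i j = 0 := by
    intro i j hij
    have h1 : (t * x - x * t) i j = 0 := by rw [hc]; rfl
    rw [hd', Matrix.sub_apply, Matrix.diagonal_mul, Matrix.mul_diagonal] at h1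
    have h2 : (d i - d j) * x i j = 0 := by rw [← h1]; ring
    exact (mul_eq_zero.1 h2).resolve_left (sub_ne_zero.2 hij)
  have hdi : ∀ i, d i = ∑ j, (x i j * y j i - y i j * x j i) := by
    intro i
    have h1 : t i i = d i := by rw [hd', Matrix.diagonal_apply_eq]
    rw [← h1, ht, Matrix.sub_apply, Matrix.mul_apply, Matrix.mul_apply, Finset.sum_sub_distrib]
  have hzero : ∀ i, d i = 0 := by
    intro i
    let I : Finset ι := Finset.univ.filter fun j => d j = d i
    have h1 : ∑ j ∈ I, d j = 0 := by
      have h2 : ∀ j ∈ I, d j = ∑ k ∈ I, (x j k * y k j - y j k * x k j) := by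
        intro j hj
        rw [hdi j]
        refine (Finset.sum_subset (Finset.subset_univ I) fun k _ hk => ?_).symm
        have hjk : d j ≠ d k := by
          rw [(Finset.mem_filter.1 hj).2]
          exact fun h => hk (Finset.mem_filter.2 ⟨Finset.mem_univ _, h.symm⟩)
        rw [hx j k hjk, hx k j hjk.symm, zero_mul, mul_zero, sub_zero]
      rw [Finset.sum_congr rfl h2]
      simp only [Finset.sum_sub_distrib]
      rw [Finset.sum_comm (f := fun j k => y j k * x k j), sub_eq_zero]
      exact Finset.sum_congr rfl fun j _ => Finset.sum_congr rfl fun k _ => mul_comm _ _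
    rw [Finset.sum_congr rfl fun j hj => (Finset.mem_filter.1 hj).2, Finset.sum_const,
      nsmul_eq_mul] at h1
    refine (mul_eq_zero.1 h1).resolve_left (Nat.cast_ne_zero.2 ?_)
    exact Finset.card_ne_zero_of_mem (Finset.mem_filter.2 ⟨Finset.mem_univ i, rfl⟩)
  rw [hd', funext hzero]
  exact Matrix.diagonal_zero

end Cartan

/-! ### Matrix Lie superalgebras with diagonal Cartan subalgebra -/

section MatrixCartan

variable {a b : Type*} [Fintype a] [Fintype b]

theorem gl_br_apply (x y : Matrix (a ⊕ b) (a ⊕ b) ℂ) : br x y = superComm x y := rfl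

theorem isDiag_mem_part {x : Matrix (a ⊕ b) (a ⊕ b) ℂ} (hx : x.IsDiag) : x ∈ part (L :=
    Matrix (a ⊕ b) (a ⊕ b) ℂ) 0 := by
  change x ∈ matPart 0
  refine ⟨?_, ?_⟩ <;> ext i j <;> exact hx (by simp)

theorem gl_br_even {x : Matrix (a ⊕ b) (a ⊕ b) ℂ} (hx : x ∈ part (L :=
    Matrix (a ⊕ b) (a ⊕ b) ℂ) 0) (y : Matrix (a ⊕ b) (a ⊕ b) ℂ) : br x y = x * y - y * x := by
  obtain ⟨h1, h2⟩ : x.toBlocks₁₂ = 0 ∧ x.toBlocks₂₁ = 0 := hx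
  rw [gl_br_apply, superComm, h1, h2, Matrix.fromBlocks_zero, mul_zero, smul_zero, add_zero]

theorem gl_br_diag {y : Matrix (a ⊕ b) (a ⊕ b) ℂ} (hy : y.IsDiag)
    (x : Matrix (a ⊕ b) (a ⊕ b) ℂ) (p q : a ⊕ b) : br y x p q = (y p p - y q q) * x p q := by
  classical
  obtain ⟨d, rfl⟩ : ∃ d, y = Matrix.diagonal d := ⟨y.diag, hy.diagonal_diag.symm⟩
  rw [gl_br_even (isDiag_mem_part hy), Matrix.sub_apply, Matrix.diagonal_mul, Matrix.mul_diagonal,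
    Matrix.diagonal_apply_eq, Matrix.diagonal_apply_eq]
  ring

variable {L : Type*} [AddCommGroup L] [Module ℂ L] [LieSuperalgebra L]

theorem IsDiagonalCartan.of_matrix {h : Submodule ℂ L} (ι : L →ₗ[ℂ] Matrix (a ⊕ b) (a ⊕ b) ℂ)
    (hι : Function.Injective ι) (hpart : ∀ i x, ι x ∈ part i ↔ x ∈ part i)
    (hbr : ∀ x y, ι (br x y) = br (ι x) (ι y)) (hd : ∀ y ∈ h, (ι y).IsDiag)
    (hodd : ∀ a : L → ℂ, ∀ x ∈ part (L := L) 1, ∀ z ∈ part (L := L) 1,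
      (∀ y ∈ h, br y x = a y • x) → (∀ y ∈ h, br y z = a y • z) → x ≠ 0 → ∃ c : ℂ, z = c • x) :
    IsDiagonalCartan h := by
  have heven : h ≤ part (L := L) 0 := fun y hy => (hpart 0 y).1 (isDiag_mem_part (hd y hy))
  refine ⟨heven, fun y hy z hz => hι ?_, fun x hx y hy hxy hc => hι ?_, hodd⟩
  · rw [hbr, map_zero]
    ext p q
    rw [gl_br_diag (hd y hy)]
    by_cases hpq : p = q
    · rw [hpq, sub_self, zero_mul]; rfl
    · rw [hd z hz hpq, mul_zero]; rfl
  · have h1 : ι (br x y) = ι x * ι y - ι y * ι x := by rw [hbr, gl_br_even ((hpart 0 x).2 hx)]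
    have h2 := congrArg ι hc
    rw [hbr, gl_br_even ((hpart 0 _).2 (heven hxy)), map_zero, h1] at h2
    rw [h1, map_zero]
    exact commutator_eq_zero_of_isDiag (h1 ▸ hd _ hxy) h2

/-- The entries in the two off-diagonal blocks. -/
def offDiagonal : Matrix (a ⊕ b) (a ⊕ b) ℂ →ₗ[ℂ] ((a × b) ⊕ (b × a) → ℂ) where
  toFun x := Sum.elim (fun k => x (Sum.inl k.1) (Sum.inr k.2))
    (fun k => x (Sum.inr k.1) (Sum.inl k.2))
  map_add' x y := by ext (k | k) <;> rfl
  map_smul' c x := by ext (k | k) <;> rfl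

/-- The weights of the entries in the two off-diagonal blocks. -/
def offDiagonalWeight (k : (a × b) ⊕ (b × a)) (y : Matrix (a ⊕ b) (a ⊕ b) ℂ) : ℂ :=
  Sum.elim (fun k : a × b => y (Sum.inl k.1) (Sum.inl k.1) - y (Sum.inr k.2) (Sum.inr k.2))
    (fun k : b × a => y (Sum.inr k.1) (Sum.inr k.1) - y (Sum.inl k.2) (Sum.inl k.2)) k

theorem offDiagonal_br {y : Matrix (a ⊕ b) (a ⊕ b) ℂ} (hy : y.IsDiag)
    (x : Matrix (a ⊕ b) (a ⊕ b) ℂ) (k : (a × b) ⊕ (b × a)) :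
    offDiagonal (br y x) k = offDiagonalWeight k y * offDiagonal x k := by
  rcases k with k | k <;> exact gl_br_diag hy x _ _

theorem eq_zero_of_offDiagonal {x : Matrix (a ⊕ b) (a ⊕ b) ℂ}
    (hx : x ∈ part (L := Matrix (a ⊕ b) (a ⊕ b) ℂ) 1) (h0 : offDiagonal x = 0) : x = 0 := by
  obtain ⟨B, C, rfl⟩ := mem_matPart_one.1 hx
  ext (i | i) (j | j)
  · rfl
  · exact congrFun h0 (Sum.inl (i, j))
  · exact congrFun h0 (Sum.inr (i, j))
  · rfl

/-- Differences of two diagonal matrix units in the same block have supertrace zero, and already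
separate the weights within each off-diagonal block. -/
theorem offDiagonalWeight_separated {a b : Type*} [DecidableEq a] [DecidableEq b]
    {s : Set (Matrix (a ⊕ b) (a ⊕ b) ℂ)}
    (ha : ∀ i i' : a, Matrix.diagonal (Pi.single (Sum.inl i) 1 - Pi.single (Sum.inl i') 1) ∈ s)
    (hb : ∀ j j' : b, Matrix.diagonal (Pi.single (Sum.inr j) 1 - Pi.single (Sum.inr j') 1) ∈ s)
    (hab : ∃ (u w : ℂ), u ≠ w ∧ Matrix.diagonal (Sum.elim (fun _ => u) (fun _ => w)) ∈ s)
    (k k' : (a × b) ⊕ (b × a)) (hk : ∀ y ∈ s, offDiagonalWeight k y = offDiagonalWeight k' y) :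
    k = k' := by
  obtain ⟨u, w, huw, hs⟩ := hab
  rcases k with ⟨i, j⟩ | ⟨j, i⟩ <;> rcases k' with ⟨i', j'⟩ | ⟨j', i'⟩
  · have h1 := hk _ (ha i i')
    have h2 := hk _ (hb j j')
    simp only [offDiagonalWeight, Sum.elim_inl, Matrix.diagonal_apply_eq, Pi.sub_apply,
      Pi.single_apply, Sum.inl.injEq, Sum.inr.injEq, reduceCtorEq, if_true, if_false] at h1 h2
    have hi : i = i' := by
      by_contra hi
      norm_num [hi, Ne.symm hi] at h1
    have hj : j = j' := by
      by_contra hj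
      norm_num [hj, Ne.symm hj] at h2
    rw [hi, hj]
  · exfalso
    have h1 := hk _ hs
    simp only [offDiagonalWeight, Sum.elim_inl, Sum.elim_inr, Matrix.diagonal_apply_eq] at h1
    exact huw (by linear_combination h1 / 2)
  · exfalso
    have h1 := hk _ hs
    simp only [offDiagonalWeight, Sum.elim_inl, Sum.elim_inr, Matrix.diagonal_apply_eq] at h1
    exact huw (by linear_combination -h1 / 2)
  · have h1 := hk _ (ha i i')
    have h2 := hk _ (hb j j')
    simp only [offDiagonalWeight, Sum.elim_inr, Matrix.diagonal_apply_eq, Pi.sub_apply,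
      Pi.single_apply, Sum.inl.injEq, Sum.inr.injEq, reduceCtorEq, if_true, if_false] at h1 h2
    have hi : i = i' := by
      by_contra hi
      norm_num [hi, Ne.symm hi] at h1
    have hj : j = j' := by
      by_contra hj
      norm_num [hj, Ne.symm hj] at h2
    rw [hi, hj]

theorem isDiagonalCartan_gl (m n : ℕ) : IsDiagonalCartan (diagSub (Fin m ⊕ Fin n)) := by
  refine IsDiagonalCartan.of_matrix LinearMap.id Function.injective_id (fun _ _ => Iff.rfl)
    (fun _ _ => rfl) (fun _ hy => hy) (odd_line_of_coordinates offDiagonal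
      (fun _ => eq_zero_of_offDiagonal) offDiagonalWeight (fun y hy x _ => offDiagonal_br hy x) ?_)
  have hd : ∀ d, Matrix.diagonal d ∈ diagSub (Fin m ⊕ Fin n) := Matrix.isDiag_diagonal
  exact offDiagonalWeight_separated (fun _ _ => hd _) (fun _ _ => hd _) ⟨1, 0, one_ne_zero, hd _⟩

theorem diagonal_mem_slSub [DecidableEq a] [DecidableEq b] {d : a ⊕ b → ℂ}
    (hd : ∑ i, d (Sum.inl i) = ∑ j, d (Sum.inr j)) : Matrix.diagonal d ∈ slSub a b := by
  change (Matrix.diagonal d).toBlocks₁₁.trace - (Matrix.diagonal d).toBlocks₂₂.trace = 0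
  simp [Matrix.trace, Matrix.toBlocks₁₁, Matrix.toBlocks₂₂, hd]

theorem isDiagonalCartan_sl {m n : ℕ} (hmn : m ≠ n) :
    IsDiagonalCartan ((diagSub (Fin m ⊕ Fin n)).comap (slSub (Fin m) (Fin n)).subtype) := by
  refine IsDiagonalCartan.of_matrix (slSub (Fin m) (Fin n)).subtype Subtype.val_injective
    (fun _ _ => Iff.rfl) (fun _ _ => rfl) (fun _ hy => hy) (odd_line_of_coordinates
      (offDiagonal ∘ₗ (slSub (Fin m) (Fin n)).subtype)
      (fun x hx h0 => Subtype.ext (eq_zero_of_offDiagonal hx h0))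
      (fun k y => offDiagonalWeight k y) (fun y hy x _ => offDiagonal_br hy x.1) ?_)
  intro k k' hk
  refine offDiagonalWeight_separated (s := {y | y.IsDiag ∧ y ∈ slSub (Fin m) (Fin n)})
    (fun i i' => ⟨Matrix.isDiag_diagonal _, diagonal_mem_slSub ?_⟩)
    (fun j j' => ⟨Matrix.isDiag_diagonal _, diagonal_mem_slSub ?_⟩)
    ⟨n, m, by exact_mod_cast hmn.symm, Matrix.isDiag_diagonal _, diagonal_mem_slSub ?_⟩ k k'
    fun y hy => hk ⟨y, hy.2⟩ hy.1
  · simp [Pi.single_apply]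
  · simp [Pi.single_apply]
  · simp [mul_comm]

theorem isDiagonalCartan_osp (m n : ℕ) :
    IsDiagonalCartan ((diagSub (Fin m ⊕ (Fin n ⊕ Fin n))).comap (ospSub m n).subtype) := by
  -- The upper right block determines an odd element, and its weights are already distinct.
  let Ψ : ospSub m n →ₗ[ℂ] (Fin m × (Fin n ⊕ Fin n) → ℂ) :=
    { toFun := fun x k => x.1 (Sum.inl k.1) (Sum.inr k.2)
      map_add' := fun _ _ => rfl
      map_smul' := fun _ _ => rfl }
  refine IsDiagonalCartan.of_matrix (ospSub m n).subtype Subtype.val_injective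
    (fun _ _ => Iff.rfl) (fun _ _ => rfl) (fun _ hy => hy) (odd_line_of_coordinates Ψ
      ?_ (fun k y => y.1 (Sum.inl k.1) (Sum.inl k.1) - y.1 (Sum.inr k.2) (Sum.inr k.2))
      (fun y hy x _ k => gl_br_diag hy x.1 _ _) ?_)
  · rintro ⟨x, hx⟩ hx1 h0
    obtain ⟨B, C, rfl⟩ := mem_matPart_one.1 hx1
    have hB : B = 0 := by
      ext i j
      exact congrFun h0 (i, j)
    subst hB
    have hC : C = 0 := by
      have h3 := hx.2.2
      rw [Matrix.toBlocks_fromBlocks₁₂, Matrix.toBlocks_fromBlocks₂₁, Matrix.transpose_zero,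
        Matrix.zero_mul] at h3
      have h4 := congrArg (Matrix.J (Fin n) ℂ * ·) h3
      simpa [← Matrix.mul_assoc, Matrix.J_squared] using h4
    subst hC
    exact Subtype.ext Matrix.fromBlocks_zero
  · rintro ⟨i, j⟩ ⟨i', j'⟩ hk
    let d : Fin m → ℂ := fun i => (m : ℂ) - 1 - 2 * (i : ℕ)
    let c : Fin n → ℂ := fun j => (j : ℕ) + 1
    have h1 : Matrix.fromBlocks (Matrix.diagonal d) 0 0 0 ∈ ospSub m n := by
      refine ⟨?_, by simp, by simp⟩
      rw [Matrix.toBlocks_fromBlocks₁₁, Matrix.diagonal_transpose]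
      ext p q
      rw [Matrix.add_apply, Matrix.diagonal_mul, Matrix.mul_diagonal, Matrix.zero_apply]
      by_cases hpq : p = q.rev
      · have hq : ((q.rev : Fin m) : ℂ) = (m : ℂ) - 1 - q := by
          have := q.2
          rw [Fin.val_rev, Nat.cast_sub (by omega)]
          push_cast
          ring
        simp only [antiDiag, Matrix.of_apply, hpq, if_true, d, hq]
        ring
      · simp [antiDiag, hpq]
    have h2 : Matrix.fromBlocks (0 : Matrix (Fin m) (Fin m) ℂ) 0 0
        (Matrix.fromBlocks (Matrix.diagonal c) 0 0 (-Matrix.diagonal c)) ∈ ospSub m n := by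
      refine ⟨by simp, ?_, by simp⟩
      rw [Matrix.toBlocks_fromBlocks₂₂, Matrix.J, Matrix.fromBlocks_transpose,
        Matrix.fromBlocks_multiply, Matrix.fromBlocks_multiply, Matrix.fromBlocks_add]
      simp
    have e1 := hk ⟨_, h1⟩ (by
      change Matrix.IsDiag _
      exact Matrix.IsDiag.fromBlocks (Matrix.isDiag_diagonal _) (Matrix.isDiag_zero))
    have e2 := hk ⟨_, h2⟩ (by
      change Matrix.IsDiag _
      exact Matrix.IsDiag.fromBlocks Matrix.isDiag_zero
        (Matrix.IsDiag.fromBlocks (Matrix.isDiag_diagonal _) (Matrix.isDiag_diagonal _).neg))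
    have hi : i = i' := by
      simp only [Matrix.fromBlocks_apply₁₁, Matrix.fromBlocks_apply₂₂, Matrix.diagonal_apply_eq,
        Matrix.zero_apply, sub_zero, d] at e1
      have : (i : ℂ) = (i' : ℂ) := by linear_combination -e1 / 2
      exact Fin.ext (by exact_mod_cast this)
    have hpos : ∀ p q : Fin n, c p ≠ -c q := by
      intro p q hpq
      have h3 : ((p + q + 2 : ℕ) : ℂ) = 0 := by
        simp only [c] at hpq
        push_cast
        linear_combination hpq
      have h4 := Nat.cast_eq_zero.1 h3
      omega
    have hinj : ∀ p q : Fin n, c p = c q → p = q := by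
      intro p q hpq
      have : (p : ℂ) = (q : ℂ) := add_right_cancel hpq
      exact Fin.ext (by exact_mod_cast this)
    have hj : j = j' := by
      simp only [Matrix.fromBlocks_apply₁₁, Matrix.fromBlocks_apply₂₂, Matrix.zero_apply, zero_sub,
        neg_inj] at e2
      rcases j with j | j <;> rcases j' with j' | j' <;>
        simp only [Matrix.fromBlocks_apply₁₁, Matrix.fromBlocks_apply₂₂, Matrix.neg_apply,
          Matrix.diagonal_apply_eq, neg_inj] at e2
      · rw [hinj _ _ e2]
      · exact absurd e2 (hpos _ _)
      · exact absurd e2.symm (hpos _ _)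
      · rw [hinj _ _ e2]
    rw [hi, hj]

end MatrixCartan

/-! ### The exceptional Lie superalgebras -/

section Exceptional

variable {L : Type*} [AddCommGroup L] [Module ℂ L] [LieSuperalgebra L]

theorem sub_mul_eq_zero_of_isDiag {ι : Type*} [Fintype ι] {A A' : Matrix ι ι ℂ} (hA : A.IsDiag)
    (hA' : A'.IsDiag) : A * A' - A' * A = 0 := by
  classical
  rw [← hA.diagonal_diag, ← hA'.diagonal_diag, Matrix.diagonal_mul_diagonal,
    Matrix.diagonal_mul_diagonal, sub_eq_zero]
  exact congrArg _ (funext fun _ => mul_comm _ _)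

/-- It suffices that `s` contains a diagonal matrix with pairwise distinct entries. -/
theorem isDiagonalCartan_of_isExceptional {ι : Type*} [Fintype ι] [DecidableEq ι]
    {s : Set (Matrix ι ι ℂ)} {h : Submodule ℂ L} (h0 : (0 : Matrix ι ι ℂ) ∈ s) {d : ι → ℂ}
    (hinj : Function.Injective d) (hd : Matrix.diagonal d ∈ s) (hL : IsExceptional s h) :
    IsDiagonalCartan h := by
  obtain ⟨-, Φ, hΦ, hrange, hp0, hp1, hbr0, hbr1, hh⟩ := hL
  have hbr2 : ∀ x ∈ part (L := L) 0, ∀ y ∈ part (L := L) 0, (Φ (br x y)).2.2 = 0 :=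
    fun x hx y hy => (hp0 _).1 (by simpa using br_mem hx hy)
  refine ⟨fun y hy => ((hh y).1 hy).1, fun y hy z hz => hΦ ?_, fun x hx y hy hxy hc => hΦ ?_, ?_⟩
  · obtain ⟨hy0, hy1, hy2⟩ := (hh y).1 hy
    obtain ⟨hz0, hz1, hz2⟩ := (hh z).1 hz
    obtain ⟨h1, h2⟩ := hbr0 y hy0 z hz0
    rw [map_zero]
    refine Prod.ext ?_ (Prod.ext ?_ (hbr2 y hy0 z hz0))
    · rw [h1, sub_mul_eq_zero_of_isDiag hy1 hz1]; rfl
    · rw [h2, sub_mul_eq_zero_of_isDiag hy2 hz2]; rfl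
  · obtain ⟨hxy0, hxy1, hxy2⟩ := (hh _).1 hxy
    obtain ⟨h1, h2⟩ := hbr0 x hx y hy
    obtain ⟨c1, c2⟩ := hbr0 _ hxy0 x hx
    rw [hc, map_zero, h1] at c1
    rw [hc, map_zero, h2] at c2
    rw [h1] at hxy1
    rw [h2] at hxy2
    rw [map_zero]
    refine Prod.ext ?_ (Prod.ext ?_ (hbr2 x hx y hy))
    · rw [h1, commutator_eq_zero_of_isDiag hxy1 c1.symm]; rfl
    · rw [h2, commutator_eq_zero_of_isDiag hxy2 c2.symm]; rfl
  · let Ψ : L →ₗ[ℂ] (ι × Fin 2 → ℂ) :=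
      { toFun := fun x k => (Φ x).2.2 k.1 k.2
        map_add' := fun x y => by rw [map_add]; rfl
        map_smul' := fun c x => by rw [map_smul]; rfl }
    refine odd_line_of_coordinates Ψ ?_
      (fun k y => (Φ y).1 k.1 k.1 + (Φ y).2.1 k.2 k.2) ?_ ?_
    · intro x hx hx0
      obtain ⟨h1, h2⟩ := (hp1 x).1 hx
      refine hΦ ?_
      rw [map_zero]
      refine Prod.ext h1 (Prod.ext h2 ?_)
      ext i j
      exact congrFun hx0 (i, j)
    · intro y hy x hx k
      obtain ⟨hy0, hy1, hy2⟩ := (hh y).1 hy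
      change (Φ (br y x)).2.2 k.1 k.2 = _ * (Φ x).2.2 k.1 k.2
      rw [hbr1 y hy0 x hx, ← hy1.diagonal_diag, ← hy2.diagonal_diag, Matrix.diagonal_transpose,
        Matrix.add_apply, Matrix.diagonal_mul, Matrix.mul_diagonal, Matrix.diagonal_apply_eq,
        Matrix.diagonal_apply_eq]
      ring
    · rintro ⟨i, u⟩ ⟨i', u'⟩ hk
      have hex : ∀ A ∈ s, A.IsDiag → ∀ S : Matrix (Fin 2) (Fin 2) ℂ, S.trace = 0 → S.IsDiag →
          A i i + S u u = A i' i' + S u' u' := by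
        intro A hA hAd S hS hSd
        obtain ⟨y, hy⟩ : ((A, S, 0) : Matrix ι ι ℂ × Matrix (Fin 2) (Fin 2) ℂ ×
            Matrix ι (Fin 2) ℂ) ∈ Set.range Φ := by
          rw [hrange]
          exact ⟨hA, hS⟩
        have := hk y ((hh y).2 ⟨(hp0 y).2 (by rw [hy]), by rw [hy]; exact hAd,
          by rw [hy]; exact hSd⟩)
        rwa [hy] at this
      have h1 := hex _ hd (Matrix.isDiag_diagonal d) 0 (Matrix.trace_zero _ _) Matrix.isDiag_zero
      have h2 := hex 0 h0 Matrix.isDiag_zero (Matrix.diagonal ![1, -1])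
        (by simp [Matrix.trace, Fin.sum_univ_two]) (Matrix.isDiag_diagonal _)
      simp only [Matrix.diagonal_apply_eq, Matrix.zero_apply, add_zero, zero_add] at h1 h2
      have hu : u = u' := by
        fin_cases u <;> fin_cases u' <;> first | rfl | (exfalso; norm_num at h2)
      rw [hinj h1, hu]

theorem pauliZ_eq_diagonal : pauliZ = Matrix.diagonal ![1, -1] := by
  ext i j
  fin_cases i <;> fin_cases j <;> simp [pauliZ]

theorem exists_regular_sl2sl2 : ∃ d : Fin 2 × Fin 2 → ℂ, Function.Injective d ∧
    Matrix.diagonal d ∈ sl2sl2 := by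
  refine ⟨fun k => 2 * ![1, -1] k.1 + ![1, -1] k.2, ?_, (2 : ℂ) • pauliZ, pauliZ, ?_, ?_, ?_⟩
  · rintro ⟨i, j⟩ ⟨i', j'⟩ hij
    fin_cases i <;> fin_cases j <;> fin_cases i' <;> fin_cases j' <;>
      first | rfl | (exfalso; norm_num at hij)
  · simp [pauliZ, Matrix.trace, Fin.sum_univ_two]
  · simp [pauliZ, Matrix.trace, Fin.sum_univ_two]
  · rw [pauliZ_eq_diagonal, ← Matrix.diagonal_one, ← Matrix.diagonal_smul,
      Matrix.diagonal_kronecker_diagonal, Matrix.diagonal_kronecker_diagonal, Matrix.diagonal_add]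
    congr 1
    ext k
    simp

theorem exists_regular_g2 : ∃ d : Fin 3 ⊕ Fin 3 ⊕ Unit → ℂ, Function.Injective d ∧
    Matrix.diagonal d ∈ g2 := by
  refine ⟨Sum.elim ![1, 2, -3] (Sum.elim ![-1, -2, 3] fun _ => 0), ?_, fun u v w => ?_⟩
  · rintro (i | i | i) (j | j | j) hij <;> fin_cases i <;> fin_cases j <;>
      first | rfl | (exfalso; norm_num at hij)
  · simp only [threeForm, Matrix.mulVec_diagonal, crossProduct, Matrix.vec3_dotProduct]
    simp
    ring

theorem exists_regular_spin7 : ∃ d : Fin 2 × Fin 2 × Fin 2 → ℂ, Function.Injective d ∧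
    Matrix.diagonal d ∈ spin7 := by
  let N : Fin 2 × Fin 2 × Fin 2 → ℤ := fun k => 4 * ![1, -1] k.1 + 2 * ![1, -1] k.2.1 +
    ![1, -1] k.2.2
  have hN : Function.Injective N := by decide
  refine ⟨fun k => Complex.I * N k, fun k k' hk => hN (by
    exact_mod_cast mul_left_cancel₀ Complex.I_ne_zero hk), ?_⟩
  have hXY : pauliX * pauliY = Complex.I • pauliZ := by
    ext i j
    fin_cases i <;> fin_cases j <;> simp [pauliX, pauliY, pauliZ]
  have hZZ : pauliZ * pauliZ = 1 := by
    ext i j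
    fin_cases i <;> fin_cases j <;> simp [pauliZ]
  have h01 : gammaMat 0 * gammaMat 1 = (Complex.I • pauliZ) ⊗ₖ (1 ⊗ₖ 1) := by
    change (pauliX ⊗ₖ (1 ⊗ₖ 1)) * (pauliY ⊗ₖ (1 ⊗ₖ 1)) = _
    rw [← Matrix.mul_kronecker_mul, ← Matrix.mul_kronecker_mul, hXY, mul_one]
  have h23 : gammaMat 2 * gammaMat 3 = 1 ⊗ₖ ((Complex.I • pauliZ) ⊗ₖ 1) := by
    change (pauliZ ⊗ₖ (pauliX ⊗ₖ 1)) * (pauliZ ⊗ₖ (pauliY ⊗ₖ 1)) = _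
    rw [← Matrix.mul_kronecker_mul, ← Matrix.mul_kronecker_mul, hXY, hZZ, mul_one]
  have h45 : gammaMat 4 * gammaMat 5 = 1 ⊗ₖ (1 ⊗ₖ (Complex.I • pauliZ)) := by
    change (pauliZ ⊗ₖ (pauliZ ⊗ₖ pauliX)) * (pauliZ ⊗ₖ (pauliZ ⊗ₖ pauliY)) = _
    rw [← Matrix.mul_kronecker_mul, ← Matrix.mul_kronecker_mul, hXY, hZZ]
  have hmem : ∀ i j : Fin 7, i ≠ j → gammaMat i * gammaMat j ∈ Submodule.span ℂ
      {A | ∃ i j : Fin 7, i ≠ j ∧ A = gammaMat i * gammaMat j} :=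
    fun i j hij => Submodule.subset_span ⟨i, j, hij, rfl⟩
  have hsum := add_mem (add_mem (Submodule.smul_mem _ (4 : ℂ) (hmem 0 1 (by decide)))
    (Submodule.smul_mem _ (2 : ℂ) (hmem 2 3 (by decide)))) (hmem 4 5 (by decide))
  rw [h01, h23, h45, pauliZ_eq_diagonal, ← Matrix.diagonal_one, ← Matrix.diagonal_smul] at hsum
  simp only [Matrix.diagonal_kronecker_diagonal, ← Matrix.diagonal_smul,
    Matrix.diagonal_add] at hsum
  change _ ∈ Submodule.span ℂ _
  refine Eq.mpr (congrArg (fun d => Matrix.diagonal d ∈ Submodule.span ℂ _)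
    (funext fun k => ?_)) hsum
  obtain ⟨i, j, k⟩ := k
  fin_cases i <;> fin_cases j <;> fin_cases k <;> simp [N] <;> ring

theorem isDiagonalCartan_of_isBasicClassical {h : Submodule ℂ L} (hL : IsBasicClassical h) :
    IsDiagonalCartan h := by
  rcases hL with ⟨m, n, hp⟩ | ⟨m, n, hmn, hp⟩ | ⟨m, n, hp⟩ | hE | hE | hE
  · exact (isDiagonalCartan_gl m n).of_isoPair hp
  · exact (isDiagonalCartan_sl hmn).of_isoPair hp
  · exact (isDiagonalCartan_osp m n).of_isoPair hp
  · obtain ⟨d, hinj, hd⟩ := exists_regular_sl2sl2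
    exact isDiagonalCartan_of_isExceptional (show (0 : Matrix _ _ ℂ) ∈ sl2sl2 from
      ⟨0, 0, by simp, by simp, by simp⟩) hinj hd hE
  · obtain ⟨d, hinj, hd⟩ := exists_regular_g2
    refine isDiagonalCartan_of_isExceptional (fun u v w => ?_) hinj hd hE
    simp [threeForm, crossProduct, Matrix.vec3_dotProduct]
  · obtain ⟨d, hinj, hd⟩ := exists_regular_spin7
    exact isDiagonalCartan_of_isExceptional (Submodule.zero_mem _) hinj hd hE

end Exceptional

/-! ### Isotropic roots and the invariant form -/

section Form

variable {L : Type*} [AddCommGroup L] [Module ℂ L] [LieSuperalgebra L]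
variable {h : Submodule ℂ L} {B : L →ₗ[ℂ] L →ₗ[ℂ] ℂ} {H : h}

theorem IsTriangular.rootSpace_zero (hT : IsTriangular h H) (hh : IsDiagonalCartan h) :
    rootSpace h 0 = h := by
  refine le_antisymm ?_ fun x hx y => ?_
  · conv_rhs => rw [← hT.zero]
    exact le_iSup₂_of_le 0 (by simp) le_rfl
  · rw [hh.abelian y y.2 x hx, LinearMap.zero_apply, zero_smul]

theorem IsTriangular.eq_zero_of_re_eq_zero (hT : IsTriangular h H) (hh : IsDiagonalCartan h)
    {α : Module.Dual ℂ h} (hα : rootSpace h α ≠ ⊥) (hre : (α H).re = 0) : α = 0 := by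
  obtain ⟨x, hx, hx0⟩ := Submodule.exists_mem_ne_zero_of_ne_bot hα
  have hxh : x ∈ h := by
    have : rootSpace h α ≤ h := by
      conv_rhs => rw [← hT.zero]
      exact le_iSup₂_of_le α hre le_rfl
    exact this hx
  ext y
  have := hx y
  rw [hh.abelian y y.2 x hxh, eq_comm] at this
  exact (smul_eq_zero.1 this).resolve_right hx0

theorem form_eq_zero (hB : IsInvariantForm B) (hh : IsDiagonalCartan h) {α β : Module.Dual ℂ h}
    (hαβ : α + β ≠ 0) {x y : L} (hx : x ∈ rootSpace h α) (hy : y ∈ rootSpace h β) : B x y = 0 := by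
  by_contra hne
  refine hαβ (LinearMap.ext fun z => ?_)
  have h1 := hB.invariant x z y
  rw [← neg_eq_iff_eq_neg.2 (br_even_skew (hh.even z.2) x), hx z, hy z, map_neg,
    LinearMap.neg_apply, map_smul, LinearMap.smul_apply, map_smul, smul_eq_mul, smul_eq_mul] at h1
  have h2 : (α z + β z) * B x y = 0 := by linear_combination -h1
  exact (mul_eq_zero.1 h2).resolve_right hne

theorem exists_form_ne_zero (hB : IsInvariantForm B) (hT : IsTriangular h H)
    (hh : IsDiagonalCartan h) {α : Module.Dual ℂ h} {x : L} (hx : x ∈ rootSpace h α)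
    (hx0 : x ≠ 0) : ∃ y ∈ rootSpace h (-α), B x y ≠ 0 := by
  by_contra! hall
  refine hx0 (hB.nondegenerate x fun y => ?_)
  have hy : y ∈ ⨆ α : Module.Dual ℂ h, rootSpace h α := hT.span ▸ Submodule.mem_top
  refine (iSup_le fun β y hy => ?_ : (⨆ α : Module.Dual ℂ h, rootSpace h α) ≤
    LinearMap.ker (B x)) hy
  by_cases hβ : α + β = 0
  · exact hall y (neg_eq_of_add_eq_zero_right hβ ▸ hy)
  · exact form_eq_zero hB hh hβ hx hy

theorem eq_zero_of_form_cartan (hB : IsInvariantForm B) (hT : IsTriangular h H)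
    (hh : IsDiagonalCartan h) {t : L} (ht : t ∈ h) (ht0 : ∀ y ∈ h, B t y = 0) : t = 0 := by
  by_contra hne
  rw [← hT.rootSpace_zero hh] at ht
  obtain ⟨y, hy, hty⟩ := exists_form_ne_zero hB hT hh ht hne
  rw [neg_zero, hT.rootSpace_zero hh] at hy
  exact hty (ht0 y hy)

/-- `[x, y] = B(x, y) t_α` for `x` of weight `α` and `y` of weight `-α`, where `t` represents `α`. -/
theorem br_eq_form_smul (hB : IsInvariantForm B) (hT : IsTriangular h H)
    (hh : IsDiagonalCartan h) {α : Module.Dual ℂ h} {t : h} (ht : ∀ z : h, B (t : L) z = α z)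
    {x y : L} (hx : x ∈ rootSpace h α) (hy : y ∈ rootSpace h (-α)) :
    br x y = B x y • (t : L) := by
  have hmem : br x y ∈ h := by
    have := br_mem_rootSpace hh.even hx hy
    rwa [add_neg_cancel, hT.rootSpace_zero hh] at this
  refine sub_eq_zero.1 (eq_zero_of_form_cartan hB hT hh
    (sub_mem hmem (h.smul_mem _ t.2)) fun z hz => ?_)
  rw [map_sub, map_smul, LinearMap.sub_apply, LinearMap.smul_apply, hB.invariant,
    ← neg_eq_iff_eq_neg.2 (br_even_skew (hh.even hz) y), hy ⟨z, hz⟩, ht ⟨z, hz⟩]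
  simp only [LinearMap.neg_apply, neg_smul, neg_neg, map_smul, smul_eq_mul]
  ring

/-- The weight space of a nonzero isotropic weight has no even part. -/
theorem even_eq_zero_of_isotropic (hB : IsInvariantForm B) (hT : IsTriangular h H)
    (hh : IsDiagonalCartan h) {α : Module.Dual ℂ h} (hα : α ≠ 0) {t : h}
    (ht : ∀ z : h, B (t : L) z = α z) (hαt : α t = 0) {x : L} (hx : x ∈ rootSpace h α)
    (hx0 : x ∈ part (L := L) 0) : x = 0 := by
  by_contra hne
  obtain ⟨y, hy, hxy⟩ := exists_form_ne_zero hB hT hh hx hne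
  obtain ⟨y0, hy0, p0, y1, hy1, p1, rfl⟩ := rootSpace_isGraded hh.even _ y hy
  rw [map_add, (hB.even x hx0 y1 p1).1, add_zero] at hxy
  have hbr := br_eq_form_smul hB hT hh ht hx hy0
  have h0 : br x y0 = 0 := by
    refine hh.anisotropic x hx0 y0 p0 (hbr ▸ h.smul_mem _ t.2) ?_
    rw [hbr, map_smul, LinearMap.smul_apply, hx t, hαt, zero_smul, smul_zero]
  rw [hbr] at h0
  have ht0 := (smul_eq_zero.1 h0).resolve_left hxy
  refine hα (LinearMap.ext fun z => ?_)
  rw [← ht z, ht0, map_zero]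
  rfl

theorem mem_odd_of_isotropic (hB : IsInvariantForm B) (hT : IsTriangular h H)
    (hh : IsDiagonalCartan h) {α : Module.Dual ℂ h} (hα : α ≠ 0) {t : h}
    (ht : ∀ z : h, B (t : L) z = α z) (hαt : α t = 0) {x : L} (hx : x ∈ rootSpace h α) :
    x ∈ part (L := L) 1 := by
  obtain ⟨x0, h0, p0, x1, -, p1, rfl⟩ := rootSpace_isGraded hh.even _ x hx
  rwa [even_eq_zero_of_isotropic hB hT hh hα ht hαt h0 p0, zero_add]

variable {α : Module.Dual ℂ h} {f : L}

/-- The element `t_α` exists for an odd root. -/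
theorem exists_dual_element (hB : IsInvariantForm B) (hT : IsTriangular h H)
    (hh : IsDiagonalCartan h) (hodd : α ∈ oddRoots h) : ∃ t : h, ∀ z : h, B (t : L) z = α z := by
  obtain ⟨x, hx, hx0⟩ := Submodule.exists_mem_ne_zero_of_ne_bot hodd.2
  obtain ⟨y, hy, hxy⟩ := exists_form_ne_zero hB hT hh hx.1 hx0
  have hmem : br x y ∈ h := by
    have := br_mem_rootSpace hh.even hx.1 hy
    rwa [add_neg_cancel, hT.rootSpace_zero hh] at this
  refine ⟨(B x y)⁻¹ • ⟨br x y, hmem⟩, fun z => ?_⟩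
  rw [Submodule.coe_smul, map_smul, LinearMap.smul_apply, hB.invariant,
    ← neg_eq_iff_eq_neg.2 (br_even_skew (hh.even z.2) y), hy z]
  simp only [LinearMap.neg_apply, neg_smul, neg_neg, map_smul, smul_eq_mul]
  field_simp

/-- For a simple isotropic odd root `α`, the positive root spaces other than `L^α` are stable under
bracketing with a vector `f` of weight `-α`. -/
theorem br_mem_rootSum_diff (hB : IsInvariantForm B) (hT : IsTriangular h H)
    (hh : IsDiagonalCartan h) (hα : α ∈ simpleRoots (posRoots h H)) {t : h}
    (ht : ∀ z : h, B (t : L) z = α z) (hαt : α t = 0) (hf : f ∈ rootSpace h (-α))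
    (hfo : f ∈ part (L := L) 1) {x : L} (hx : x ∈ rootSum h (posRoots h H \ {α})) :
    br x f ∈ rootSum h (posRoots h H \ {α}) := by
  have hα0 : α ≠ 0 := hα.1.1.1
  suffices hle : rootSum h (posRoots h H \ {α}) ≤
      (rootSum h (posRoots h H \ {α})).comap ((br (L := L)).flip f) from hle hx
  refine iSup₂_le fun β hβ x hx => ?_
  change br x f ∈ rootSum h (posRoots h H \ {α})
  have hmem := br_mem_rootSpace hh.even hx hf
  by_cases hzero : br x f = 0
  · rw [hzero]
    exact zero_mem _
  have hne : rootSpace h (β + -α) ≠ ⊥ := (Submodule.ne_bot_iff _).2 ⟨_, hmem, hzero⟩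
  have hβα : β + -α ≠ 0 := fun h0 => hβ.2 (by
    rw [← sub_eq_add_neg] at h0
    exact sub_eq_zero.1 h0)
  rcases lt_trichotomy ((β + -α) H).re 0 with hre | hre | hre
  · -- Otherwise `α = β + (α - β)` is a sum of positive roots.
    exfalso
    obtain ⟨y, hy, hxy⟩ := exists_form_ne_zero hB hT hh hmem hzero
    refine hα.2 β hβ.1 (-(β + -α)) ⟨⟨neg_ne_zero.2 hβα, (Submodule.ne_bot_iff _).2 ⟨y, hy, ?_⟩⟩,
      ?_⟩ (by abel)
    · rintro rfl
      exact hxy (map_zero _)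
    · rw [LinearMap.neg_apply, Complex.neg_re]
      linarith
  · exact absurd (hT.eq_zero_of_re_eq_zero hh hne hre) hβα
  · by_cases hβ2 : β + -α = α
    · -- The weight space of `2 α` is odd, so it brackets with `f` into the even part of `L^α`.
      exfalso
      have hβ' : β = α + α := eq_add_of_add_neg_eq hβ2
      have hxo : x ∈ part (L := L) 1 := by
        refine mem_odd_of_isotropic hB hT hh hβ.1.1.1 (t := t + t) (fun z => ?_) ?_ hx
        · rw [hβ', Submodule.coe_add, map_add, LinearMap.add_apply, ht, LinearMap.add_apply]
        · rw [hβ', map_add, LinearMap.add_apply, hαt, add_zero, add_zero]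
      refine hzero (even_eq_zero_of_isotropic hB hT hh hα0 ht hαt (hβ2 ▸ hmem) ?_)
      simpa [show (1 : ZMod 2) + 1 = 0 by decide] using br_mem hxo hfo
    · exact rootSpace_le_rootSum (P := posRoots h H \ {α}) ⟨⟨⟨hβα, hne⟩, hre⟩, hβ2⟩ hmem

theorem isReflection_of_isotropic (hB : IsInvariantForm B) (hT : IsTriangular h H)
    (hh : IsDiagonalCartan h) (hα : α ∈ simpleRoots (posRoots h H)) {t : h}
    (ht : ∀ z : h, B (t : L) z = α z) (hαt : α t = 0) (hf : f ∈ rootSpace h (-α)) :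
    IsReflection h (rootSum h (posRoots h H \ {α})) H (-α) f t := by
  have hα0 : α ≠ 0 := hα.1.1.1
  have ht' : ∀ z : h, B ((-t : h) : L) z = (-α) z := fun z => by
    rw [Submodule.coe_neg, map_neg, LinearMap.neg_apply, ht, LinearMap.neg_apply]
  have hfo := mem_odd_of_isotropic hB hT hh (neg_ne_zero.2 hα0) ht' (by simpa using hαt) hf
  refine ⟨hh.even, hT.span, fun δ hδ => ?_, ?_, rootSum_isGraded hh.even _,
    fun x hx => br_mem_rootSum_diff hB hT hh hα ht hαt hf hfo hx, hf, hfo, ?_,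
    by simpa using hαt, fun e he => ?_⟩
  · rw [neg_neg]
    by_cases hδα : δ = α
    · exact hδα ▸ le_sup_right
    by_cases hbot : rootSpace h δ = ⊥
    · rw [hbot]
      exact bot_le
    refine le_sup_of_le_left (rootSpace_le_rootSum ⟨⟨⟨?_, hbot⟩, hδ⟩, hδα⟩)
    rintro rfl
    simp at hδ
  · have := hα.1.2
    rw [LinearMap.neg_apply, Complex.neg_re]
    linarith
  · refine even_eq_zero_of_isotropic hB hT hh (α := -α + -α) (t := -t + -t) ?_ (fun z => ?_) ?_
      (br_mem_rootSpace hh.even hf hf) ?_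
    · rw [← two_smul ℂ]
      exact smul_ne_zero two_ne_zero (neg_ne_zero.2 hα0)
    · rw [Submodule.coe_add, map_add, LinearMap.add_apply, ht', LinearMap.add_apply]
    · simp [hαt]
    · simpa [show (1 : ZMod 2) + 1 = 0 by decide] using br_mem hfo hfo
  · rw [neg_neg] at he
    exact ⟨mem_odd_of_isotropic hB hT hh hα0 ht hαt he, _, br_eq_form_smul hB hT hh ht he hf⟩

theorem exists_opposite (hB : IsInvariantForm B) (hT : IsTriangular h H)
    (hh : IsDiagonalCartan h) {t : h} (ht : ∀ z : h, B (t : L) z = α z)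
    (hf : f ∈ rootSpace h (-α)) (hfo : f ∈ part (L := L) 1) (hf0 : f ≠ 0) :
    ∃ e ∈ rootSpace h α, br e f = t := by
  obtain ⟨y, hy, hfy⟩ := exists_form_ne_zero hB hT hh hf hf0
  rw [neg_neg] at hy
  obtain ⟨y0, hy0, p0, y1, hy1, p1, rfl⟩ := rootSpace_isGraded hh.even _ y hy
  rw [map_add, (hB.even y0 p0 f hfo).2, zero_add, hB.symm hfo p1] at hfy
  have hne : B y1 f ≠ 0 := right_ne_zero_of_mul hfy
  refine ⟨(B y1 f)⁻¹ • y1, Submodule.smul_mem _ _ hy1, ?_⟩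
  rw [map_smul, LinearMap.smul_apply, br_eq_form_smul hB hT hh ht hy1 hf, smul_smul,
    inv_mul_cancel₀ hne, one_smul]

end Form

/-! ### Isotropic odd reflections in the basic classical case -/

section BasicClassicalReflection

variable {L : Type*} [AddCommGroup L] [Module ℂ L] [LieSuperalgebra L] {ℓ : ℕ}
variable {M : Type*} [AddCommGroup M] [Module ℂ M] [LieSuperModule (Takiff L ℓ) M]

theorem highestWeight_oddReflection {h : Submodule ℂ L} (hL : IsBasicClassical h)
    {B : L →ₗ[ℂ] L →ₗ[ℂ] ℂ} (hB : IsInvariantForm B) {H : h} (hT : IsTriangular h H)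
    (hM : IsSimpleMod (Takiff L ℓ) M) {lam : Module.Dual ℂ (takiffSub h ℓ)} {v : M}
    (hv : IsHighestWeightVector h (rootSum h (posRoots h H)) ℓ lam v)
    {α : Module.Dual ℂ h} (hα : α ∈ simpleRoots (posRoots h H)) (hodd : α ∈ oddRoots h)
    (hiso : dualForm h B α α = 0) {f : L} (hf : f ∈ rootSpace h (-α)) (hf0 : f ≠ 0) :
    (∀ k ≤ ℓ, dualForm h B (weightComp lam k) α ≠ 0 →
      (∀ j, k < j → j ≤ ℓ → dualForm h B (weightComp lam j) α = 0) →
      ∃ mu, IsHighestWeightVector h (rootSum h (oddReflection (posRoots h H) α)) ℓ mu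
        (jetProd ℓ f k v)) ∧
    ((∀ k ≤ ℓ, dualForm h B (weightComp lam k) α = 0) →
      ∃ mu, IsHighestWeightVector h (rootSum h (oddReflection (posRoots h H) α)) ℓ mu v) := by
  have hh := isDiagonalCartan_of_isBasicClassical hL
  obtain ⟨t, ht⟩ := exists_dual_element hB hT hh hodd
  have hform : ∀ ν : Module.Dual ℂ h, dualForm h B ν α = ν t := fun ν =>
    dualForm_eq h B (fun x hx => Subtype.ext
      (eq_zero_of_form_cartan hB hT hh x.2 fun y hy => hx ⟨y, hy⟩)) ν α t ht
  simp only [hform] at hiso ⊢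
  have hR := isReflection_of_isotropic hB hT hh hα ht hiso hf
  obtain ⟨e, he, hef⟩ := exists_opposite hB hT hh ht hf hR.f_odd hf0
  have hn : rootSum h (posRoots h H \ {α}) ⊔ rootSpace h (-(-α)) ≤ rootSum h (posRoots h H) := by
    rw [neg_neg]
    exact sup_le (biSup_mono fun β hβ => hβ.1) (rootSpace_le_rootSum hα.1)
  have hline : rootSpace h (-α) ≤ Submodule.span ℂ {f} := by
    intro x hx
    have hxo : x ∈ part (L := L) 1 :=
      (isReflection_of_isotropic hB hT hh hα ht hiso hx).f_odd
    classical
    obtain ⟨c, rfl⟩ := hh.odd_line (fun y => if hy : y ∈ h then (-α) ⟨y, hy⟩ else 0) f hR.f_odd x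
      hxo (fun y hy => by rw [dif_pos hy]; exact hf ⟨y, hy⟩)
      (fun y hy => by rw [dif_pos hy]; exact hx ⟨y, hy⟩) hf0
    exact Submodule.smul_mem _ _ (Submodule.mem_span_singleton_self f)
  have hn'' : rootSum h (oddReflection (posRoots h H) α) ≤
      rootSum h (posRoots h H \ {α}) ⊔ Submodule.span ℂ {f} := by
    refine iSup₂_le fun β hβ => ?_
    rcases hβ with hβ | rfl
    · exact le_sup_of_le_left (rootSpace_le_rootSum hβ)
    · exact le_sup_of_le_right hline
  exact ⟨fun k _ hk hlam => hR.highestWeight_jetProd hM (by rwa [neg_neg]) hef hn hn'' hv hk hlam,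
    fun hlam => hR.highestWeight_self hM hn hn'' hv hlam⟩

end BasicClassicalReflection

/-! ### Root spaces of the periplectic Lie superalgebra -/

section PeriplecticRoots

variable {n : ℕ}

/-- The weight of the `p`-th basis vector of the natural representation. -/
def peEntry : Fin n ⊕ Fin n → Module.Dual ℂ (peCartan n) := Sum.elim eps fun i => -eps i

theorem peEntry_apply (p : Fin n ⊕ Fin n) (y : peCartan n) : peEntry p y = y.1.1 p p := by
  rcases p with i | i
  · rfl
  · exact (congrFun (congrFun y.1.2.1 i) i).symm

theorem pe_br_apply (y : peCartan n) (x : peSub n) (p q : Fin n ⊕ Fin n) :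
    (br (y : peSub n) x).1 p q = (peEntry p - peEntry q) y * x.1 p q := by
  rw [LinearMap.sub_apply, peEntry_apply, peEntry_apply]
  exact gl_br_diag y.2 x.1 p q

theorem mem_pe_rootSpace_iff {δ : Module.Dual ℂ (peCartan n)} {x : peSub n} :
    x ∈ rootSpace (peCartan n) δ ↔ ∀ p q, x.1 p q ≠ 0 → δ = peEntry p - peEntry q := by
  constructor
  · intro hx p q hpq
    ext y
    have h1 := pe_br_apply y x p q
    rw [hx y] at h1
    exact mul_right_cancel₀ hpq h1
  · intro hx y
    ext p q
    rw [pe_br_apply]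
    change _ = δ y * x.1 p q
    by_cases hpq : x.1 p q = 0
    · rw [hpq, mul_zero, mul_zero]
    · rw [hx p q hpq]

theorem peCartan_even : peCartan n ≤ part (L := peSub n) 0 := fun _ hy => isDiag_mem_part hy

open Classical in
/-- The component of weight `δ`: the entries of weight `δ` are kept. -/
def peProj (δ : Module.Dual ℂ (peCartan n)) (x : peSub n) : peSub n :=
  ⟨Matrix.of fun p q => if peEntry p - peEntry q = δ then x.1 p q else 0, by
    obtain ⟨x, h1, h2, h3⟩ := x
    refine ⟨?_, ?_, ?_⟩ <;> ext i j
    · have hx : x (Sum.inr i) (Sum.inr j) = -x (Sum.inl j) (Sum.inl i) := congrFun (congrFun h1 i) j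
      have hw : (peEntry (Sum.inr i) - peEntry (Sum.inr j) : Module.Dual ℂ (peCartan n)) =
          peEntry (Sum.inl j) - peEntry (Sum.inl i) := by
        change -eps i - -eps j = eps j - eps i
        abel
      change (if _ then x (Sum.inr i) (Sum.inr j) else 0) =
        -(if _ then x (Sum.inl j) (Sum.inl i) else 0)
      rw [hw, hx]
      split_ifs <;> simp
    · have hx : x (Sum.inl j) (Sum.inr i) = x (Sum.inl i) (Sum.inr j) := congrFun (congrFun h2 i) j
      have hw : (peEntry (Sum.inl j) - peEntry (Sum.inr i) : Module.Dual ℂ (peCartan n)) =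
          peEntry (Sum.inl i) - peEntry (Sum.inr j) := by
        change eps j - -eps i = eps i - -eps j
        abel
      change (if _ then x (Sum.inl j) (Sum.inr i) else 0) =
        (if _ then x (Sum.inl i) (Sum.inr j) else 0)
      rw [hw, hx]
    · have hx : x (Sum.inr j) (Sum.inl i) = -x (Sum.inr i) (Sum.inl j) :=
        congrFun (congrFun h3 i) j
      have hw : (peEntry (Sum.inr j) - peEntry (Sum.inl i) : Module.Dual ℂ (peCartan n)) =
          peEntry (Sum.inr i) - peEntry (Sum.inl j) := by
        change -eps j - eps i = -eps i - eps j
        abel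
      change (if _ then x (Sum.inr j) (Sum.inl i) else 0) =
        -(if _ then x (Sum.inr i) (Sum.inl j) else 0)
      rw [hw, hx]
      split_ifs <;> simp⟩

theorem peProj_apply_ne_zero {δ : Module.Dual ℂ (peCartan n)} {x : peSub n} {p q : Fin n ⊕ Fin n}
    (h : (peProj δ x).1 p q ≠ 0) : peEntry p - peEntry q = δ := by
  by_contra hne
  exact h (if_neg hne)

theorem pe_span : ⨆ δ : Module.Dual ℂ (peCartan n), rootSpace (peCartan n) δ = ⊤ := by
  classical
  rw [eq_top_iff]
  intro x _
  let D : Finset (Module.Dual ℂ (peCartan n)) :=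
    Finset.univ.image fun k : (Fin n ⊕ Fin n) × (Fin n ⊕ Fin n) => peEntry k.1 - peEntry k.2
  have hx : x = ∑ δ ∈ D, peProj δ x := by
    ext p q
    rw [Submodule.coe_sum, Matrix.sum_apply]
    change x.1 p q = ∑ δ ∈ D, if peEntry p - peEntry q = δ then x.1 p q else 0
    rw [Finset.sum_ite_eq, if_pos]
    exact Finset.mem_image.2 ⟨(p, q), Finset.mem_univ _, rfl⟩
  rw [hx]
  exact Submodule.sum_mem _ fun δ _ => Submodule.mem_iSup_of_mem δ
    (mem_pe_rootSpace_iff.2 fun p q hpq => (peProj_apply_ne_zero hpq).symm)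

theorem eps_cartanBasis (i j : Fin n) : eps i (cartanBasis j) = if i = j then 1 else 0 := by
  change Matrix.diagonal (Pi.single j 1) i i = _
  rw [Matrix.diagonal_apply_eq, Pi.single_apply]

theorem eps_sub (i : Fin n) (y z : peCartan n) : eps i (y - z) = eps i y - eps i z := rfl

theorem eps_add_eps_injective {i k s j : Fin n} (h : eps i + eps k = eps s + eps j) :
    (i = s ∧ k = j) ∨ (i = j ∧ k = s) := by
  have h1 : ∀ r, eps i (cartanBasis r) + eps k (cartanBasis r) =
      eps s (cartanBasis r) + eps j (cartanBasis r) := fun r => LinearMap.congr_fun h (cartanBasis r)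
  simp only [eps_cartanBasis] at h1
  have hi := h1 i
  have hk := h1 k
  have hs := h1 s
  have hj := h1 j
  by_cases e1 : i = s
  · subst e1
    by_cases e2 : k = j
    · exact Or.inl ⟨rfl, e2⟩
    · have e2' := Ne.symm e2
      simp [e2'] at hk hj
  · have e1' := Ne.symm e1
    by_cases e2 : i = j
    · subst e2
      by_cases e3 : k = s
      · exact Or.inr ⟨rfl, e3⟩
      · simp [e3, e1] at hs
    · exfalso
      have e2' := Ne.symm e2
      simp only [if_true, e1', e2', if_false, add_zero] at hi
      split_ifs at hi <;> norm_num at hi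

/-- The element of the Cartan subalgebra with `ε_i`-coordinates `a i`. -/
def peElement (a : Fin n → ℝ) : peCartan n := ∑ i, (a i : ℂ) • cartanBasis i

theorem eps_peElement (a : Fin n → ℝ) (i : Fin n) : eps i (peElement a) = a i := by
  rw [peElement, map_sum]
  simp [eps_cartanBasis]

/-- The sum of the `e_ii` has the weights `2`, `0`, `-2` on the blocks `B`, `A`, `C`, so its value at
a weight tells in which block the root vectors lie. -/
theorem pe_block {δ : Module.Dual ℂ (peCartan n)} {x : peSub n}
    (hx : x ∈ rootSpace (peCartan n) δ) :
    (δ (peElement fun _ => 1) = 2 → ∃ B, x.1 = Matrix.fromBlocks 0 B 0 0) ∧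
    (δ (peElement fun _ => 1) = -2 → ∃ C, x.1 = Matrix.fromBlocks 0 0 C 0) := by
  rw [mem_pe_rootSpace_iff] at hx
  have hl : ∀ i : Fin n, peEntry (Sum.inl i) (peElement fun _ => 1) = 1 := fun i =>
    (eps_peElement _ i).trans Complex.ofReal_one
  have hr : ∀ i : Fin n, peEntry (Sum.inr i) (peElement fun _ => 1) = -1 := fun i =>
    congrArg Neg.neg (hl i)
  constructor <;> intro hδ
  · refine ⟨x.1.toBlocks₁₂, ?_⟩
    ext (i | i) (j | j)
    · by_contra hne
      norm_num [hx _ _ hne, hl] at hδ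
    · rfl
    · by_contra hne
      norm_num [hx _ _ hne, hl, hr] at hδ
    · by_contra hne
      norm_num [hx _ _ hne, hr] at hδ
  · refine ⟨x.1.toBlocks₂₁, ?_⟩
    ext (i | i) (j | j)
    · by_contra hne
      norm_num [hx _ _ hne, hl] at hδ
    · by_contra hne
      norm_num [hx _ _ hne, hl, hr] at hδ
    · rfl
    · by_contra hne
      norm_num [hx _ _ hne, hr] at hδ

/-- The root vector of weight `ε_i + ε_j`. -/
def peB (i j : Fin n) : peSub n :=
  ⟨Matrix.fromBlocks 0 (Matrix.single i j 1 + Matrix.single j i 1) 0 0, by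
    refine ⟨by simp, ?_, by simp⟩
    rw [Matrix.toBlocks_fromBlocks₁₂, Matrix.transpose_add, Matrix.transpose_single,
      Matrix.transpose_single, add_comm]⟩

/-- The root vector of weight `-ε_i - ε_j`, which is zero for `i = j`. -/
def peC (i j : Fin n) : peSub n :=
  ⟨Matrix.fromBlocks 0 0 (Matrix.single i j 1 - Matrix.single j i 1) 0, by
    refine ⟨by simp, by simp, ?_⟩
    rw [Matrix.toBlocks_fromBlocks₂₁, Matrix.transpose_sub, Matrix.transpose_single,
      Matrix.transpose_single, neg_sub]⟩

theorem peB_odd (i j : Fin n) : peB i j ∈ part (L := peSub n) 1 :=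
  mem_matPart_one.2 ⟨_, _, rfl⟩

theorem peC_odd (i j : Fin n) : peC i j ∈ part (L := peSub n) 1 :=
  mem_matPart_one.2 ⟨_, _, rfl⟩

theorem peB_mem (s j : Fin n) : peB s j ∈ rootSpace (peCartan n) (eps s + eps j) := by
  rw [mem_pe_rootSpace_iff]
  rintro (p | p) (q | q) hpq
  · exact absurd rfl hpq
  · have h1 : Matrix.single s j (1 : ℂ) p q + Matrix.single j s (1 : ℂ) p q ≠ 0 := hpq
    change _ = eps p - -eps q
    by_cases h2 : s = p ∧ j = q
    · rw [h2.1, h2.2]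
      abel
    · by_cases h3 : j = p ∧ s = q
      · rw [h3.1, h3.2]
        abel
      · rw [Matrix.single_apply, Matrix.single_apply, if_neg h2, if_neg h3, add_zero] at h1
        exact absurd rfl h1
  · exact absurd rfl hpq
  · exact absurd rfl hpq

theorem peB_ne_zero (s j : Fin n) : peB s j ≠ 0 := by
  intro h
  have h1 : Matrix.single s j (1 : ℂ) s j + Matrix.single j s (1 : ℂ) s j = 0 :=
    congrFun (congrFun (congrArg Subtype.val h) (Sum.inl s)) (Sum.inr j)
  rw [Matrix.single_apply, Matrix.single_apply] at h1
  by_cases hsj : s = j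
  · subst hsj
    norm_num at h1
  · simp [Ne.symm hsj] at h1

theorem peC_self (s : Fin n) : peC s s = 0 :=
  Subtype.ext (by simp [peC])

theorem peC_mem (s j : Fin n) : peC s j ∈ rootSpace (peCartan n) (-(eps s + eps j)) := by
  rw [mem_pe_rootSpace_iff]
  rintro (p | p) (q | q) hpq
  · exact absurd rfl hpq
  · exact absurd rfl hpq
  · have h1 : Matrix.single s j (1 : ℂ) p q - Matrix.single j s (1 : ℂ) p q ≠ 0 := hpq
    change _ = -eps p - eps q
    by_cases h2 : s = p ∧ j = q
    · rw [h2.1, h2.2]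
      abel
    · by_cases h3 : j = p ∧ s = q
      · rw [h3.1, h3.2]
        abel
      · rw [Matrix.single_apply, Matrix.single_apply, if_neg h2, if_neg h3, sub_zero] at h1
        exact absurd rfl h1
  · exact absurd rfl hpq

theorem eq_smul_peB {s j : Fin n} {x : peSub n} (hx : x ∈ rootSpace (peCartan n) (eps s + eps j)) :
    ∃ b : ℂ, x = b • peB s j := by
  obtain ⟨B, hB⟩ := (pe_block hx).1 (by
    rw [LinearMap.add_apply, eps_peElement, eps_peElement]; norm_num)
  rw [mem_pe_rootSpace_iff] at hx
  have hsymm : ∀ p q, B q p = B p q := by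
    have h2 := x.2.2.1
    rw [hB, Matrix.toBlocks_fromBlocks₁₂] at h2
    exact fun p q => congrFun (congrFun h2 p) q
  have hsupp : ∀ p q, B p q ≠ 0 → (p = s ∧ q = j) ∨ (p = j ∧ q = s) := by
    intro p q hpq
    have h2 := hx (Sum.inl p) (Sum.inr q) (by rw [hB]; exact hpq)
    refine eps_add_eps_injective ?_
    rw [h2]
    change _ = eps p - -eps q
    abel
  refine ⟨if s = j then B s j / 2 else B s j, Subtype.ext ?_⟩
  rw [Submodule.coe_smul, peB, hB, Matrix.fromBlocks_smul]
  simp only [smul_zero]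
  congr 1
  ext p q
  rw [Matrix.smul_apply, Matrix.add_apply, Matrix.single_apply, Matrix.single_apply, smul_eq_mul]
  by_cases h0 : B p q = 0
  · rw [h0]
    by_cases h2 : s = p ∧ j = q
    · rw [h2.1, h2.2, h0]
      simp
    · by_cases h3 : j = p ∧ s = q
      · rw [h3.1, h3.2, hsymm, h0]
        simp
      · simp [h2, h3]
  · rcases hsupp p q h0 with ⟨rfl, rfl⟩ | ⟨rfl, rfl⟩
    · by_cases hpq : p = q
      · subst hpq
        simp
        ring
      · simp [hpq, Ne.symm hpq]
    · by_cases hpq : p = q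
      · subst hpq
        simp
        ring
      · simp [hpq, Ne.symm hpq, hsymm]

theorem eq_smul_peC {s j : Fin n} {x : peSub n}
    (hx : x ∈ rootSpace (peCartan n) (-(eps s + eps j))) : ∃ c : ℂ, x = c • peC s j := by
  obtain ⟨C, hC⟩ := (pe_block hx).2 (by
    rw [LinearMap.neg_apply, LinearMap.add_apply, eps_peElement, eps_peElement]; norm_num)
  rw [mem_pe_rootSpace_iff] at hx
  have hskew : ∀ p q, C q p = -C p q := by
    have h2 := x.2.2.2
    rw [hC, Matrix.toBlocks_fromBlocks₂₁] at h2
    exact fun p q => congrFun (congrFun h2 p) q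
  have hsupp : ∀ p q, C p q ≠ 0 → (p = s ∧ q = j) ∨ (p = j ∧ q = s) := by
    intro p q hpq
    have h2 := hx (Sum.inr p) (Sum.inl q) (by rw [hC]; exact hpq)
    refine eps_add_eps_injective (neg_injective ?_)
    rw [h2]
    change _ = -eps p - eps q
    abel
  have hdiag : ∀ p, C p p = 0 := fun p => self_eq_neg.1 (hskew p p)
  refine ⟨C s j, Subtype.ext ?_⟩
  rw [Submodule.coe_smul, peC, hC, Matrix.fromBlocks_smul]
  simp only [smul_zero]
  congr 1
  ext p q
  rw [Matrix.smul_apply, Matrix.sub_apply, Matrix.single_apply, Matrix.single_apply, smul_eq_mul]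
  by_cases h0 : C p q = 0
  · rw [h0]
    by_cases h2 : s = p ∧ j = q
    · rw [h2.1, h2.2, h0]
      simp
    · by_cases h3 : j = p ∧ s = q
      · rw [h3.1, h3.2, hskew, h0]
        simp
      · simp [h2, h3]
  · have hpq : p ≠ q := by
      rintro rfl
      exact h0 (hdiag p)
    rcases hsupp p q h0 with ⟨rfl, rfl⟩ | ⟨rfl, rfl⟩
    · simp [hpq, hpq.symm]
    · simp [hpq, hpq.symm, hskew p q]

theorem br_peB_peB (s j : Fin n) : br (peB s j) (peB s j) = 0 := by
  refine Subtype.ext ((gl_br_fromBlocks _ _ _ _ _ _ _ _).trans ?_)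
  simp

theorem br_peC_peB (s j : Fin n) :
    br (peC s j) (peB s j) = -((cartanBasis s - cartanBasis j : peCartan n) : peSub n) := by
  refine Subtype.ext ((gl_br_fromBlocks _ _ _ _ _ _ _ _).trans ?_)
  change _ = -(Matrix.fromBlocks (Matrix.diagonal (Pi.single s 1)) 0 0
    (-Matrix.diagonal (Pi.single s 1)) - Matrix.fromBlocks (Matrix.diagonal (Pi.single j 1)) 0 0
    (-Matrix.diagonal (Pi.single j 1)))
  rw [sub_eq_add_neg (Matrix.fromBlocks _ _ _ _), Matrix.fromBlocks_neg, Matrix.fromBlocks_add,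
    Matrix.fromBlocks_neg]
  by_cases hsj : s = j
  · subst hsj
    simp
  · have h1 : Matrix.single s j (1 : ℂ) * Matrix.single s j (1 : ℂ) = 0 :=
      Matrix.single_mul_single_of_ne (c := 1) s j s (Ne.symm hsj) 1
    have h2 : Matrix.single j s (1 : ℂ) * Matrix.single j s (1 : ℂ) = 0 :=
      Matrix.single_mul_single_of_ne (c := 1) j s j hsj 1
    simp only [Matrix.diagonal_single, Matrix.add_mul, Matrix.mul_sub, Matrix.mul_add,
      Matrix.sub_mul, Matrix.single_mul_single_same, Matrix.mul_zero, Matrix.zero_mul,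
      h1, h2, mul_one, sub_zero, zero_sub, zero_add, add_zero, neg_zero]
    congr 1 <;> abel

end PeriplecticRoots

/-! ### The chain of Borel subalgebras of the periplectic Lie superalgebra -/

section PeriplecticChain

variable {n : ℕ}

theorem mem_peSeq {i j : Fin n} : (i, j) ∈ peSeq n ↔ i ≤ j := by
  simp [peSeq]

theorem peSeq_get_le (p : Fin (peSeq n).length) : ((peSeq n).get p).1 ≤ ((peSeq n).get p).2 :=
  mem_peSeq.1 (List.get_mem (peSeq n) p)

/-- The sequence of pairs is increasing for the colexicographic order. -/
theorem peSeq_get_lt {r p : Fin (peSeq n).length} (hrp : r < p) :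
    ((peSeq n).get r).2 < ((peSeq n).get p).2 ∨
      ((peSeq n).get r).2 = ((peSeq n).get p).2 ∧ ((peSeq n).get r).1 < ((peSeq n).get p).1 := by
  have hpair : (peSeq n).Pairwise fun k k' => k.2 < k'.2 ∨ k.2 = k'.2 ∧ k.1 < k'.1 := by
    rw [peSeq, List.pairwise_flatMap]
    refine ⟨fun j _ => ?_, (List.pairwise_lt_finRange n).imp fun {j j'} hjj k hk k' hk' => ?_⟩
    · rw [List.pairwise_map]
      exact ((List.pairwise_lt_finRange n).filter _).imp fun hii => Or.inr ⟨rfl, hii⟩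
    · obtain ⟨i, -, rfl⟩ := List.mem_map.1 hk
      obtain ⟨i', -, rfl⟩ := List.mem_map.1 hk'
      exact Or.inl hjj
  exact List.pairwise_iff_get.1 hpair r p hrp

/-- The positive system `{ε_i - ε_j : i < j}` together with the `ε_i + ε_j` for the pairs in `T` and
the `-ε_i - ε_j`, `i < j`, for the other pairs. -/
def peSystem (T : Fin n → Fin n → Prop) : Set (Module.Dual ℂ (peCartan n)) :=
  {α | ∃ i j : Fin n, i < j ∧ α = eps i - eps j} ∪
  {α | ∃ i j : Fin n, i ≤ j ∧ T i j ∧ α = eps i + eps j} ∪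
  {α | ∃ i j : Fin n, i < j ∧ ¬T i j ∧ α = -(eps i + eps j)}

theorem peRoots_eq_peSystem {q : ℕ} {T : Fin n → Fin n → Prop}
    (hT : ∀ r : Fin (peSeq n).length, T ((peSeq n).get r).1 ((peSeq n).get r).2 ↔ (r : ℕ) < q) :
    peRoots n q = peSystem T := by
  have hget : ∀ {i j : Fin n}, i ≤ j → ∃ r : Fin (peSeq n).length, (peSeq n).get r = (i, j) :=
    fun hij => List.get_of_mem (mem_peSeq.2 hij)
  refine congrArg₂ _ (congrArg₂ _ rfl ?_) ?_ <;> ext α <;> constructor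
  · rintro ⟨r, hr, rfl⟩
    exact ⟨_, _, peSeq_get_le r, (hT r).2 hr, rfl⟩
  · rintro ⟨i, j, hij, hTij, rfl⟩
    obtain ⟨r, hr⟩ := hget hij
    have := hT r
    rw [hr] at this
    exact ⟨r, this.1 hTij, by rw [peGamma, hr]⟩
  · rintro ⟨r, hr, hlt, rfl⟩
    exact ⟨_, _, hlt, fun h => absurd ((hT r).1 h) (not_lt.2 hr), rfl⟩
  · rintro ⟨i, j, hij, hTij, rfl⟩
    obtain ⟨r, hr⟩ := hget hij.le
    have := hT r
    rw [hr] at this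
    exact ⟨r, not_lt.1 fun h => hTij (this.2 h), by rw [hr]; exact hij, by rw [peGamma, hr]⟩

/-- The positive system of the pairs in `T` is cut out by `a`. -/
structure Realizes (a : Fin n → ℝ) (T : Fin n → Fin n → Prop) : Prop where
  anti : ∀ i j, i < j → a j < a i
  pos : ∀ i j, i ≤ j → T i j → 0 < a i + a j
  neg : ∀ i j, i ≤ j → ¬T i j → a i + a j < 0

theorem Realizes.re_pos {a : Fin n → ℝ} {T : Fin n → Fin n → Prop} (ha : Realizes a T)
    {δ : Module.Dual ℂ (peCartan n)} (hδ : δ ∈ peSystem T) : 0 < (δ (peElement a)).re := by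
  rcases hδ with (⟨i, j, hij, rfl⟩ | ⟨i, j, hij, hT, rfl⟩) | ⟨i, j, hij, hT, rfl⟩ <;>
    simp only [LinearMap.sub_apply, LinearMap.add_apply, LinearMap.neg_apply, eps_peElement,
      Complex.sub_re, Complex.add_re, Complex.neg_re, Complex.ofReal_re]
  · linarith [ha.anti i j hij]
  · exact ha.pos i j hij hT
  · linarith [ha.neg i j hij.le hT]

theorem Realizes.mem_peSystem {a : Fin n → ℝ} {T : Fin n → Fin n → Prop} (ha : Realizes a T)
    {δ : Module.Dual ℂ (peCartan n)} {x : peSub n} (hx : x ∈ rootSpace (peCartan n) δ)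
    (hx0 : x ≠ 0) (hδ : 0 < (δ (peElement a)).re) : δ ∈ peSystem T := by
  obtain ⟨p, q, hpq⟩ : ∃ p q, x.1 p q ≠ 0 := by
    by_contra! hall
    exact hx0 (Subtype.ext (Matrix.ext hall))
  have hdiff : ∀ i j : Fin n, δ = eps i - eps j → δ ∈ peSystem T := by
    rintro i j rfl
    simp only [LinearMap.sub_apply, eps_peElement, Complex.sub_re, Complex.ofReal_re] at hδ
    refine Or.inl (Or.inl ⟨i, j, ?_, rfl⟩)
    rcases lt_trichotomy i j with h | rfl | h
    · exact h
    · linarith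
    · linarith [ha.anti j i h]
  have hsum : ∀ i j : Fin n, i ≤ j → δ = eps i + eps j → δ ∈ peSystem T := by
    rintro i j hij rfl
    simp only [LinearMap.add_apply, eps_peElement, Complex.add_re, Complex.ofReal_re] at hδ
    exact Or.inl (Or.inr ⟨i, j, hij, by_contra fun h => by linarith [ha.neg i j hij h], rfl⟩)
  have hneg : ∀ i j : Fin n, i < j → δ = -(eps i + eps j) → δ ∈ peSystem T := by
    rintro i j hij rfl
    simp only [LinearMap.neg_apply, LinearMap.add_apply, eps_peElement, Complex.neg_re,
      Complex.add_re, Complex.ofReal_re] at hδ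
    exact Or.inr ⟨i, j, hij, fun h => by linarith [ha.pos i j hij.le h], rfl⟩
  have hw := mem_pe_rootSpace_iff.1 hx p q hpq
  rcases p with i | i <;> rcases q with j | j
  · exact hdiff i j hw
  · have hw' : δ = eps i + eps j := hw.trans (sub_neg_eq_add _ _)
    rcases le_total i j with h | h
    · exact hsum i j h hw'
    · exact hsum j i h (by rw [hw', add_comm])
  · have hw' : δ = -(eps i + eps j) := by
      rw [hw]
      change -eps i - eps j = _
      abel
    rcases lt_trichotomy i j with h | rfl | h
    · exact hneg i j h hw'
    · exact absurd (self_eq_neg.1 (congrFun (congrFun x.2.2.2 i) i)) hpq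
    · exact hneg j i h (by rw [hw', add_comm])
  · exact hdiff j i (hw.trans (by change -eps i - -eps j = _; abel))

/-- For each step of the chain, elements of the Cartan subalgebra cut out the positive systems
before and after the step. -/
theorem exists_realizes (p : Fin (peSeq n).length) : ∃ a a' : Fin n → ℝ,
    (∀ δ ∈ peRoots n p, 0 < (δ (peElement a)).re) ∧
    (∀ δ ∈ peRoots n (p + 1), 0 < (δ (peElement a')).re) ∧
    (∀ (δ : Module.Dual ℂ (peCartan n)) (x : peSub n), x ∈ rootSpace (peCartan n) δ → x ≠ 0 →
      0 < (δ (peElement a)).re → δ ∈ peRoots n p) ∧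
    (∀ (δ : Module.Dual ℂ (peCartan n)) (x : peSub n), x ∈ rootSpace (peCartan n) δ → x ≠ 0 →
      0 < (δ (peElement a')).re → δ ∈ peRoots n (p + 1)) ∧
    (peGamma n p (peElement a)).re < 0 ∧ 0 < (peGamma n p (peElement a')).re := by
  obtain ⟨⟨s, m⟩, hsm⟩ : ∃ k, (peSeq n).get p = k := ⟨_, rfl⟩
  have hle : s ≤ m := by
    have := peSeq_get_le p
    rwa [hsm] at this
  let T : Fin n → Fin n → Prop := fun i j => j < m ∨ j = m ∧ i < s
  let T' : Fin n → Fin n → Prop := fun i j => j < m ∨ j = m ∧ i ≤ s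
  have hT : peRoots n p = peSystem T := by
    refine peRoots_eq_peSystem fun r => ?_
    rcases lt_trichotomy r p with h | rfl | h
    · have := peSeq_get_lt h
      rw [hsm] at this
      exact ⟨fun _ => h, fun _ => this⟩
    · rw [hsm]
      simp [T]
    · have := peSeq_get_lt h
      rw [hsm] at this
      refine ⟨fun h' => ?_, fun h' => absurd h' (not_lt.2 h.le)⟩
      simp only [T] at h' this
      omega
  have hT' : peRoots n (p + 1) = peSystem T' := by
    refine peRoots_eq_peSystem fun r => ?_
    rcases lt_trichotomy r p with h | rfl | h
    · have := peSeq_get_lt h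
      rw [hsm] at this
      exact ⟨fun _ => Nat.lt_succ_of_lt h, fun _ => this.imp_right fun h => ⟨h.1, h.2.le⟩⟩
    · rw [hsm]
      simp [T']
    · have := peSeq_get_lt h
      rw [hsm] at this
      refine ⟨fun h' => ?_, fun h' => absurd h' (not_lt.2 h)⟩
      simp only [T'] at h' this
      omega
  -- `z` decreases, is positive before `m` and very negative after `m`. Its value `c` at `m` lies
  -- between `-z (s - 1)` and `-z s` before the step, and between `-z s` and `-z (s + 1)` after it,
  -- where for `s = m` only the sign of `c` changes.
  let z : ℤ → Fin n → ℤ := fun c i =>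
    if i < m then 2 * (n - i : ℤ) else if i = m then c else -(4 * n : ℤ) - i
  have hreal : ∀ (c : ℤ) (S : Fin n → Fin n → Prop), (∀ i, i < m → c < 2 * (n - i : ℤ)) →
      -(4 * n : ℤ) < c → (∀ i j : Fin n, m < j → ¬S i j) → (∀ i j : Fin n, j < m → S i j) →
      (∀ i, i < m → S i m → 0 < 2 * (n - i : ℤ) + c) →
      (∀ i, i < m → ¬S i m → 2 * (n - i : ℤ) + c < 0) → (S m m → 0 < c) → (¬S m m → c < 0) →
      c < 2 * n → Realizes (fun i => (z c i : ℝ)) S := by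
    intro c S h1 h2 h3 h4 h5 h6 h7 h8 h9
    refine ⟨fun i j hij => ?_, fun i j hij hS => ?_, fun i j hij hS => ?_⟩
    · have hi := h1 i
      have : z c j < z c i := by
        simp only [z]
        split_ifs <;> omega
      exact_mod_cast this
    · have hj : ¬m < j := fun h => h3 i j h hS
      have hi := h5 i
      have : 0 < z c i + z c j := by
        rcases lt_or_eq_of_le (not_lt.1 hj) with hj | rfl
        · simp only [z]
          split_ifs <;> omega
        · simp only [z]
          rcases lt_or_eq_of_le hij with hij | rfl
          · have := hi hij hS
            split_ifs <;> omega
          · have := h7 hS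
            split_ifs <;> omega
      exact_mod_cast this
    · have hj : ¬j < m := fun h => hS (h4 i j h)
      have hi := h6 i
      have : z c i + z c j < 0 := by
        rcases lt_or_eq_of_le (not_lt.1 hj) with hj | rfl
        · simp only [z]
          split_ifs <;> omega
        · simp only [z]
          rcases lt_or_eq_of_le hij with hij | rfl
          · have := hi hij hS
            split_ifs <;> omega
          · have := h8 hS
            split_ifs <;> omega
      exact_mod_cast this
  have ha : Realizes (fun i => (z (-(2 * (n - s : ℤ) + 1)) i : ℝ)) T := by
    apply hreal <;> (try simp only [T, lt_self_iff_false, true_and, false_or]) <;> intros <;> omega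
  obtain ⟨c, hc⟩ : ∃ c : ℤ, ((s : ℕ) = m ∧ c = 1) ∨
      ((s : ℕ) < m ∧ c = -(2 * (n - s : ℤ) - 1)) := by
    rcases lt_or_eq_of_le hle with h | h
    · exact ⟨_, Or.inr ⟨h, rfl⟩⟩
    · exact ⟨1, Or.inl ⟨congrArg _ h, rfl⟩⟩
  have ha' : Realizes (fun i => (z c i : ℝ)) T' := by
    apply hreal <;> (try simp only [T', lt_self_iff_false, true_and, false_or]) <;> intros <;> omega
  have hγ : peGamma n p = eps s + eps m := by rw [peGamma, hsm]
  refine ⟨_, _, hT ▸ fun δ => ha.re_pos, hT' ▸ fun δ => ha'.re_pos,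
    hT ▸ fun δ x => ha.mem_peSystem, hT' ▸ fun δ x => ha'.mem_peSystem, ?_, ?_⟩
  · rw [hγ, LinearMap.add_apply, eps_peElement, eps_peElement, Complex.add_re, Complex.ofReal_re,
      Complex.ofReal_re]
    exact ha.neg s m hle (by simp [T])
  · rw [hγ, LinearMap.add_apply, eps_peElement, eps_peElement, Complex.add_re, Complex.ofReal_re,
      Complex.ofReal_re]
    exact ha'.pos s m hle (by simp [T'])

/-- The positive roots common to both sides of a step. -/
def peCommon (n p : ℕ) : Set (Module.Dual ℂ (peCartan n)) := peRoots n p ∩ peRoots n (p + 1)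

theorem mem_peCommon_of_mem (p : Fin (peSeq n).length) {δ : Module.Dual ℂ (peCartan n)}
    (hδ : δ ∈ peRoots n p) : δ ∈ peCommon n p ∨ δ = -peGamma n p := by
  rcases hδ with (h | ⟨r, hr, rfl⟩) | ⟨r, hr, hlt, rfl⟩
  · exact Or.inl ⟨Or.inl (Or.inl h), Or.inl (Or.inl h)⟩
  · exact Or.inl ⟨Or.inl (Or.inr ⟨r, hr, rfl⟩), Or.inl (Or.inr ⟨r, Nat.lt_succ_of_lt hr, rfl⟩)⟩
  · rcases Nat.eq_or_lt_of_le hr with h | h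
    · exact Or.inr (by rw [Fin.ext h])
    · exact Or.inl ⟨Or.inr ⟨r, hr, hlt, rfl⟩, Or.inr ⟨r, h, hlt, rfl⟩⟩

theorem mem_peCommon_of_mem_succ (p : Fin (peSeq n).length) {δ : Module.Dual ℂ (peCartan n)}
    (hδ : δ ∈ peRoots n (p + 1)) : δ ∈ peCommon n p ∨ δ = peGamma n p := by
  rcases hδ with (h | ⟨r, hr, rfl⟩) | ⟨r, hr, hlt, rfl⟩
  · exact Or.inl ⟨Or.inl (Or.inl h), Or.inl (Or.inl h)⟩
  · rcases Nat.eq_or_lt_of_le (Nat.lt_succ_iff.1 hr) with h | h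
    · exact Or.inr (by rw [Fin.ext h])
    · exact Or.inl ⟨Or.inl (Or.inr ⟨r, h, rfl⟩), Or.inl (Or.inr ⟨r, hr, rfl⟩)⟩
  · exact Or.inl ⟨Or.inr ⟨r, (Nat.le_succ _).trans hr, hlt, rfl⟩, Or.inr ⟨r, hr, hlt, rfl⟩⟩

theorem pe_isReflection (p : Fin (peSeq n).length) {s m : Fin n} (hsm : (peSeq n).get p = (s, m))
    {f : peSub n} (hf : f ∈ rootSpace (peCartan n) (peGamma n p)) :
    ∃ H, IsReflection (peCartan n) (rootSum (peCartan n) (peCommon n p)) H (peGamma n p) f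
      (cartanBasis s - cartanBasis m) := by
  obtain ⟨a, a', hpos, hpos', hmem, hmem', hneg, hneg'⟩ := exists_realizes p
  have hγ : peGamma n p = eps s + eps m := by rw [peGamma, hsm]
  obtain ⟨b, rfl⟩ := eq_smul_peB (hγ ▸ hf)
  refine ⟨peElement a, peCartan_even, pe_span, fun δ hδ x hx => ?_, hneg,
    rootSum_isGraded peCartan_even _, fun x hx => ?_, hf, Submodule.smul_mem _ _ (peB_odd s m), ?_,
    ?_, fun e he => ?_⟩
  · by_cases hx0 : x = 0
    · rw [hx0]
      exact zero_mem _
    rcases mem_peCommon_of_mem p (hmem δ x hx hx0 hδ) with h | rfl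
    · exact Submodule.mem_sup_left (rootSpace_le_rootSum h hx)
    · exact Submodule.mem_sup_right hx
  · suffices hle : rootSum (peCartan n) (peCommon n p) ≤ (rootSum (peCartan n) (peCommon n p)).comap
        ((br (L := peSub n)).flip (b • peB s m)) from hle hx
    refine iSup₂_le fun β hβ x hx => ?_
    change br x (b • peB s m) ∈ rootSum (peCartan n) (peCommon n p)
    have hbr := br_mem_rootSpace peCartan_even hx hf
    by_cases h0 : br x (b • peB s m) = 0
    · rw [h0]
      exact zero_mem _
    have hre : 0 < ((β + peGamma n p) (peElement a')).re := by
      rw [LinearMap.add_apply, Complex.add_re]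
      linarith [hpos' β hβ.2]
    rcases mem_peCommon_of_mem_succ p (hmem' _ _ hbr h0 hre) with h | h
    · exact rootSpace_le_rootSum h hbr
    · exfalso
      have := hpos β hβ.1
      rw [add_eq_right.1 h] at this
      simp at this
  · rw [map_smul, map_smul, LinearMap.smul_apply, br_peB_peB, smul_zero, smul_zero]
  · rw [hγ, LinearMap.add_apply, eps_sub, eps_sub]
    simp only [eps_cartanBasis, if_true, eq_comm (a := m)]
    ring
  · rw [hγ] at he
    obtain ⟨c, rfl⟩ := eq_smul_peC he
    refine ⟨Submodule.smul_mem _ _ (peC_odd s m), -(c * b), ?_⟩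
    rw [map_smul, map_smul, LinearMap.smul_apply, br_peC_peB, smul_neg, smul_neg, smul_smul,
      neg_smul, mul_comm]

theorem peNil_succ_le (p : Fin (peSeq n).length) {f : peSub n}
    (hf : f ∈ rootSpace (peCartan n) (peGamma n p)) (hf0 : f ≠ 0) :
    peNil n (p + 1) ≤ rootSum (peCartan n) (peCommon n p) ⊔ Submodule.span ℂ {f} := by
  refine iSup₂_le fun β hβ x hx => ?_
  rcases mem_peCommon_of_mem_succ p hβ with h | rfl
  · exact Submodule.mem_sup_left (rootSpace_le_rootSum h hx)
  · obtain ⟨b, rfl⟩ := eq_smul_peB hf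
    obtain ⟨c, rfl⟩ := eq_smul_peB hx
    have hb : b ≠ 0 := by
      rintro rfl
      exact hf0 (zero_smul _ _)
    exact Submodule.mem_sup_right (Submodule.mem_span_singleton.2
      ⟨c / b, by rw [smul_smul, div_mul_cancel₀ _ hb]⟩)

end PeriplecticChain

/-! ### Reflections and inclusions in the periplectic case -/

section PeriplecticReflection

variable {n ℓ : ℕ}

theorem peNil_ge (p : Fin (peSeq n).length) :
    rootSum (peCartan n) (peCommon n p) ⊔ rootSpace (peCartan n) (-peGamma n p) ≤ peNil n p := by
  refine sup_le (biSup_mono fun β hβ => hβ.1) ?_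
  rcases lt_or_eq_of_le (peSeq_get_le p) with hlt | heq
  · exact rootSpace_le_rootSum (Or.inr ⟨p, le_rfl, hlt, rfl⟩)
  · intro e he
    obtain ⟨c, rfl⟩ := eq_smul_peC he
    rw [heq, peC_self, smul_zero]
    exact zero_mem _

theorem peForm_sub (ν : Module.Dual ℂ (peCartan n)) (i j : Fin n) :
    peForm ν (eps i - eps j) = ν (cartanBasis i - cartanBasis j) := by
  simp only [peForm, LinearMap.sub_apply, eps_cartanBasis, mul_sub, Finset.sum_sub_distrib, mul_ite,
    mul_one, mul_zero, Finset.sum_ite_eq, Finset.mem_univ, if_true]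
  exact (map_sub ν _ _).symm

/-- An inclusion of neighbouring Borel subalgebras only occurs for `γ = 2 ε_i`: otherwise the root
space of weight `-γ` is lost. -/
theorem eq_of_isInclusion (p : Fin (peSeq n).length)
    (hp : peBorel n p ≤ peBorel n (p + 1)) : ((peSeq n).get p).1 = ((peSeq n).get p).2 := by
  by_contra hne
  have hlt := lt_of_le_of_ne (peSeq_get_le p) hne
  obtain ⟨⟨s, m⟩, hsm⟩ : ∃ k, (peSeq n).get p = k := ⟨_, rfl⟩
  rw [hsm] at hne hlt
  obtain ⟨a, a', -, hpos', -, -, -, hγpos⟩ := exists_realizes p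
  have hγ : peGamma n p = eps s + eps m := by rw [peGamma, hsm]
  have hC : peC s m ∈ peBorel n p := by
    refine Submodule.mem_sup_right (peNil_ge p (Submodule.mem_sup_right ?_))
    rw [hγ]
    exact peC_mem s m
  have hentry : ∀ x ∈ peBorel n (p + 1), x.1 (Sum.inr s) (Sum.inl m) = 0 := by
    let E : peSub n →ₗ[ℂ] ℂ :=
      { toFun := fun x => x.1 (Sum.inr s) (Sum.inl m)
        map_add' := fun _ _ => rfl
        map_smul' := fun _ _ => rfl }
    suffices hle : peBorel n (p + 1) ≤ LinearMap.ker E from fun x hx => hle hx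
    refine sup_le (fun y hy => hy (by simp)) (iSup₂_le fun δ hδ x hx => ?_)
    by_contra hx0
    have hw : δ = -peGamma n p := by
      rw [mem_pe_rootSpace_iff.1 hx _ _ hx0, hγ]
      change -eps s - eps m = _
      abel
    have := hpos' δ hδ
    rw [hw, LinearMap.neg_apply, Complex.neg_re] at this
    linarith
  have h1 : Matrix.single s m (1 : ℂ) s m - Matrix.single m s (1 : ℂ) s m = 0 :=
    hentry _ (hp hC)
  rw [Matrix.single_apply, Matrix.single_apply] at h1
  simp [Ne.symm hne] at h1

variable {M : Type*} [AddCommGroup M] [Module ℂ M] [LieSuperModule (Takiff (peSub n) ℓ) M]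

theorem pe_highestWeight_self (hM : IsSimpleMod (Takiff (peSub n) ℓ) M)
    (p : Fin (peSeq n).length) {s m : Fin n} (hsm : (peSeq n).get p = (s, m))
    {lam : Module.Dual ℂ (takiffSub (peCartan n) ℓ)} {v : M}
    (hv : IsHighestWeightVector (peCartan n) (peNil n p) ℓ lam v)
    (hlam : ∀ k ≤ ℓ, weightComp lam k (cartanBasis s - cartanBasis m) = 0) :
    ∃ mu, IsHighestWeightVector (peCartan n) (peNil n (p + 1)) ℓ mu v := by
  have hf : peB s m ∈ rootSpace (peCartan n) (peGamma n p) := by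
    rw [peGamma, hsm]
    exact peB_mem s m
  obtain ⟨H, hR⟩ := pe_isReflection p hsm hf
  exact hR.highestWeight_self hM (peNil_ge p) (peNil_succ_le p hf (peB_ne_zero s m)) hv hlam

theorem pe_highestWeight_jetProd (hM : IsSimpleMod (Takiff (peSub n) ℓ) M)
    (p : Fin (peSeq n).length) {s m : Fin n} (hsm : (peSeq n).get p = (s, m))
    {lam : Module.Dual ℂ (takiffSub (peCartan n) ℓ)} {v : M}
    (hv : IsHighestWeightVector (peCartan n) (peNil n p) ℓ lam v)
    {f : peSub n} (hf : f ∈ rootSpace (peCartan n) (peGamma n p)) (hf0 : f ≠ 0) {k : ℕ}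
    (hk : weightComp lam k (cartanBasis s - cartanBasis m) ≠ 0)
    (hlam : ∀ j, k < j → j ≤ ℓ → weightComp lam j (cartanBasis s - cartanBasis m) = 0) :
    ∃ mu, IsHighestWeightVector (peCartan n) (peNil n (p + 1)) ℓ mu (jetProd ℓ f k v) := by
  obtain ⟨H, hR⟩ := pe_isReflection p hsm hf
  have hγ : peGamma n p = eps s + eps m := by rw [peGamma, hsm]
  obtain ⟨b, rfl⟩ := eq_smul_peB (hγ ▸ hf)
  have hb : b ≠ 0 := by
    rintro rfl
    exact hf0 (zero_smul _ _)
  refine hR.highestWeight_jetProd hM (e := -b⁻¹ • peC s m)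
    (Submodule.smul_mem _ _ (hγ ▸ peC_mem s m)) ?_ (peNil_ge p) (peNil_succ_le p hf hf0) hv hk hlam
  rw [map_smul, map_smul, LinearMap.smul_apply, br_peC_peB, neg_smul, smul_neg, smul_neg, smul_neg,
    neg_neg, smul_smul, mul_inv_cancel₀ hb, one_smul]

theorem pe_oddReflection (hM : IsSimpleMod (Takiff (peSub n) ℓ) M)
    (p : Fin (peSeq n).length)
    {lam : Module.Dual ℂ (takiffSub (peCartan n) ℓ)} {v : M}
    (hv : IsHighestWeightVector (peCartan n) (peNil n p) ℓ lam v) :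
    (∀ i j : Fin n, i < j → peGamma n p = eps i + eps j →
      (∀ f ∈ rootSpace (peCartan n) (peGamma n p), f ≠ 0 →
        ∀ k ≤ ℓ, peForm (weightComp lam k) (eps i - eps j) ≠ 0 →
        (∀ m, k < m → m ≤ ℓ → peForm (weightComp lam m) (eps i - eps j) = 0) →
        ∃ mu, IsHighestWeightVector (peCartan n) (peNil n (p + 1)) ℓ mu (jetProd ℓ f k v)) ∧
      ((∀ k ≤ ℓ, peForm (weightComp lam k) (eps i - eps j) = 0) →
        ∃ mu, IsHighestWeightVector (peCartan n) (peNil n (p + 1)) ℓ mu v)) ∧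
    (IsInclusion (peBorel n p) (peBorel n (p + 1)) →
      ∃ mu, IsHighestWeightVector (peCartan n) (peNil n (p + 1)) ℓ mu v) := by
  refine ⟨fun i j hij hγ => ?_, fun hincl => ?_⟩
  · have hget : (peSeq n).get p = (i, j) := by
      have hle := peSeq_get_le p
      rcases eps_add_eps_injective hγ with ⟨h1, h2⟩ | ⟨h1, h2⟩
      · exact Prod.ext h1 h2
      · rw [h1, h2] at hle
        exact absurd hij (not_lt.2 hle)
    simp only [peForm_sub]
    exact ⟨fun f hf hf0 k _ hk hlam => pe_highestWeight_jetProd hM p hget hv hf hf0 hk hlam,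
      fun hlam => pe_highestWeight_self hM p hget hv hlam⟩
  · refine pe_highestWeight_self hM p rfl hv fun k _ => ?_
    rw [eq_of_isInclusion p hincl.1]
    exact (congrArg (weightComp lam k) (sub_self (cartanBasis _))).trans (map_zero _)

end PeriplecticReflection

end TakiffSuper

end

theorem mainTheorem6 (ℓ : ℕ) (hℓ : 0 < ℓ) :
    (∀ {L : Type*} [AddCommGroup L] [Module ℂ L] [LieSuperalgebra L] (h : Submodule ℂ L)
      (_ : IsBasicClassical h) (B : L →ₗ[ℂ] L →ₗ[ℂ] ℂ) (_ : IsInvariantForm B)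
      (H : h) (_ : IsTriangular h H)
      {M : Type*} [AddCommGroup M] [Module ℂ M] [LieSuperModule (Takiff L ℓ) M]
      (_ : IsSimpleMod (Takiff L ℓ) M)
      (_ : InCategoryO M h (h ⊔ rootSum h (posRoots h H)) ℓ)
      (lam : Module.Dual ℂ (takiffSub h ℓ)) (v : M)
      (_ : IsHighestWeightVector h (rootSum h (posRoots h H)) ℓ lam v)
      (α : Module.Dual ℂ h) (_ : α ∈ simpleRoots (posRoots h H)) (_ : α ∈ oddRoots h)
      (_ : dualForm h B α α = 0)
      (f : L) (_ : f ∈ rootSpace h (-α)) (_ : f ≠ 0),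
      (∀ k ≤ ℓ, dualForm h B (weightComp lam k) α ≠ 0 →
        (∀ j, k < j → j ≤ ℓ → dualForm h B (weightComp lam j) α = 0) →
        ∃ mu, IsHighestWeightVector h (rootSum h (oddReflection (posRoots h H) α)) ℓ mu
          (jetProd ℓ f k v)) ∧
      ((∀ k ≤ ℓ, dualForm h B (weightComp lam k) α = 0) →
        ∃ mu, IsHighestWeightVector h (rootSum h (oddReflection (posRoots h H) α)) ℓ mu v)) ∧
    (∀ (n : ℕ) {M : Type*} [AddCommGroup M] [Module ℂ M] [LieSuperModule (Takiff (peSub n) ℓ) M]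
      (_ : IsSimpleMod (Takiff (peSub n) ℓ) M)
      (_ : InCategoryO M (peCartan n) (peCartan n ⊔ rootSum (peCartan n) (peDistinguished n)) ℓ)
      (p : Fin (peSeq n).length)
      (lam : Module.Dual ℂ (takiffSub (peCartan n) ℓ)) (v : M)
      (_ : IsHighestWeightVector (peCartan n) (peNil n p) ℓ lam v),
      (∀ i j : Fin n, i < j → peGamma n p = eps i + eps j →
        (∀ f ∈ rootSpace (peCartan n) (peGamma n p), f ≠ 0 →
          ∀ k ≤ ℓ, peForm (weightComp lam k) (eps i - eps j) ≠ 0 →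
          (∀ m, k < m → m ≤ ℓ → peForm (weightComp lam m) (eps i - eps j) = 0) →
          ∃ mu, IsHighestWeightVector (peCartan n) (peNil n (p + 1)) ℓ mu (jetProd ℓ f k v)) ∧
        ((∀ k ≤ ℓ, peForm (weightComp lam k) (eps i - eps j) = 0) →
          ∃ mu, IsHighestWeightVector (peCartan n) (peNil n (p + 1)) ℓ mu v)) ∧
      (IsInclusion (peBorel n p) (peBorel n (p + 1)) →
        ∃ mu, IsHighestWeightVector (peCartan n) (peNil n (p + 1)) ℓ mu v)) := by
  refine ⟨?_, ?_⟩
  · intro L _ _ _ h hL B hB H hT M _ _ _ hM _ lam v hv α hα hodd hiso f hf hf0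
    exact highestWeight_oddReflection hL hB hT hM hv hα hodd hiso hf hf0
  · intro n M _ _ _ hM _ p lam v hv
    exact pe_oddReflection hM p hv
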